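/- **Proposition 5.7.** Let $k$ be a field and let $H=(H,\Delta,\varepsilon,\Phi,S,\alpha,\beta)$ be a quasi-Hopf algebra over $k$: $H$ is an associative unital $k$-algebra, $\Delta:H\to H\otimes H$ and $\varepsilon:H\to k$ are algebra maps, $\Phi\in H\otimes H\otimes H$ is invertible, $S$ is an anti-automorphism of the algebra $H$, $\alpha,\beta\in H$, and, writing $\Delta(h)=h_1\otimes h_2$, $\Phi=X^1\otimes X^2\otimes X^3=Y^1\otimes Y^2\otimes Y^3$, $\Phi^{-1}=x^1\otimes x^2\otimes x^3$ (summations understood), for all $h\in H$: - $(\mathrm{id}\otimes\Delta)(\Delta(h))=\Phi\,(\Delta\otimes \mathrm{id})(\Delta(h))\,\Phi^{-1}$, $\;(\mathrm{id}\otimes\varepsilon)(\Delta(h))=h\otimes1$, $\;(\varepsilon\otimes \mathrm{id})(\Delta(h))=1\otimes h$; - $(1\otimes\Phi)(\mathrm{id}\otimes\Delta\otimes \mathrm{id})(\Phi)(\Phi\otimes1)=(\mathrm{id}\otimes \mathrm{id}\otimes\Delta)(\Phi)(\Delta\otimes \mathrm{id}\otimes \mathrm{id})(\Phi)$, and applying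 $\varepsilon$ to any one of the three tensor factors of $\Phi$ gives $1\otimes1$; - $S(h_1)\alpha h_2=\varepsilon(h)\alpha$, $\;h_1\beta S(h_2)=\varepsilon(h)\beta$, $\;X^1\beta S(X^2)\alpha X^3=1$, $\;S(x^1)\alpha x^2\beta S(x^3)=1$. *The category.* A left Yetter–Drinfeld module over $H$ is a left $H$-module $M$ with a linear map $\lambda_M:M\to H\otimes M$, $m\mapsto m_{(-1)}\otimes m_{(0)}$, such that for all $m\in M$, $h\in H$ $$X^1m_{(-1)}\otimes(X^2\cdot m_{(0)})_{(-1)}X^3\otimes(X^2\cdot m_{(0)})_{(0)}=X^1(Y^1\cdot m)_{(-1)_1}Y^2\otimes X^2(Y^1\cdot m)_{(-1)_2}Y^3\otimes X^3\cdot(Y^1\cdot m)_{(0)},$$ $$\varepsilon(m_{(-1)})m_{(0)}=m,\qquad h_1m_{(-1)}\otimes h_2\cdot m_{(0)}=(h_1\cdot m)_{(-1)}h_2\otimes(h_1\cdot m)_{(0)}.$$ These modules, with the linear maps that commute with the $H$-actions and the coactions, form a (pre)braided monoidal category ${}_H^H\mathcal{YD}$: the action on $M\otimes N$ is $h\cdot(m\otimes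 n)=h_1\cdot m\otimes h_2\cdot n$, the coaction is $$m\otimes n\mapsto X^1(x^1Y^1\cdot m)_{(-1)}x^2(Y^2\cdot n)_{(-1)}Y^3\otimes X^2\cdot(x^1Y^1\cdot m)_{(0)}\otimes X^3x^3\cdot(Y^2\cdot n)_{(0)},$$ the associativity constraint is $a_{M,N,P}((m\otimes n)\otimes p)=X^1\cdot m\otimes(X^2\cdot n\otimes X^3\cdot p)$, the unit object is $k$ with $h\cdot 1=\varepsilon(h)1$ and $1\mapsto 1\otimes 1$, and the braiding is $c_{M,N}(m\otimes n)=m_{(-1)}\cdot n\otimes m_{(0)}$. An algebra in ${}_H^H\mathcal{YD}$ is an object with a multiplication and a unit that are morphisms of ${}_H^H\mathcal{YD}$ and satisfy the unit laws and associativity up to $a$. The braided tensor product $A\,\underline{\otimes}\,B$ of two such algebras is the object $A\otimes B$ with unit $1_A\otimes1_B$ and multiplication $$(\mu_A\otimes\mu_B)\circ a_{A,A,B\otimes B}^{-1}\circ(\mathrm{id}_A\otimes a_{A,B,B})\circ(\mathrm{id}_A\otimes c_{B,A}\otimes \mathrm{id}_B)\circ(\mathrm{id}_A\otimes a_{B,A,B}^{-1})\circ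 a_{A,B,A\otimes B}.$$ *The objects.* Put $E^1\otimes E^2\otimes E^3\otimes E^4=(\Delta\otimes \mathrm{id}\otimes \mathrm{id})(\Phi)(\Phi^{-1}\otimes1)$, $\delta=E^1\beta S(E^4)\otimes E^2\beta S(E^3)$, $$g^1\otimes g^2=\Delta(S(x^1)\alpha x^2)\,\delta\,(S\otimes S)(\Delta^{\mathrm{cop}}(x^3)),\qquad q^1\otimes q^2=X^1\otimes S^{-1}(\alpha X^3)X^2 ,$$ where $\Delta^{\mathrm{cop}}(h)=h_2\otimes h_1$. For an associative algebra $B$, an algebra map $v:H\to B$ and a linear map $\lambda:B\to H\otimes B$, $b\mapsto b_{[-1]}\otimes b_{[0]}$, let $B^v$ be the vector space $B$ with unit $v(\beta)$, action $h\triangleright b=v(h_1)\,b\,v(S(h_2))$, multiplication $$b\star b'=v(X^1)\,b\,v(S(x^1X^2)\alpha x^2X^3_1)\,b'\,v(S(x^3X^3_2)),$$ and coaction $$b\mapsto X^1Y^1_1b_{[-1]}g^1S(q^2Y^2_2)Y^3\otimes v(X^2Y^1_2)\,b_{[0]}\,v(g^2S(X^3q^1Y^2_1)).$$ Let $H_0$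 be this structure for $B=H$, $v=\mathrm{id}_H$, $\lambda=\Delta$, and let $(H\otimes H)^\Delta$ be this structure for the tensor product algebra $B=H\otimes H$, $v=\Delta$ and $\lambda(h'\otimes h)=\Phi\,(\Delta(h')\otimes h)\,\Phi^{-1}$. *Claim.* $H_0$, $H_0\,\underline{\otimes}\,H_0$ and $(H\otimes H)^\Delta$ are algebras in ${}_H^H\mathcal{YD}$, and $H_0\,\underline{\otimes}\,H_0\cong(H\otimes H)^\Delta$ as algebras in ${}_H^H\mathcal{YD}$; that is, there is a linear bijection between them that is $H$-linear, compatible with the coactions, multiplicative and unital. -/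

import Mathlib

open scoped TensorProduct

noncomputable section

namespace QuasiHopf

section Sandwich

variable {k H : Type*} [Field k] [Ring H] [Algebra k H]

/-- The linear map `a ⊗ b ↦ S(a) α b`. -/
def antipodeLeft (S : H →ₗ[k] H) (α : H) : H ⊗[k] H →ₗ[k] H :=
  LinearMap.mul' k H ∘ₗ TensorProduct.map (LinearMap.mulRight k α ∘ₗ S) LinearMap.id

/-- The linear map `a ⊗ b ↦ a β S(b)`. -/
def antipodeRight (S : H →ₗ[k] H) (β : H) : H ⊗[k] H →ₗ[k] H :=
  LinearMap.mul' k H ∘ₗ TensorProduct.map (LinearMap.mulRight k β) S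

@[simp]
theorem antipodeLeft_tmul (S : H →ₗ[k] H) (α a b : H) :
    antipodeLeft S α (a ⊗ₜ[k] b) = S a * α * b := by
  simp [antipodeLeft]

@[simp]
theorem antipodeRight_tmul (S : H →ₗ[k] H) (β a b : H) :
    antipodeRight S β (a ⊗ₜ[k] b) = a * β * S b := by
  simp [antipodeRight]

end Sandwich

/-- A quasi-bialgebra structure `(Δ, ε, Φ)` on an associative unital `k`-algebra `H`.
The iterated tensor powers of `H` are bracketed to the right, and carry the componentwise
multiplication; `Φ = X¹ ⊗ X² ⊗ X³` and `Φ⁻¹ = x¹ ⊗ x² ⊗ x³`. -/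
structure QuasiBialgebra (k H : Type*) [Field k] [Ring H] [Algebra k H] where
  /-- the comultiplication `Δ` -/
  comul : H →ₐ[k] H ⊗[k] H
  /-- the counit `ε` -/
  counit : H →ₐ[k] k
  /-- the reassociator `Φ` -/
  Φ : (H ⊗[k] (H ⊗[k] H))ˣ
  /-- `(id ⊗ Δ)(Δ(h)) = Φ (Δ ⊗ id)(Δ(h)) Φ⁻¹` -/
  comul_quasi_coassoc : ∀ h : H,
    Algebra.TensorProduct.map (AlgHom.id k H) comul (comul h) =
      Φ.val * TensorProduct.assoc k H H H
        (Algebra.TensorProduct.map comul (AlgHom.id k H) (comul h)) * Φ.inv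
  /-- `(id ⊗ ε)(Δ(h)) = h ⊗ 1` -/
  comul_counit : ∀ h : H,
    Algebra.TensorProduct.map (AlgHom.id k H) counit (comul h) = h ⊗ₜ[k] (1 : k)
  /-- `(ε ⊗ id)(Δ(h)) = 1 ⊗ h` -/
  counit_comul : ∀ h : H,
    Algebra.TensorProduct.map counit (AlgHom.id k H) (comul h) = (1 : k) ⊗ₜ[k] h
  /-- `(1 ⊗ Φ) (id ⊗ Δ ⊗ id)(Φ) (Φ ⊗ 1) = (id ⊗ id ⊗ Δ)(Φ) (Δ ⊗ id ⊗ id)(Φ)`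
  in `H ⊗ (H ⊗ (H ⊗ H))` -/
  pentagon :
    ((1 : H) ⊗ₜ[k] Φ.val) *
      TensorProduct.map LinearMap.id
        ((TensorProduct.assoc k H H H).toLinearMap ∘ₗ
          TensorProduct.map comul.toLinearMap LinearMap.id) Φ.val *
      TensorProduct.map LinearMap.id
        (TensorProduct.map LinearMap.id
          ((Algebra.TensorProduct.includeLeft : H →ₐ[k] H ⊗[k] H).toLinearMap)) Φ.val =
    TensorProduct.map LinearMap.id (TensorProduct.map LinearMap.id comul.toLinearMap) Φ.val *
      TensorProduct.assoc k H H (H ⊗[k] H)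
        (TensorProduct.map comul.toLinearMap LinearMap.id Φ.val)
  /-- `(ε ⊗ id ⊗ id)(Φ) = 1` -/
  counit_left : Algebra.TensorProduct.map counit (AlgHom.id k (H ⊗[k] H)) Φ.val = 1
  /-- `(id ⊗ ε ⊗ id)(Φ) = 1` -/
  counit_middle : Algebra.TensorProduct.map (AlgHom.id k H)
    (Algebra.TensorProduct.map counit (AlgHom.id k H)) Φ.val = 1
  /-- `(id ⊗ id ⊗ ε)(Φ) = 1` -/
  counit_right : Algebra.TensorProduct.map (AlgHom.id k H)
    (Algebra.TensorProduct.map (AlgHom.id k H) counit) Φ.val = 1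

/-- A quasi-Hopf algebra structure on `H`: a quasi-bialgebra with an algebra anti-automorphism `S`
and elements `α`, `β`. -/
structure QuasiHopfAlgebra (k H : Type*) [Field k] [Ring H] [Algebra k H] extends
    QuasiBialgebra k H where
  /-- the antipode, a bijective linear map -/
  S : H ≃ₗ[k] H
  S_one : S 1 = 1
  S_mul : ∀ a b : H, S (a * b) = S b * S a
  α : H
  β : H
  /-- `S(h₁) α h₂ = ε(h) α` -/
  antipode_left : ∀ h : H, antipodeLeft S.toLinearMap α (comul h) = counit h • α
  /-- `h₁ β S(h₂) = ε(h) β` -/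
  antipode_right : ∀ h : H, antipodeRight S.toLinearMap β (comul h) = counit h • β
  /-- `X¹ β S(X²) α X³ = 1` -/
  antipode_Φ :
    LinearMap.mul' k H (TensorProduct.map (LinearMap.mulRight k β)
      (antipodeLeft S.toLinearMap α) Φ.val) = 1
  /-- `S(x¹) α x² β S(x³) = 1` -/
  antipode_Φ_inv :
    LinearMap.mul' k H (TensorProduct.map (LinearMap.mulRight k α ∘ₗ S.toLinearMap)
      (antipodeRight S.toLinearMap β) Φ.inv) = 1

/-! ### Modules over a quasi-bialgebra, coactions, and algebras in the Yetter-Drinfeld category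

An action of `H` on a `k`-space `M` is given by a bilinear map `H → M → M`. -/

section Category

variable {k H : Type*} [Field k] [Ring H] [Algebra k H] (Q : QuasiBialgebra k H)
variable {M N P : Type*} [AddCommGroup M] [Module k M] [AddCommGroup N] [Module k N]
  [AddCommGroup P] [Module k P]

/-- The tensor product action `h · (m ⊗ n) = h₁ · m ⊗ h₂ · n`. -/
def tensorAct (aM : H →ₗ[k] M →ₗ[k] M) (aN : H →ₗ[k] N →ₗ[k] N) :
    H →ₗ[k] M ⊗[k] N →ₗ[k] M ⊗[k] N :=
  TensorProduct.map₂ aM aN ∘ₗ Q.comul.toLinearMap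

/-- The associativity constraint
`(m ⊗ n) ⊗ p ↦ X¹ · m ⊗ (X² · n ⊗ X³ · p)`. -/
def associator (aM : H →ₗ[k] M →ₗ[k] M) (aN : H →ₗ[k] N →ₗ[k] N) (aP : H →ₗ[k] P →ₗ[k] P) :
    (M ⊗[k] N) ⊗[k] P →ₗ[k] M ⊗[k] (N ⊗[k] P) :=
  TensorProduct.map₂ aM (TensorProduct.map₂ aN aP) Q.Φ.val ∘ₗ
    (TensorProduct.assoc k M N P).toLinearMap

/-- The inverse associativity constraint
`m ⊗ (n ⊗ p) ↦ (x¹ · m ⊗ x² · n) ⊗ x³ · p`. -/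
def associatorInv (aM : H →ₗ[k] M →ₗ[k] M) (aN : H →ₗ[k] N →ₗ[k] N)
    (aP : H →ₗ[k] P →ₗ[k] P) :
    M ⊗[k] (N ⊗[k] P) →ₗ[k] (M ⊗[k] N) ⊗[k] P :=
  (TensorProduct.assoc k M N P).symm.toLinearMap ∘ₗ
    TensorProduct.map₂ aM (TensorProduct.map₂ aN aP) Q.Φ.inv

/-- For a linear map `δ : M → B ⊗ M`, `δ(m) = m₍₋₁₎ ⊗ m₍₀₎`, with values in an algebra `B`
tensor `M`, the map `M ⊗ B → B ⊗ M`, `m ⊗ b ↦ m₍₋₁₎ b ⊗ m₍₀₎`. -/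
def coactMul {B : Type*} [Ring B] [Algebra k B] (δ : M →ₗ[k] B ⊗[k] M) :
    M ⊗[k] B →ₗ[k] B ⊗[k] M :=
  TensorProduct.map (LinearMap.mul' k B) LinearMap.id ∘ₗ
    (TensorProduct.rightComm k B M B).toLinearMap ∘ₗ
    TensorProduct.map δ LinearMap.id

/-- The left regular action of `H` on itself. -/
abbrev regAct : H →ₗ[k] H →ₗ[k] H := LinearMap.mul k H

/-- The coaction on the tensor product of two Yetter-Drinfeld modules,
`m ⊗ n ↦ X¹ (x¹Y¹ · m)₍₋₁₎ x² (Y² · n)₍₋₁₎ Y³ ⊗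
  (X² · (x¹Y¹ · m)₍₀₎ ⊗ X³x³ · (Y² · n)₍₀₎)`.

It is built in steps: `(m ⊗ n) ⊗ 1 ↦ Y¹·m ⊗ (Y²·n ⊗ Y³) ↦ m' ⊗ (h ⊗ n')` with
`m' = Y¹·m`, `h ⊗ n' = (Y²·n)₍₋₁₎ Y³ ⊗ (Y²·n)₍₀₎`; then
`m' ⊗ (h ⊗ n') ↦ (x¹·m' ⊗ x² h) ⊗ x³·n' ↦ ((x¹·m')₍₋₁₎ x² h ⊗ (x¹·m')₍₀₎) ⊗ x³·n'`; and finally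
`Φ` is applied to the three factors. -/
def tensorCoact (aM : H →ₗ[k] M →ₗ[k] M) (cM : M →ₗ[k] H ⊗[k] M)
    (aN : H →ₗ[k] N →ₗ[k] N) (cN : N →ₗ[k] H ⊗[k] N) :
    M ⊗[k] N →ₗ[k] H ⊗[k] (M ⊗[k] N) :=
  associator Q regAct aM aN ∘ₗ
    TensorProduct.map (coactMul cM) LinearMap.id ∘ₗ
    associatorInv Q aM regAct aN ∘ₗ
    TensorProduct.map LinearMap.id (coactMul cN) ∘ₗ
    associator Q aM aN regAct ∘ₗ
    (TensorProduct.mk k (M ⊗[k] N) H).flip 1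

/-- The braiding `m ⊗ n ↦ m₍₋₁₎ · n ⊗ m₍₀₎`. -/
def braiding (cM : M →ₗ[k] H ⊗[k] M) (aN : H →ₗ[k] N →ₗ[k] N) :
    M ⊗[k] N →ₗ[k] N ⊗[k] M :=
  TensorProduct.map (TensorProduct.lift aN) LinearMap.id ∘ₗ
    (TensorProduct.rightComm k H M N).toLinearMap ∘ₗ
    TensorProduct.map cM LinearMap.id

theorem associator_tmul (aM : H →ₗ[k] M →ₗ[k] M) (aN : H →ₗ[k] N →ₗ[k] N)
    (aP : H →ₗ[k] P →ₗ[k] P) (m : M) (n : N) (p : P) :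
    associator Q aM aN aP ((m ⊗ₜ n) ⊗ₜ p) =
      TensorProduct.map (aM.flip m) (TensorProduct.map (aN.flip n) (aP.flip p)) Q.Φ.val := by
  simp only [associator, LinearMap.comp_apply, LinearEquiv.coe_coe, TensorProduct.assoc_tmul]
  induction Q.Φ.val using TensorProduct.induction_on with
  | zero => simp
  | add x y hx hy => simp [hx, hy]
  | tmul a t =>
    induction t using TensorProduct.induction_on with
    | zero => simp
    | add x y hx hy => simp_all [TensorProduct.tmul_add]
    | tmul b c => simp

theorem coactMul_tmul {B : Type*} [Ring B] [Algebra k B] (δ : M →ₗ[k] B ⊗[k] M) (m : M) (b : B) :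
    coactMul δ (m ⊗ₜ b) = TensorProduct.map (LinearMap.mulRight k b) LinearMap.id (δ m) := by
  simp only [coactMul, LinearMap.comp_apply, TensorProduct.map_tmul, LinearEquiv.coe_coe]
  induction δ m using TensorProduct.induction_on with
  | zero => simp
  | add x y hx hy => simp_all [TensorProduct.add_tmul]
  | tmul a c => simp

theorem braiding_tmul (cM : M →ₗ[k] H ⊗[k] M) (aN : H →ₗ[k] N →ₗ[k] N) (m : M) (n : N) :
    braiding cM aN (m ⊗ₜ n) = TensorProduct.map (aN.flip n) LinearMap.id (cM m) := by
  simp only [braiding, LinearMap.comp_apply, TensorProduct.map_tmul, LinearEquiv.coe_coe]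
  induction cM m using TensorProduct.induction_on with
  | zero => simp
  | add x y hx hy => simp_all [TensorProduct.add_tmul]
  | tmul a c => simp

/-- `(M, aM, cM)` is a left Yetter-Drinfeld module over the quasi-bialgebra `H`. -/
structure IsYetterDrinfeld (aM : H →ₗ[k] M →ₗ[k] M) (cM : M →ₗ[k] H ⊗[k] M) : Prop where
  one_act : ∀ m : M, aM 1 m = m
  mul_act : ∀ (g h : H) (m : M), aM (g * h) m = aM g (aM h m)
  /-- `X¹ m₍₋₁₎ ⊗ (X² · m₍₀₎)₍₋₁₎ X³ ⊗ (X² · m₍₀₎)₍₀₎ =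
    X¹ (Y¹ · m)₍₋₁₎₁ Y² ⊗ X² (Y¹ · m)₍₋₁₎₂ Y³ ⊗ X³ · (Y¹ · m)₍₀₎` in `H ⊗ (H ⊗ M)` -/
  quasi_coassoc : ∀ m : M,
    TensorProduct.map LinearMap.id (coactMul cM)
        (associator Q regAct aM regAct (cM m ⊗ₜ[k] (1 : H))) =
      associator Q regAct regAct aM
        (coactMul (TensorProduct.map Q.comul.toLinearMap LinearMap.id ∘ₗ cM)
          (TensorProduct.map (aM.flip m) LinearMap.id Q.Φ.val))
  /-- `ε(m₍₋₁₎) m₍₀₎ = m` -/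
  counit_coact : ∀ m : M,
    TensorProduct.lid k M (TensorProduct.map Q.counit.toLinearMap LinearMap.id (cM m)) = m
  /-- `h₁ m₍₋₁₎ ⊗ h₂ · m₍₀₎ = (h₁ · m)₍₋₁₎ h₂ ⊗ (h₁ · m)₍₀₎` -/
  compat : ∀ (h : H) (m : M),
    tensorAct Q regAct aM h (cM m) =
      coactMul cM (TensorProduct.map (aM.flip m) LinearMap.id (Q.comul h))

end Category

/-- The structure maps that an algebra in the category of left Yetter-Drinfeld modules over `H`
has on its underlying space `A`; the laws are in `YDAlgebraData.IsAlgebra`. -/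
structure YDAlgebraData (k H A : Type*) [Field k] [Ring H] [Algebra k H]
    [AddCommGroup A] [Module k A] where
  act : H →ₗ[k] A →ₗ[k] A
  coact : A →ₗ[k] H ⊗[k] A
  mul : A ⊗[k] A →ₗ[k] A
  one : A

namespace YDAlgebraData

variable {k H : Type*} [Field k] [Ring H] [Algebra k H]
variable {A B : Type*} [AddCommGroup A] [Module k A] [AddCommGroup B] [Module k B]

/-- `X` is an algebra in the monoidal category of left Yetter-Drinfeld modules over `H`:
a Yetter-Drinfeld module with an associative (up to the associativity constraint) and unital
multiplication such that multiplication and unit are `H`-linear and `H`-colinear. -/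
structure IsAlgebra (Q : QuasiBialgebra k H) (X : YDAlgebraData k H A) : Prop where
  isYetterDrinfeld : IsYetterDrinfeld Q X.act X.coact
  /-- `(a a') a'' = (X¹ · a) ((X² · a') (X³ · a''))` -/
  mul_assoc : ∀ a b c : A,
    X.mul (X.mul (a ⊗ₜ b) ⊗ₜ c) =
      X.mul (TensorProduct.map LinearMap.id X.mul
        (associator Q X.act X.act X.act ((a ⊗ₜ b) ⊗ₜ c)))
  one_mul : ∀ a : A, X.mul (X.one ⊗ₜ a) = a
  mul_one : ∀ a : A, X.mul (a ⊗ₜ X.one) = a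
  /-- `h · (a a') = (h₁ · a) (h₂ · a')` -/
  act_mul : ∀ (h : H) (a b : A),
    X.act h (X.mul (a ⊗ₜ b)) = X.mul (tensorAct Q X.act X.act h (a ⊗ₜ b))
  act_one : ∀ h : H, X.act h X.one = Q.counit h • X.one
  coact_mul : ∀ a b : A,
    X.coact (X.mul (a ⊗ₜ b)) =
      TensorProduct.map LinearMap.id X.mul
        (tensorCoact Q X.act X.coact X.act X.coact (a ⊗ₜ b))
  coact_one : X.coact X.one = (1 : H) ⊗ₜ X.one

/-- An isomorphism of algebras in the Yetter-Drinfeld category: a linear bijection that is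
`H`-linear, `H`-colinear, multiplicative and unital. -/
structure Iso (X : YDAlgebraData k H A) (Y : YDAlgebraData k H B) extends A ≃ₗ[k] B where
  map_act : ∀ (h : H) (a : A), toLinearEquiv (X.act h a) = Y.act h (toLinearEquiv a)
  map_coact : ∀ a : A,
    Y.coact (toLinearEquiv a) =
      TensorProduct.map LinearMap.id toLinearEquiv.toLinearMap (X.coact a)
  map_mul : ∀ a b : A,
    toLinearEquiv (X.mul (a ⊗ₜ b)) = Y.mul (toLinearEquiv a ⊗ₜ toLinearEquiv b)
  map_one : toLinearEquiv X.one = Y.one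

/-- The braided tensor product `A ⊗ B` of two algebras in the Yetter-Drinfeld category: the
tensor product Yetter-Drinfeld module with unit `1 ⊗ 1` and multiplication
`(μ_A ⊗ μ_B) ∘ a⁻¹_{A,A,B⊗B} ∘ (id ⊗ a_{A,B,B}) ∘ (id ⊗ (c_{B,A} ⊗ id)) ∘ (id ⊗ a⁻¹_{B,A,B}) ∘
a_{A,B,A⊗B}`, where `a` is the associativity constraint and `c` is the braiding. -/
def braidedTensor (Q : QuasiBialgebra k H) (X : YDAlgebraData k H A) (Y : YDAlgebraData k H B) :
    YDAlgebraData k H (A ⊗[k] B) where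
  act := tensorAct Q X.act Y.act
  coact := tensorCoact Q X.act X.coact Y.act Y.coact
  mul :=
    TensorProduct.map X.mul Y.mul ∘ₗ
      associatorInv Q X.act X.act (tensorAct Q Y.act Y.act) ∘ₗ
      TensorProduct.map LinearMap.id (associator Q X.act Y.act Y.act) ∘ₗ
      TensorProduct.map LinearMap.id
        (TensorProduct.map (braiding Y.coact X.act) LinearMap.id) ∘ₗ
      TensorProduct.map LinearMap.id (associatorInv Q Y.act X.act Y.act) ∘ₗ
      associator Q X.act Y.act (tensorAct Q X.act Y.act)
  one := X.one ⊗ₜ Y.one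

end YDAlgebraData

namespace QuasiHopfAlgebra

variable {k H : Type*} [Field k] [Ring H] [Algebra k H] (Q : QuasiHopfAlgebra k H)

/-- `B¹ ⊗ B² ⊗ B³ ⊗ B⁴ = (Δ ⊗ id ⊗ id)(Φ) (Φ⁻¹ ⊗ 1)`, in `H ⊗ (H ⊗ (H ⊗ H))`. -/
def elementB : H ⊗[k] (H ⊗[k] (H ⊗[k] H)) :=
  TensorProduct.assoc k H H (H ⊗[k] H)
      (TensorProduct.map Q.comul.toLinearMap LinearMap.id Q.Φ.val) *
    TensorProduct.map LinearMap.id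
      (TensorProduct.map LinearMap.id
        ((Algebra.TensorProduct.includeLeft : H →ₐ[k] H ⊗[k] H).toLinearMap)) Q.Φ.inv

/-- The linear map `a ⊗ (b ⊗ (c ⊗ d)) ↦ a β S(d) ⊗ b β S(c)`. -/
def deltaMap : H ⊗[k] (H ⊗[k] (H ⊗[k] H)) →ₗ[k] H ⊗[k] H :=
  TensorProduct.map (antipodeRight Q.S.toLinearMap Q.β) (antipodeRight Q.S.toLinearMap Q.β) ∘ₗ
    (TensorProduct.tensorTensorTensorComm k H H H H).toLinearMap ∘ₗ
    TensorProduct.map LinearMap.id (TensorProduct.comm k H H).toLinearMap ∘ₗ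
    (TensorProduct.assoc k H H (H ⊗[k] H)).symm.toLinearMap

/-- `δ = B¹ β S(B⁴) ⊗ B² β S(B³)`. -/
def delta : H ⊗[k] H := Q.deltaMap Q.elementB

/-- The linear map `c ↦ (S ⊗ S)(Δᶜᵒᵖ(c)) = S(c₂) ⊗ S(c₁)`. -/
def antipodeCop : H →ₗ[k] H ⊗[k] H :=
  TensorProduct.map Q.S.toLinearMap Q.S.toLinearMap ∘ₗ
    (TensorProduct.comm k H H).toLinearMap ∘ₗ Q.comul.toLinearMap

/-- The linear map `a ⊗ (b ⊗ c) ↦ Δ(S(a) α b) δ (S ⊗ S)(Δᶜᵒᵖ(c))`. -/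
def twistInvMap : H ⊗[k] (H ⊗[k] H) →ₗ[k] H ⊗[k] H :=
  LinearMap.mul' k (H ⊗[k] H) ∘ₗ
    TensorProduct.map
      (LinearMap.mulRight k Q.delta ∘ₗ Q.comul.toLinearMap ∘ₗ antipodeLeft Q.S.toLinearMap Q.α)
      Q.antipodeCop ∘ₗ
    (TensorProduct.assoc k H H H).symm.toLinearMap

/-- The inverse of the Drinfeld twist,
`f⁻¹ = g¹ ⊗ g² = Δ(S(x¹) α x²) δ (S ⊗ S)(Δᶜᵒᵖ(x³))`. -/
def twistInv : H ⊗[k] H := Q.twistInvMap Q.Φ.inv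

/-- The linear map `b ⊗ c ↦ S⁻¹(α c) b`. -/
def qMap : H ⊗[k] H →ₗ[k] H :=
  LinearMap.mul' k H ∘ₗ
    TensorProduct.map (Q.S.symm.toLinearMap ∘ₗ LinearMap.mulLeft k Q.α) LinearMap.id ∘ₗ
    (TensorProduct.comm k H H).toLinearMap

/-- `q_R = q¹ ⊗ q² = X¹ ⊗ S⁻¹(α X³) X²`. -/
def qR : H ⊗[k] H := TensorProduct.map LinearMap.id Q.qMap Q.Φ.val

/-- `X¹ ⊗ (x¹X² ⊗ (x²X³₁ ⊗ x³X³₂)) = (1 ⊗ Φ⁻¹) (id ⊗ id ⊗ Δ)(Φ)`. -/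
def starElement : H ⊗[k] (H ⊗[k] (H ⊗[k] H)) :=
  ((1 : H) ⊗ₜ[k] Q.Φ.inv) *
    TensorProduct.map LinearMap.id (TensorProduct.map LinearMap.id Q.comul.toLinearMap) Q.Φ.val

/-- The linear map `b ⊗ (c ⊗ d) ↦ S(b) α c ⊗ S(d)`. -/
def starMap : H ⊗[k] (H ⊗[k] H) →ₗ[k] H ⊗[k] H :=
  TensorProduct.map (antipodeLeft Q.S.toLinearMap Q.α) Q.S.toLinearMap ∘ₗ
    (TensorProduct.assoc k H H H).symm.toLinearMap

/-- `P¹ ⊗ (P² ⊗ P³) = X¹ ⊗ (S(x¹X²) α x²X³₁ ⊗ S(x³X³₂))`. -/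
def elementP : H ⊗[k] (H ⊗[k] H) :=
  TensorProduct.map LinearMap.id Q.starMap Q.starElement

/-- The element
`(X¹Y¹₁ ⊗ X²Y¹₂) ⊗ (X³q¹Y²₁ ⊗ (q²Y²₂ ⊗ Y³))` of `(H ⊗ H) ⊗ (H ⊗ (H ⊗ H))`. -/
def coactElement : (H ⊗[k] H) ⊗[k] (H ⊗[k] (H ⊗[k] H)) :=
  TensorProduct.map LinearMap.id
      ((Algebra.TensorProduct.includeLeft : H →ₐ[k] H ⊗[k] (H ⊗[k] H)).toLinearMap)
      ((TensorProduct.assoc k H H H).symm Q.Φ.val) *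
    ((1 : H ⊗[k] H) ⊗ₜ[k] TensorProduct.map LinearMap.id
      ((Algebra.TensorProduct.includeLeft : H →ₐ[k] H ⊗[k] H).toLinearMap) Q.qR) *
    TensorProduct.map Q.comul.toLinearMap
      ((TensorProduct.assoc k H H H).toLinearMap ∘ₗ
        TensorProduct.map Q.comul.toLinearMap LinearMap.id) Q.Φ.val

/-- The linear map `a ⊗ (b ⊗ c) ↦ g¹ S(b) c ⊗ g² S(a)`. -/
def coactRightMap : H ⊗[k] (H ⊗[k] H) →ₗ[k] H ⊗[k] H :=
  LinearMap.mulLeft k Q.twistInv ∘ₗ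
    (TensorProduct.comm k H H).toLinearMap ∘ₗ
    TensorProduct.map Q.S.toLinearMap (antipodeLeft Q.S.toLinearMap 1)

/-- `(X¹Y¹₁ ⊗ X²Y¹₂) ⊗ (g¹ S(q²Y²₂) Y³ ⊗ g² S(X³q¹Y²₁))`. -/
def elementK : (H ⊗[k] H) ⊗[k] (H ⊗[k] H) :=
  TensorProduct.map LinearMap.id Q.coactRightMap Q.coactElement

section Twisted

variable {B : Type*} [Ring B] [Algebra k B] (v : H →ₐ[k] B)

/-- The bilinear map sending `c ⊗ d` and `b` to `c b d`. -/
def bimul : B ⊗[k] B →ₗ[k] B →ₗ[k] B :=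
  TensorProduct.lift ((LinearMap.llcomp k B B B).compl₁₂ (LinearMap.mul k B)
    (LinearMap.mul k B).flip)

@[simp]
theorem bimul_tmul (c d b : B) : bimul (k := k) (c ⊗ₜ[k] d) b = c * b * d := by
  simp [bimul, _root_.mul_assoc]

/-- The action `h ▷ b = v(h₁) b v(S(h₂))` of `H` on `B`. -/
def twistedAct : H →ₗ[k] B →ₗ[k] B :=
  bimul ∘ₗ TensorProduct.map v.toLinearMap (v.toLinearMap ∘ₗ Q.S.toLinearMap) ∘ₗ
    Q.comul.toLinearMap

/-- The multiplication `b ⋆ b' = v(P¹) b v(P²) b' v(P³)`, that is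
`b ⋆ b' = v(X¹) b v(S(x¹X²) α x²X³₁) b' v(S(x³X³₂))`. -/
def twistedMul : B →ₗ[k] B →ₗ[k] B :=
  LinearMap.mk₂ k
    (fun b b' => bimul
      (TensorProduct.map v.toLinearMap
        (bimul.flip b' ∘ₗ TensorProduct.map v.toLinearMap v.toLinearMap) Q.elementP) b)
    (fun _ _ _ => map_add _ _ _)
    (fun _ _ _ => map_smul _ _ _)
    (fun _ _ _ => by
      simp [LinearMap.add_comp, TensorProduct.map_add_right])
    (fun _ _ _ => by
      simp [LinearMap.smul_comp, TensorProduct.map_smul_right])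

/-- The coaction
`b ↦ X¹Y¹₁ b₍₋₁₎ g¹ S(q²Y²₂) Y³ ⊗ v(X²Y¹₂) b₍₀₎ v(g² S(X³q¹Y²₁))` built from a linear map
`lam : B → H ⊗ B`, `lam(b) = b₍₋₁₎ ⊗ b₍₀₎`. -/
def twistedCoact (lam : B →ₗ[k] H ⊗[k] B) : B →ₗ[k] H ⊗[k] B :=
  bimul
    (TensorProduct.map (TensorProduct.map LinearMap.id v.toLinearMap)
      (TensorProduct.map LinearMap.id v.toLinearMap) Q.elementK) ∘ₗ lam

/-- The algebra `Bᵛ` in the Yetter-Drinfeld category attached to an associative algebra `B`, an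
algebra map `v : H → B` and a coaction `lam : B → H ⊗ B`. -/
def twistedAlgebra (lam : B →ₗ[k] H ⊗[k] B) : YDAlgebraData k H B where
  act := Q.twistedAct v
  coact := Q.twistedCoact v lam
  mul := TensorProduct.lift (Q.twistedMul v)
  one := v Q.β

end Twisted

/-- `H₀`, the case `B = H`, `v = id`, `lam = Δ`: the unit is `β`, the action is
`h ▷ h' = h₁ h' S(h₂)`, the multiplication is
`h * h' = X¹ h S(x¹X²) α x²X³₁ h' S(x³X³₂)`, and the coaction is
`h ↦ X¹Y¹₁ h₁ g¹ S(q²Y²₂) Y³ ⊗ X²Y¹₂ h₂ g² S(X³q¹Y²₁)`. -/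
def H₀ : YDAlgebraData k H H :=
  Q.twistedAlgebra (AlgHom.id k H) Q.comul.toLinearMap

/-- The coaction `h' ⊗ h ↦ Φ (Δ(h') ⊗ h) Φ⁻¹` on the tensor product algebra `H ⊗ H`. -/
def squareCoact : H ⊗[k] H →ₗ[k] H ⊗[k] (H ⊗[k] H) :=
  LinearMap.mulRight k Q.Φ.inv ∘ₗ LinearMap.mulLeft k Q.Φ.val ∘ₗ
    (TensorProduct.assoc k H H H).toLinearMap ∘ₗ
    TensorProduct.map Q.comul.toLinearMap LinearMap.id

/-- `(H ⊗ H)^Δ`, the case where `B` is the tensor product algebra `H ⊗ H`, `v = Δ` and `lam` is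
`h' ⊗ h ↦ Φ (Δ(h') ⊗ h) Φ⁻¹`. -/
def squareΔ : YDAlgebraData k H (H ⊗[k] H) :=
  Q.twistedAlgebra Q.comul Q.squareCoact

end QuasiHopfAlgebra

end QuasiHopf

end

/-! The twisted structures are honest associative structures seen through a retraction. Let C be an
algebra with an algebra map v : H → C and an algebra map lam : C → H ⊗ C that is a coaction up to
conjugation by Φ. A dressing of M is a linear map D : M → C with v(h) D(m) = D(h₁·m) v(h₂), with a
matching rule for coactions and, for algebras, with D(1) = 1 and D(ab) = D(X¹·a) D(X²·b) v(X³).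
Suppose that κ : C → M is linear, κ(c v(h)) = ε(h) κ(c) and κ D = id. Then h·m = κ(v(h) D(m)), ab =
κ(D(a) D(b)), and the coaction is (id ⊗ κ) lam D. Every axiom of an algebra in the Yetter–Drinfeld
category becomes a consequence of strict associativity in C and of the comodule algebra axioms
(`isYetterDrinfeld_of_dressing`, `YDAlgebraData.IsDressing.isAlgebra`).

If B is a comodule algebra, so is B ⊗ H, with h ↦ v(h₁) ⊗ h₂ and with the coaction of B conjugated
by Φ. The map `dress` sends b to v(X¹) b v(S(y¹X²)αy²X³₁) ⊗ y³X³₂, where y¹ ⊗ y² ⊗ y³ = Φ⁻¹, and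
`undress` sends b ⊗ h to b v(β S(h)). They play the roles of D and κ for Bᵛ
(`twistedAlgebra_isDressing`). The delicate point is the coaction: the inverse Drinfeld twist is
eliminated from it by `twistInv_mul_antipodeSwap_qR`. The cases B = H and B = H ⊗ H settle two of
the three algebra claims.

For the isomorphism, H₀ is dressed twice in (H ⊗ H) ⊗ H, by `dressLeft` and `dressRight`. The two
copies commute up to the braiding (`dressMul_braiding`), so their product carries the braided
multiplication to the multiplication of (H ⊗ H) ⊗ H. By the universal property
`dress_undress_liftDress` this product factors through `dress`, which gives `squareMap` together
with its compatibility with all structure maps. Up to an invertible reparametrization by Φ⁻¹,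
`squareMap` is a ⊗ h ↦ D(a) Δ(h), whose bijectivity is checked directly. The braided square is then
an algebra by transport along the isomorphism. -/

noncomputable section

set_option maxSynthPendingDepth 3

namespace QuasiHopf

/-! ### Reduction to pure tensors in iterated tensor products -/

section TensorInduction

variable {R A B C D : Type*} [CommSemiring R] [AddCommMonoid A] [AddCommMonoid B]
  [AddCommMonoid C] [AddCommMonoid D] [Module R A] [Module R B] [Module R C] [Module R D]

theorem tensor_induction {p : A ⊗[R] B → Prop} (t : A ⊗[R] B) (zero : p 0)
    (add : ∀ x y, p x → p y → p (x + y)) (tmul : ∀ a b, p (a ⊗ₜ b)) : p t :=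
  TensorProduct.induction_on t zero tmul add

/-- The identities below are linear in Φ, in Φ⁻¹ and in each coproduct. Once such an element is
generalized to an arbitrary tensor, this induction leaves a Sweedler computation on pure tensors. -/
theorem tensor_induction_right {p : A ⊗[R] (B ⊗[R] C) → Prop} (t : A ⊗[R] (B ⊗[R] C)) (zero : p 0)
    (add : ∀ x y, p x → p y → p (x + y)) (tmul : ∀ a b c, p (a ⊗ₜ (b ⊗ₜ c))) : p t := by
  refine TensorProduct.induction_on t zero (fun a s => ?_) add
  refine TensorProduct.induction_on s (by simpa using zero) (fun b c => tmul a b c) ?_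
  intro x y hx hy
  rw [TensorProduct.tmul_add]
  exact add _ _ hx hy

theorem tensor_induction_left {p : (A ⊗[R] B) ⊗[R] C → Prop} (t : (A ⊗[R] B) ⊗[R] C) (zero : p 0)
    (add : ∀ x y, p x → p y → p (x + y)) (tmul : ∀ a b c, p ((a ⊗ₜ b) ⊗ₜ c)) : p t := by
  refine TensorProduct.induction_on t zero (fun s c => ?_) add
  refine TensorProduct.induction_on s (by simpa using zero) (fun a b => tmul a b c) ?_
  intro x y hx hy
  rw [TensorProduct.add_tmul]
  exact add _ _ hx hy

theorem tensor_induction_right_right {p : A ⊗[R] (B ⊗[R] (C ⊗[R] D)) → Prop}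
    (t : A ⊗[R] (B ⊗[R] (C ⊗[R] D))) (zero : p 0)
    (add : ∀ x y, p x → p y → p (x + y)) (tmul : ∀ a b c d, p (a ⊗ₜ (b ⊗ₜ (c ⊗ₜ d)))) : p t := by
  refine tensor_induction_right t zero add (fun a b s => ?_)
  refine TensorProduct.induction_on s (by simpa using zero) (fun c d => tmul a b c d) ?_
  intro x y hx hy
  rw [TensorProduct.tmul_add, TensorProduct.tmul_add]
  exact add _ _ hx hy

end TensorInduction

section MulMap

variable {k A B R : Type*} [Field k] [AddCommGroup A] [Module k A] [AddCommGroup B] [Module k B]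
  [Ring R] [Algebra k R]

/-- `a ⊗ b ↦ f(a) g(b)`. -/
def mulMap (f : A →ₗ[k] R) (g : B →ₗ[k] R) : A ⊗[k] B →ₗ[k] R :=
  LinearMap.mul' k R ∘ₗ TensorProduct.map f g

@[simp]
theorem mulMap_tmul (f : A →ₗ[k] R) (g : B →ₗ[k] R) (a : A) (b : B) :
    mulMap f g (a ⊗ₜ b) = f a * g b := by
  simp [mulMap]

end MulMap

/-! ### Linear maps that absorb an algebra map -/

section Equivariance

variable {k : Type*} [Field k]
variable {G C P A : Type*} [Ring G] [Algebra k G] [Ring C] [Algebra k C] [Ring P] [Algebra k P]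
  [Ring A] [Algebra k A]

/-- `F(δ(g) c) = π(g) F(c)`. -/
def LeftEquivariant (F : C →ₗ[k] P) (δ : G →ₐ[k] C) (π : G →ₐ[k] P) : Prop :=
  ∀ g c, F (δ g * c) = π g * F c

/-- `F(c δ(g)) = F(c) π(g)`. -/
def RightEquivariant (F : C →ₗ[k] P) (δ : G →ₐ[k] C) (π : G →ₐ[k] P) : Prop :=
  ∀ g c, F (c * δ g) = F c * π g

/-- Stability under tensoring lets the antipode axioms act on two adjacent legs of a longer tensor:
there δ is Δ, π is the counit, and a coproduct on those legs collapses to a scalar. -/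
theorem LeftEquivariant.tmul_left {F : C →ₗ[k] P} {δ : G →ₐ[k] C} {π : G →ₐ[k] P}
    (h : LeftEquivariant F δ π) :
    LeftEquivariant (TensorProduct.map (LinearMap.id : A →ₗ[k] A) F)
      (Algebra.TensorProduct.map (AlgHom.id k A) δ)
      (Algebra.TensorProduct.map (AlgHom.id k A) π) := by
  intro g c
  induction g using TensorProduct.induction_on with
  | zero => simp
  | add x y hx hy => simp only [map_add, add_mul, hx, hy]
  | tmul a g =>
    induction c using TensorProduct.induction_on with
    | zero => simp
    | add x y hx hy => simp only [map_add, mul_add, hx, hy]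
    | tmul b c => simp [h g c]

theorem LeftEquivariant.tmul_right {F : C →ₗ[k] P} {δ : G →ₐ[k] C} {π : G →ₐ[k] P}
    (h : LeftEquivariant F δ π) :
    LeftEquivariant (TensorProduct.map F (LinearMap.id : A →ₗ[k] A))
      (Algebra.TensorProduct.map δ (AlgHom.id k A))
      (Algebra.TensorProduct.map π (AlgHom.id k A)) := by
  intro g c
  induction g using TensorProduct.induction_on with
  | zero => simp
  | add x y hx hy => simp only [map_add, add_mul, hx, hy]
  | tmul g a =>
    induction c using TensorProduct.induction_on with
    | zero => simp
    | add x y hx hy => simp only [map_add, mul_add, hx, hy]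
    | tmul b c => simp [h g]

theorem RightEquivariant.tmul_left {F : C →ₗ[k] P} {δ : G →ₐ[k] C} {π : G →ₐ[k] P}
    (h : RightEquivariant F δ π) :
    RightEquivariant (TensorProduct.map (LinearMap.id : A →ₗ[k] A) F)
      (Algebra.TensorProduct.map (AlgHom.id k A) δ)
      (Algebra.TensorProduct.map (AlgHom.id k A) π) := by
  intro g c
  induction g using TensorProduct.induction_on with
  | zero => simp
  | add x y hx hy => simp only [map_add, mul_add, hx, hy]
  | tmul a g =>
    induction c using TensorProduct.induction_on with
    | zero => simp
    | add x y hx hy => simp only [map_add, add_mul, hx, hy]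
    | tmul b c => simp [h g c]

theorem RightEquivariant.tmul_right {F : C →ₗ[k] P} {δ : G →ₐ[k] C} {π : G →ₐ[k] P}
    (h : RightEquivariant F δ π) :
    RightEquivariant (TensorProduct.map F (LinearMap.id : A →ₗ[k] A))
      (Algebra.TensorProduct.map δ (AlgHom.id k A))
      (Algebra.TensorProduct.map π (AlgHom.id k A)) := by
  intro g c
  induction g using TensorProduct.induction_on with
  | zero => simp
  | add x y hx hy => simp only [map_add, mul_add, hx, hy]
  | tmul g a =>
    induction c using TensorProduct.induction_on with
    | zero => simp
    | add x y hx hy => simp only [map_add, add_mul, hx, hy]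
    | tmul b c => simp [h g]

theorem LeftEquivariant.assoc {H : Type*} [Ring H] [Algebra k H]
    {δ : G →ₐ[k] H ⊗[k] A} {π : G →ₐ[k] P} {F : H ⊗[k] A →ₗ[k] P}
    (h : LeftEquivariant F δ π) {B : Type*} [Ring B] [Algebra k B] :
    LeftEquivariant (TensorProduct.map F (LinearMap.id : B →ₗ[k] B) ∘ₗ
        (TensorProduct.assoc k H A B).symm.toLinearMap)
      ((Algebra.TensorProduct.assoc k k k H A B).toAlgHom.comp
        (Algebra.TensorProduct.map δ (AlgHom.id k B)))
      (Algebra.TensorProduct.map π (AlgHom.id k B)) := by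
  intro g c
  have h1 : (TensorProduct.assoc k H A B).symm
      (((Algebra.TensorProduct.assoc k k k H A B).toAlgHom.comp
        (Algebra.TensorProduct.map δ (AlgHom.id k B))) g * c) =
      Algebra.TensorProduct.map δ (AlgHom.id k B) g * (TensorProduct.assoc k H A B).symm c := by
    apply (TensorProduct.assoc k H A B).injective
    rw [LinearEquiv.apply_symm_apply]
    change _ = (Algebra.TensorProduct.assoc k k k H A B) (_ * _)
    rw [map_mul]
    congr 1
    exact ((TensorProduct.assoc k H A B).apply_symm_apply c).symm
  simp only [LinearMap.comp_apply, LinearEquiv.coe_coe, h1]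
  exact h.tmul_right g _

end Equivariance

/-! ### Solved forms of the pentagon, and counit arguments -/

namespace QuasiBialgebra

variable {k H : Type*} [Field k] [Ring H] [Algebra k H] (Q : QuasiBialgebra k H)

/-- `Δ ⊗ id ⊗ id` on `H ⊗ H ⊗ H`. -/
def comulFst : H ⊗[k] (H ⊗[k] H) →ₐ[k] H ⊗[k] (H ⊗[k] (H ⊗[k] H)) :=
  (Algebra.TensorProduct.assoc k k k H H (H ⊗[k] H)).toAlgHom.comp
    (Algebra.TensorProduct.map Q.comul (AlgHom.id k (H ⊗[k] H)))

/-- `id ⊗ Δ ⊗ id` on `H ⊗ H ⊗ H`. -/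
def comulSnd : H ⊗[k] (H ⊗[k] H) →ₐ[k] H ⊗[k] (H ⊗[k] (H ⊗[k] H)) :=
  Algebra.TensorProduct.map (AlgHom.id k H)
    ((Algebra.TensorProduct.assoc k k k H H H).toAlgHom.comp
      (Algebra.TensorProduct.map Q.comul (AlgHom.id k H)))

/-- `id ⊗ id ⊗ Δ` on `H ⊗ H ⊗ H`. -/
def comulThd : H ⊗[k] (H ⊗[k] H) →ₐ[k] H ⊗[k] (H ⊗[k] (H ⊗[k] H)) :=
  Algebra.TensorProduct.map (AlgHom.id k H) (Algebra.TensorProduct.map (AlgHom.id k H) Q.comul)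

/-- `t ↦ t ⊗ 1` on `H ⊗ H ⊗ H`. -/
def inclInit : H ⊗[k] (H ⊗[k] H) →ₐ[k] H ⊗[k] (H ⊗[k] (H ⊗[k] H)) :=
  Algebra.TensorProduct.map (AlgHom.id k H)
    (Algebra.TensorProduct.map (AlgHom.id k H) Algebra.TensorProduct.includeLeft)

/-- `t ↦ 1 ⊗ t` on `H ⊗ H ⊗ H`. -/
def inclTail : H ⊗[k] (H ⊗[k] H) →ₐ[k] H ⊗[k] (H ⊗[k] (H ⊗[k] H)) :=
  Algebra.TensorProduct.includeRight

/-- The image of `Φ` under an algebra map, as a unit. -/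
def mapΦ {R : Type*} [Semiring R] [Algebra k R] (f : H ⊗[k] (H ⊗[k] H) →ₐ[k] R) : Rˣ :=
  Units.map (f : H ⊗[k] (H ⊗[k] H) →* R) Q.Φ

/-- As a relation between units the pentagon can be solved for any of its factors by group
manipulation; the solved forms that follow are the ones that meet the antipode axioms. -/
theorem pentagon_units :
    Q.mapΦ inclTail * Q.mapΦ Q.comulSnd * Q.mapΦ inclInit =
      Q.mapΦ Q.comulThd * Q.mapΦ Q.comulFst := by
  ext
  exact Q.pentagon

/-- `(Φ ⊗ 1)(Δ ⊗ id ⊗ id)(Φ⁻¹) = (id ⊗ Δ ⊗ id)(Φ⁻¹)(1 ⊗ Φ⁻¹)(id ⊗ id ⊗ Δ)(Φ)`. -/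
theorem inclInit_mul_comulFst_inv :
    inclInit Q.Φ.val * Q.comulFst Q.Φ.inv =
      Q.comulSnd Q.Φ.inv * (inclTail Q.Φ.inv * Q.comulThd Q.Φ.val) := by
  have h : Q.mapΦ inclInit * (Q.mapΦ Q.comulFst)⁻¹ =
      (Q.mapΦ Q.comulSnd)⁻¹ * ((Q.mapΦ inclTail)⁻¹ * Q.mapΦ Q.comulThd) := by
    have := Q.pentagon_units
    rw [mul_inv_eq_iff_eq_mul, mul_assoc, mul_assoc, ← this]
    group
  exact congrArg Units.val h

/-- `(1 ⊗ Φ⁻¹)(id ⊗ id ⊗ Δ)(Φ) = (id ⊗ Δ ⊗ id)(Φ)(Φ ⊗ 1)(Δ ⊗ id ⊗ id)(Φ⁻¹)`. -/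
theorem inclTail_inv_mul_comulThd :
    inclTail Q.Φ.inv * Q.comulThd Q.Φ.val =
      Q.comulSnd Q.Φ.val * (inclInit Q.Φ.val * Q.comulFst Q.Φ.inv) := by
  rw [inclInit_mul_comulFst_inv, ← mul_assoc, ← map_mul]
  simp

/-- `(Δ ⊗ id ⊗ id)(Φ)(Φ⁻¹ ⊗ 1) = (id ⊗ id ⊗ Δ)(Φ⁻¹)(1 ⊗ Φ)(id ⊗ Δ ⊗ id)(Φ)`. -/
theorem comulFst_mul_inclInit_inv :
    Q.comulFst Q.Φ.val * inclInit Q.Φ.inv =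
      Q.comulThd Q.Φ.inv * (inclTail Q.Φ.val * Q.comulSnd Q.Φ.val) := by
  have h : Q.mapΦ Q.comulFst * (Q.mapΦ inclInit)⁻¹ =
      (Q.mapΦ Q.comulThd)⁻¹ * (Q.mapΦ inclTail * Q.mapΦ Q.comulSnd) := by
    have := Q.pentagon_units
    rw [mul_inv_eq_iff_eq_mul, mul_assoc, this]
    group
  exact congrArg Units.val h

/-- `(id ⊗ id ⊗ Δ)(Φ⁻¹)(1 ⊗ Φ) = (Δ ⊗ id ⊗ id)(Φ)(Φ⁻¹ ⊗ 1)(id ⊗ Δ ⊗ id)(Φ⁻¹)`. -/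
theorem comulThd_inv_mul_inclTail :
    Q.comulThd Q.Φ.inv * inclTail Q.Φ.val =
      Q.comulFst Q.Φ.val * (inclInit Q.Φ.inv * Q.comulSnd Q.Φ.inv) := by
  rw [← mul_assoc, comulFst_mul_inclInit_inv, mul_assoc, mul_assoc, ← map_mul]
  simp

section Counit

variable {P : Type*} [AddCommGroup P] [Module k P]

/-- The counit followed by the inclusion of the scalars. -/
def counitAlg (R : Type*) [Ring R] [Algebra k R] : H →ₐ[k] R := (Algebra.ofId k R).comp Q.counit

theorem counitAlg_mul {R : Type*} [Ring R] [Algebra k R] (h : H) (r : R) :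
    Q.counitAlg R h * r = Q.counit h • r := by
  simp [counitAlg, Algebra.ofId_apply, Algebra.smul_def]

theorem mul_counitAlg {R : Type*} [Ring R] [Algebra k R] (h : H) (r : R) :
    r * Q.counitAlg R h = Q.counit h • r := by
  simp [counitAlg, Algebra.ofId_apply, Algebra.smul_def, Algebra.commutes]

/-- Such a G factors through id ⊗ ε, so the counit axiom evaluates it on a coproduct. This is the
standard way to discard a leg of Δ(h) that is seen only through ε. -/
theorem comul_counit_right (G : H ⊗[k] H →ₗ[k] P)
    (hG : ∀ a b, G (a ⊗ₜ b) = Q.counit b • G (a ⊗ₜ 1)) (h : H) :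
    G (Q.comul h) = G (h ⊗ₜ 1) := by
  have := congrArg (TensorProduct.lift
    ((LinearMap.lsmul k P).flip ∘ₗ G ∘ₗ (TensorProduct.mk k H H).flip 1)) (Q.comul_counit h)
  have h2 : ∀ t : H ⊗[k] H, TensorProduct.lift
    ((LinearMap.lsmul k P).flip ∘ₗ G ∘ₗ (TensorProduct.mk k H H).flip 1)
      (Algebra.TensorProduct.map (AlgHom.id k H) Q.counit t) = G t := by
    intro t
    induction t using TensorProduct.induction_on with
    | zero => simp
    | add x y hx hy => simp only [map_add, hx, hy]
    | tmul a b => simp [hG a b]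
  rw [h2] at this
  simpa using this

theorem comul_counit_left (G : H ⊗[k] H →ₗ[k] P)
    (hG : ∀ a b, G (a ⊗ₜ b) = Q.counit a • G (1 ⊗ₜ b)) (h : H) :
    G (Q.comul h) = G (1 ⊗ₜ h) := by
  have := congrArg (TensorProduct.lift
    (LinearMap.lsmul k P).flip.flip ∘ₗ
      TensorProduct.map LinearMap.id (G ∘ₗ TensorProduct.mk k H H 1)) (Q.counit_comul h)
  have h2 : ∀ t : H ⊗[k] H, (TensorProduct.lift
    (LinearMap.lsmul k P).flip.flip ∘ₗ
      TensorProduct.map LinearMap.id (G ∘ₗ TensorProduct.mk k H H 1))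
      (Algebra.TensorProduct.map Q.counit (AlgHom.id k H) t) = G t := by
    intro t
    induction t using TensorProduct.induction_on with
    | zero => simp
    | add x y hx hy => simp only [map_add, hx, hy]
    | tmul a b => simp [hG a b]
  rw [h2] at this
  simpa using this

/-- An element `u` with `(id ⊗ id ⊗ ε)(u) = 1`, and similarly for the other factors. -/
structure IsCounital (u : H ⊗[k] (H ⊗[k] H)) : Prop where
  left : Algebra.TensorProduct.map Q.counit (AlgHom.id k (H ⊗[k] H)) u = 1
  middle : Algebra.TensorProduct.map (AlgHom.id k H)
    (Algebra.TensorProduct.map Q.counit (AlgHom.id k H)) u = 1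
  right : Algebra.TensorProduct.map (AlgHom.id k H)
    (Algebra.TensorProduct.map (AlgHom.id k H) Q.counit) u = 1

theorem isCounital_Φ : Q.IsCounital Q.Φ.val := ⟨Q.counit_left, Q.counit_middle, Q.counit_right⟩

theorem isCounital_Φ_inv : Q.IsCounital Q.Φ.inv := by
  have key : ∀ {R : Type _} [Ring R] [Algebra k R] (f : H ⊗[k] (H ⊗[k] H) →ₐ[k] R),
      f Q.Φ.val = 1 → f Q.Φ.inv = 1 := by
    intro R _ _ f hf
    have h := congrArg f Q.Φ.val_inv
    rwa [map_mul, hf, one_mul, map_one] at h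
  exact ⟨key _ Q.counit_left, key _ Q.counit_middle, key _ Q.counit_right⟩

variable {Q}

/-- Here F factors through id ⊗ id ⊗ ε, which sends u to 1. The effect is that Φ or Φ⁻¹ may be
replaced by 1 as soon as one of its legs is seen only through the counit. -/
theorem IsCounital.apply_right {u : H ⊗[k] (H ⊗[k] H)} (hu : Q.IsCounital u)
    (F : H ⊗[k] (H ⊗[k] H) →ₗ[k] P)
    (hF : ∀ a b c, F (a ⊗ₜ (b ⊗ₜ c)) = Q.counit c • F (a ⊗ₜ (b ⊗ₜ 1))) : F u = F 1 := by
  let G : H ⊗[k] (H ⊗[k] k) →ₗ[k] P := F ∘ₗ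
    TensorProduct.map LinearMap.id (TensorProduct.map LinearMap.id (Algebra.linearMap k H))
  have h : ∀ t, F t = G (Algebra.TensorProduct.map (AlgHom.id k H)
    (Algebra.TensorProduct.map (AlgHom.id k H) Q.counit) t) := by
    intro t
    induction t using tensor_induction_right with
    | zero => simp
    | add x y hx hy => simp only [map_add, hx, hy]
    | tmul a b c =>
      simp only [G, Algebra.TensorProduct.map_tmul, LinearMap.comp_apply, TensorProduct.map_tmul,
        AlgHom.coe_id, id_eq, LinearMap.id_apply, Algebra.linearMap_apply,
        Algebra.algebraMap_eq_smul_one, TensorProduct.tmul_smul, map_smul]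
      exact hF a b c
  rw [h u, hu.right, h 1, map_one (Algebra.TensorProduct.map _ _)]

theorem IsCounital.apply_middle {u : H ⊗[k] (H ⊗[k] H)} (hu : Q.IsCounital u)
    (F : H ⊗[k] (H ⊗[k] H) →ₗ[k] P)
    (hF : ∀ a b c, F (a ⊗ₜ (b ⊗ₜ c)) = Q.counit b • F (a ⊗ₜ (1 ⊗ₜ c))) : F u = F 1 := by
  let G : H ⊗[k] (k ⊗[k] H) →ₗ[k] P := F ∘ₗ
    TensorProduct.map LinearMap.id (TensorProduct.map (Algebra.linearMap k H) LinearMap.id)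
  have h : ∀ t, F t = G (Algebra.TensorProduct.map (AlgHom.id k H)
    (Algebra.TensorProduct.map Q.counit (AlgHom.id k H)) t) := by
    intro t
    induction t using tensor_induction_right with
    | zero => simp
    | add x y hx hy => simp only [map_add, hx, hy]
    | tmul a b c =>
      simp only [G, Algebra.TensorProduct.map_tmul, LinearMap.comp_apply, TensorProduct.map_tmul,
        AlgHom.coe_id, id_eq, LinearMap.id_apply, Algebra.linearMap_apply,
        Algebra.algebraMap_eq_smul_one, TensorProduct.tmul_smul, map_smul, ← TensorProduct.smul_tmul']
      exact hF a b c
  rw [h u, hu.middle, h 1, map_one (Algebra.TensorProduct.map _ _)]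

theorem IsCounital.apply_left {u : H ⊗[k] (H ⊗[k] H)} (hu : Q.IsCounital u)
    (F : H ⊗[k] (H ⊗[k] H) →ₗ[k] P)
    (hF : ∀ a b c, F (a ⊗ₜ (b ⊗ₜ c)) = Q.counit a • F (1 ⊗ₜ (b ⊗ₜ c))) : F u = F 1 := by
  let G : k ⊗[k] (H ⊗[k] H) →ₗ[k] P := F ∘ₗ
    TensorProduct.map (Algebra.linearMap k H) LinearMap.id
  have h : ∀ t, F t = G (Algebra.TensorProduct.map Q.counit (AlgHom.id k (H ⊗[k] H)) t) := by
    intro t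
    induction t using tensor_induction_right with
    | zero => simp
    | add x y hx hy => simp only [map_add, hx, hy]
    | tmul a b c =>
      simp only [G, Algebra.TensorProduct.map_tmul, LinearMap.comp_apply, TensorProduct.map_tmul,
        AlgHom.coe_id, id_eq, LinearMap.id_apply, Algebra.linearMap_apply,
        Algebra.algebraMap_eq_smul_one, map_smul, ← TensorProduct.smul_tmul']
      exact hF a b c
  rw [h u, hu.left, h 1, map_one (Algebra.TensorProduct.map _ _)]

/-- `Φ(Δ ⊗ id)(Δ(h)) = (id ⊗ Δ)(Δ(h))Φ`. -/
theorem Φ_mul_comul (Q : QuasiBialgebra k H) (h : H) :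
    Q.Φ.val * TensorProduct.assoc k H H H
        (Algebra.TensorProduct.map Q.comul (AlgHom.id k H) (Q.comul h)) =
      Algebra.TensorProduct.map (AlgHom.id k H) Q.comul (Q.comul h) * Q.Φ.val := by
  rw [Q.comul_quasi_coassoc, mul_assoc, Units.inv_val, mul_one]

/-- `(Δ ⊗ id)(Δ(h))Φ⁻¹ = Φ⁻¹(id ⊗ Δ)(Δ(h))`. -/
theorem comul_mul_Φ_inv (Q : QuasiBialgebra k H) (h : H) :
    TensorProduct.assoc k H H H
        (Algebra.TensorProduct.map Q.comul (AlgHom.id k H) (Q.comul h)) * Q.Φ.inv =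
      Q.Φ.inv * Algebra.TensorProduct.map (AlgHom.id k H) Q.comul (Q.comul h) := by
  rw [Q.comul_quasi_coassoc, mul_assoc, ← mul_assoc Q.Φ.inv, Units.inv_val, one_mul]

end Counit

end QuasiBialgebra

namespace QuasiHopfAlgebra

variable {k H : Type*} [Field k] [Ring H] [Algebra k H] (Q : QuasiHopfAlgebra k H)

/-- `a ⊗ b ↦ S(a) α b`. -/
abbrev evα : H ⊗[k] H →ₗ[k] H := antipodeLeft Q.S.toLinearMap Q.α

/-- `a ⊗ b ↦ a β S(b)`. -/
abbrev evβ : H ⊗[k] H →ₗ[k] H := antipodeRight Q.S.toLinearMap Q.β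

/-- Since S reverses products, the factors coming from Δ(h) meet around α as S(h₁) α h₂, and the
antipode axiom turns them into ε(h) α. -/
theorem evα_equivariant : LeftEquivariant Q.evα Q.comul (Q.counitAlg H) := by
  intro h c
  induction c using TensorProduct.induction_on with
  | zero => simp
  | add x y hx hy => simp only [map_add, mul_add, hx, hy]
  | tmul a b =>
    have key : ∀ t : H ⊗[k] H, Q.evα (t * a ⊗ₜ b) = Q.S a * Q.evα t * b := by
      intro t
      induction t using TensorProduct.induction_on with
      | zero => simp
      | add x y hx hy => simp only [map_add, mul_add, add_mul, hx, hy]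
      | tmul c d => simp [Q.S_mul, mul_assoc]
    rw [key, Q.antipode_left, Q.counitAlg_mul]
    simp

theorem evβ_equivariant : RightEquivariant Q.evβ Q.comul (Q.counitAlg H) := by
  intro h c
  induction c using TensorProduct.induction_on with
  | zero => simp
  | add x y hx hy => simp only [map_add, add_mul, hx, hy]
  | tmul a b =>
    have key : ∀ t : H ⊗[k] H, Q.evβ (a ⊗ₜ b * t) = a * Q.evβ t * Q.S b := by
      intro t
      induction t using TensorProduct.induction_on with
      | zero => simp
      | add x y hx hy => simp only [map_add, mul_add, add_mul, hx, hy]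
      | tmul c d => simp [Q.S_mul, mul_assoc]
    rw [key, Q.antipode_right, Q.mul_counitAlg]
    simp [mul_assoc]

end QuasiHopfAlgebra

namespace QuasiBialgebra

variable {k H : Type*} [Field k] [Ring H] [Algebra k H] (Q : QuasiBialgebra k H)

@[simp]
theorem comulFst_tmul (a : H) (t : H ⊗[k] H) :
    Q.comulFst (a ⊗ₜ t) = TensorProduct.assoc k H H (H ⊗[k] H) (Q.comul a ⊗ₜ t) := rfl

@[simp]
theorem comulSnd_tmul (a b c : H) :
    Q.comulSnd (a ⊗ₜ (b ⊗ₜ c)) = a ⊗ₜ TensorProduct.assoc k H H H (Q.comul b ⊗ₜ c) := rfl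

@[simp]
theorem comulThd_tmul (a b c : H) :
    Q.comulThd (a ⊗ₜ (b ⊗ₜ c)) = a ⊗ₜ (b ⊗ₜ Q.comul c) := rfl

@[simp]
theorem inclInit_tmul (a b c : H) :
    inclInit (k := k) (a ⊗ₜ (b ⊗ₜ c)) = a ⊗ₜ (b ⊗ₜ (c ⊗ₜ 1)) := rfl

@[simp]
theorem inclTail_apply (t : H ⊗[k] (H ⊗[k] H)) : inclTail t = (1 : H) ⊗ₜ t := rfl

theorem map_id_counitAlg_comul (R : Type*) [Ring R] [Algebra k R] (h : H) :
    Algebra.TensorProduct.map (AlgHom.id k H) (Q.counitAlg R) (Q.comul h) = h ⊗ₜ 1 := by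
  have := Q.comul_counit_right
    (Algebra.TensorProduct.map (AlgHom.id k H) (Q.counitAlg R)).toLinearMap (fun a b => ?_) h
  · simpa only [AlgHom.toLinearMap_apply, Algebra.TensorProduct.map_tmul, map_one,
      AlgHom.coe_id, id_eq] using this
  · have := Q.counitAlg_mul b (1 : R)
    rw [mul_one] at this
    simp [this]

theorem map_counitAlg_id_comul (R : Type*) [Ring R] [Algebra k R] (h : H) :
    Algebra.TensorProduct.map (Q.counitAlg R) (AlgHom.id k H) (Q.comul h) = 1 ⊗ₜ h := by
  have := Q.comul_counit_left
    (Algebra.TensorProduct.map (Q.counitAlg R) (AlgHom.id k H)).toLinearMap (fun a b => ?_) h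
  · simpa only [AlgHom.toLinearMap_apply, Algebra.TensorProduct.map_tmul, map_one,
      AlgHom.coe_id, id_eq] using this
  · have := Q.counitAlg_mul a (1 : R)
    rw [mul_one] at this
    simp [this, ← TensorProduct.smul_tmul']

variable {Q} in
theorem IsCounital.map_left {u : H ⊗[k] (H ⊗[k] H)} (hu : Q.IsCounital u) (R : Type*) [Ring R]
    [Algebra k R] :
    Algebra.TensorProduct.map (Q.counitAlg R) (AlgHom.id k (H ⊗[k] H)) u = 1 := by
  have := hu.apply_left (Algebra.TensorProduct.map (Q.counitAlg R)
    (AlgHom.id k (H ⊗[k] H))).toLinearMap (fun a b c => ?_)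
  · simpa only [AlgHom.toLinearMap_apply, Algebra.TensorProduct.map_tmul, map_one,
      AlgHom.coe_id, id_eq] using this
  · have := Q.counitAlg_mul a (1 : R)
    rw [mul_one] at this
    simp [this, ← TensorProduct.smul_tmul']

variable {Q} in
theorem IsCounital.map_middle {u : H ⊗[k] (H ⊗[k] H)} (hu : Q.IsCounital u) (R : Type*) [Ring R]
    [Algebra k R] :
    Algebra.TensorProduct.map (AlgHom.id k H)
      (Algebra.TensorProduct.map (Q.counitAlg R) (AlgHom.id k H)) u = 1 := by
  have := hu.apply_middle (Algebra.TensorProduct.map (AlgHom.id k H)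
      (Algebra.TensorProduct.map (Q.counitAlg R) (AlgHom.id k H))).toLinearMap (fun a b c => ?_)
  · simpa only [AlgHom.toLinearMap_apply, Algebra.TensorProduct.map_tmul, map_one,
      AlgHom.coe_id, id_eq] using this
  · have := Q.counitAlg_mul b (1 : R)
    rw [mul_one] at this
    simp [this, ← TensorProduct.smul_tmul']

variable {Q} in
theorem IsCounital.map_right {u : H ⊗[k] (H ⊗[k] H)} (hu : Q.IsCounital u) (R : Type*) [Ring R]
    [Algebra k R] :
    Algebra.TensorProduct.map (AlgHom.id k H)
      (Algebra.TensorProduct.map (AlgHom.id k H) (Q.counitAlg R)) u = 1 := by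
  have := hu.apply_right (Algebra.TensorProduct.map (AlgHom.id k H)
      (Algebra.TensorProduct.map (AlgHom.id k H) (Q.counitAlg R))).toLinearMap (fun a b c => ?_)
  · simpa only [AlgHom.toLinearMap_apply, Algebra.TensorProduct.map_tmul, map_one,
      AlgHom.coe_id, id_eq] using this
  · have := Q.counitAlg_mul c (1 : R)
    rw [mul_one] at this
    simp [this]

end QuasiBialgebra

/-! ### The elements p, q and D built from Φ and the antipode -/

namespace QuasiHopfAlgebra

open QuasiBialgebra

variable {k H : Type*} [Field k] [Ring H] [Algebra k H] (Q : QuasiHopfAlgebra k H)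

/-- `x¹ ⊗ x² β S(x³)`. -/
def pR : H ⊗[k] H := TensorProduct.map LinearMap.id Q.evβ Q.Φ.inv

/-- `X¹ ⊗ S(X²) α X³`. -/
def qS : H ⊗[k] H := TensorProduct.map LinearMap.id Q.evα Q.Φ.val

/-- `a ⊗ b ⊗ c ↦ S(a) α b ⊗ c`. -/
def evαFst (A : Type*) [Ring A] [Algebra k A] : H ⊗[k] (H ⊗[k] A) →ₗ[k] H ⊗[k] A :=
  TensorProduct.map Q.evα LinearMap.id ∘ₗ (TensorProduct.assoc k H H A).symm.toLinearMap

/-- `a ⊗ b ⊗ c ↦ a β S(b) ⊗ c`. -/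
def evβFst (A : Type*) [Ring A] [Algebra k A] : H ⊗[k] (H ⊗[k] A) →ₗ[k] H ⊗[k] A :=
  TensorProduct.map Q.evβ LinearMap.id ∘ₗ (TensorProduct.assoc k H H A).symm.toLinearMap

@[simp]
theorem evαFst_tmul {A : Type*} [Ring A] [Algebra k A] (a b : H) (c : A) :
    Q.evαFst A (a ⊗ₜ (b ⊗ₜ c)) = (Q.S a * Q.α * b) ⊗ₜ c := by
  simp [evαFst]

@[simp]
theorem evβFst_tmul {A : Type*} [Ring A] [Algebra k A] (a b : H) (c : A) :
    Q.evβFst A (a ⊗ₜ (b ⊗ₜ c)) = (a * Q.β * Q.S b) ⊗ₜ c := by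
  simp [evβFst]

theorem evαFst_mul {A : Type*} [Ring A] [Algebra k A] (t : H ⊗[k] A) (c : H ⊗[k] (H ⊗[k] A)) :
    Q.evαFst A (TensorProduct.assoc k H H A
      (Algebra.TensorProduct.map Q.comul (AlgHom.id k A) t) * c) =
      Algebra.TensorProduct.map (Q.counitAlg H) (AlgHom.id k A) t * Q.evαFst A c :=
  Q.evα_equivariant.assoc (B := A) t c

theorem evβFst_mul {A : Type*} [Ring A] [Algebra k A] (t : H ⊗[k] A) (c : H ⊗[k] (H ⊗[k] A)) :
    Q.evβFst A (c * TensorProduct.assoc k H H A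
      (Algebra.TensorProduct.map Q.comul (AlgHom.id k A) t)) =
      Q.evβFst A c * Algebra.TensorProduct.map (Q.counitAlg H) (AlgHom.id k A) t := by
  obtain ⟨c, rfl⟩ := (TensorProduct.assoc k H H A).surjective c
  have h : ∀ x y : (H ⊗[k] H) ⊗[k] A, TensorProduct.assoc k H H A x *
      TensorProduct.assoc k H H A y = TensorProduct.assoc k H H A (x * y) :=
    fun x y => (map_mul (Algebra.TensorProduct.assoc k k k H H A) x y).symm
  rw [h]
  simp only [evβFst, LinearMap.comp_apply, LinearEquiv.coe_coe, LinearEquiv.symm_apply_apply]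
  exact Q.evβ_equivariant.tmul_right (A := A) t c

/-- `S(x¹) α x² ⊗ x³`. -/
def qL : H ⊗[k] H := Q.evαFst H Q.Φ.inv

/-- `X¹ ⊗ S(y¹X²) α y²X³₁ ⊗ y³X³₂`. -/
def elementD : H ⊗[k] (H ⊗[k] H) :=
  TensorProduct.map LinearMap.id (Q.evαFst H) Q.starElement

theorem starElement_eq : Q.starElement = inclTail Q.Φ.inv * Q.comulThd Q.Φ.val := rfl

/-- By the pentagon the element under the evaluation has (id ⊗ Δ ⊗ id)(Φ) as its left factor. The
evaluation S(·) α (·) on the two middle legs absorbs that factor, and the counit of Φ removes it. -/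
theorem elementD_eq : Q.elementD =
    TensorProduct.map LinearMap.id (Q.evαFst H) (inclInit Q.Φ.val * Q.comulFst Q.Φ.inv) := by
  rw [elementD, starElement_eq, inclTail_inv_mul_comulThd]
  have h : LeftEquivariant (Q.evαFst H) ((Algebra.TensorProduct.assoc k k k H H H).toAlgHom.comp
      (Algebra.TensorProduct.map Q.comul (AlgHom.id k H)))
      (Algebra.TensorProduct.map (Q.counitAlg H) (AlgHom.id k H)) :=
    fun t c => Q.evαFst_mul t c
  refine (h.tmul_left (A := H) _ _).trans ?_
  rw [Q.isCounital_Φ.map_middle, one_mul]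

theorem elementP_eq : Q.elementP =
    TensorProduct.map LinearMap.id (TensorProduct.map LinearMap.id Q.S.toLinearMap) Q.elementD := by
  rw [elementP, elementD]
  generalize Q.starElement = t
  induction t using tensor_induction_right_right with
  | zero => simp
  | add x y hx hy => simp only [map_add, hx, hy]
  | tmul a b c d => simp [starMap]

/-- `X¹ ⊗ S(y¹X²) α y²X³₁ β S(y³X³₂) = 1 ⊗ 1`. -/
theorem map_evβ_elementD : TensorProduct.map LinearMap.id Q.evβ Q.elementD = 1 := by
  -- The two evaluations share the third leg only as a product S(b) α c β S(d), so the one with β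
  -- may be performed before the one with α.
  have h1 : ∀ t : H ⊗[k] (H ⊗[k] (H ⊗[k] H)),
      TensorProduct.map LinearMap.id Q.evβ (TensorProduct.map LinearMap.id (Q.evαFst H) t) =
      TensorProduct.map LinearMap.id (LinearMap.mul' k H ∘ₗ
        TensorProduct.map (LinearMap.mulRight k Q.α ∘ₗ Q.S.toLinearMap) LinearMap.id)
        (TensorProduct.map LinearMap.id (TensorProduct.map LinearMap.id Q.evβ) t) := by
    intro t
    induction t using tensor_induction_right_right with
    | zero => simp
    | add x y hx hy => simp only [map_add, hx, hy]
    | tmul a b c d => simp [mul_assoc]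
  rw [elementD, h1, starElement_eq]
  -- The coproduct on the last two legs is absorbed by (·) β S(·). Only 1 ⊗ Φ⁻¹ survives, and it
  -- evaluates to S(x¹) α x² β S(x³) = 1.
  have h2 : TensorProduct.map LinearMap.id (TensorProduct.map LinearMap.id Q.evβ)
      (inclTail Q.Φ.inv * Q.comulThd Q.Φ.val) =
      TensorProduct.map LinearMap.id (TensorProduct.map LinearMap.id Q.evβ) (inclTail Q.Φ.inv) := by
    refine ((Q.evβ_equivariant.tmul_left (A := H)).tmul_left (A := H) _ _).trans ?_
    rw [Q.isCounital_Φ.map_right, mul_one]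
  rw [h2]
  have h3 := Q.antipode_Φ_inv
  simp only [inclTail_apply, TensorProduct.map_tmul, LinearMap.id_apply]
  rw [← LinearMap.comp_apply, LinearMap.comp_assoc, ← TensorProduct.map_comp, LinearMap.id_comp,
    LinearMap.comp_id, LinearMap.comp_apply, h3]
  rfl

/-- `X¹ β S(y¹X²) α y²X³₁ ⊗ y³X³₂ = 1 ⊗ 1`. -/
theorem map_mul_β_elementD :
    (TensorProduct.map (LinearMap.mul' k H ∘ₗ TensorProduct.map (LinearMap.mulRight k Q.β)
      LinearMap.id) LinearMap.id ∘ₗ (TensorProduct.assoc k H H H).symm.toLinearMap)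
      Q.elementD = 1 := by
  rw [elementD_eq]
  -- With the evaluation by β on the first two legs done first, the right factor (Δ ⊗ id ⊗ id)(Φ⁻¹)
  -- is absorbed, and X¹ β S(X²) α X³ = 1 finishes.
  have h1 : ∀ t : H ⊗[k] (H ⊗[k] (H ⊗[k] H)),
      (TensorProduct.map (LinearMap.mul' k H ∘ₗ TensorProduct.map (LinearMap.mulRight k Q.β)
        LinearMap.id) LinearMap.id ∘ₗ (TensorProduct.assoc k H H H).symm.toLinearMap)
        (TensorProduct.map LinearMap.id (Q.evαFst H) t) =
      (TensorProduct.map (LinearMap.mul' k H ∘ₗ TensorProduct.map (LinearMap.mulRight k Q.α)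
        LinearMap.id) LinearMap.id ∘ₗ (TensorProduct.assoc k H H H).symm.toLinearMap)
        (Q.evβFst (H ⊗[k] H) t) := by
    intro t
    induction t using tensor_induction_right_right with
    | zero => simp
    | add x y hx hy => simp only [map_add, hx, hy]
    | tmul a b c d => simp [mul_assoc]
  rw [h1]
  refine (congrArg _ (Q.evβFst_mul (A := H ⊗[k] H) _ _)).trans ?_
  rw [Q.isCounital_Φ_inv.map_left, mul_one]
  have h3 := congrArg (fun h : H => h ⊗ₜ[k] (1 : H)) Q.antipode_Φ
  refine Eq.trans ?_ h3
  generalize Q.Φ.val = t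
  induction t using tensor_induction_right with
  | zero => simp
  | add x y hx hy => simp only [map_add, TensorProduct.add_tmul, hx, hy]
  | tmul a b c => simp [mul_assoc]

/-- `h₁ p¹ ⊗ h₂ p² S(h₃) = p¹ h ⊗ p²`. -/
theorem comul_mul_pR (h : H) :
    mulMap (LinearMap.mulRight k Q.pR ∘ₗ Q.comul.toLinearMap)
      (TensorProduct.mk k H H 1 ∘ₗ Q.S.toLinearMap) (Q.comul h) = Q.pR * (h ⊗ₜ 1) := by
  have h1 : ∀ t : H ⊗[k] H, mulMap (LinearMap.mulRight k Q.pR ∘ₗ Q.comul.toLinearMap)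
      (TensorProduct.mk k H H 1 ∘ₗ Q.S.toLinearMap) t =
      TensorProduct.map LinearMap.id Q.evβ (TensorProduct.assoc k H H H
        (Algebra.TensorProduct.map Q.comul (AlgHom.id k H) t) * Q.Φ.inv) := by
    intro t
    rw [pR]
    induction t using TensorProduct.induction_on with
    | zero => simp
    | add x y hx hy => simp only [map_add, add_mul, hx, hy]
    | tmul a b =>
      simp only [LinearMap.comp_apply, mulMap_tmul,
        Algebra.TensorProduct.map_tmul, AlgHom.toLinearMap_apply, LinearMap.mulRight_apply,
        AlgHom.coe_id, id_eq, TensorProduct.mk_apply, LinearEquiv.coe_coe]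
      generalize Q.comul a = c
      generalize Q.Φ.inv = x
      induction c using TensorProduct.induction_on with
      | zero => simp
      | add x y hx hy => simp only [map_add, add_mul, TensorProduct.add_tmul, hx, hy]
      | tmul c d =>
        induction x using tensor_induction_right with
        | zero => simp
        | add x y hx hy => simp only [map_add, add_mul, mul_add, hx, hy]
        | tmul x y z => simp [Q.S_mul, mul_assoc]
  -- Quasi-coassociativity brings the inner coproduct to the right end of the last two legs, where
  -- the antipode axiom for β collapses it.
  rw [h1, comul_mul_Φ_inv]
  refine (Q.evβ_equivariant.tmul_left (A := H) _ _).trans ?_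
  rw [map_id_counitAlg_comul, pR]

/-- `X¹ h₁ ⊗ S(X² h₂) α X³ h₃ = h X¹ ⊗ S(X²) α X³`. -/
theorem map_evα_Φ_mul_comul (h : H) :
    TensorProduct.map LinearMap.id Q.evα (Q.Φ.val * TensorProduct.assoc k H H H
        (Algebra.TensorProduct.map Q.comul (AlgHom.id k H) (Q.comul h))) = (h ⊗ₜ 1) * Q.qS := by
  rw [Φ_mul_comul]
  refine (Q.evα_equivariant.tmul_left (A := H) _ _).trans ?_
  rw [map_id_counitAlg_comul, qS]

/-- `Δ(q¹) p (1 ⊗ q²) = 1` for `q = X¹ ⊗ S(X²) α X³`. -/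
theorem comul_qS_mul_pR :
    mulMap (LinearMap.mulRight k Q.pR ∘ₗ Q.comul.toLinearMap)
      (TensorProduct.mk k H H 1) Q.qS = 1 := by
  -- F sends a ⊗ b ⊗ c ⊗ d to a ⊗ b β S(c) α d. Read through α it absorbs (id ⊗ id ⊗ Δ)(Φ⁻¹) on the
  -- left; read through β it absorbs (id ⊗ Δ ⊗ id)(Φ) on the right. After the pentagon only 1 ⊗ Φ
  -- remains.
  let F : H ⊗[k] (H ⊗[k] (H ⊗[k] H)) →ₗ[k] H ⊗[k] H := TensorProduct.map LinearMap.id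
    (LinearMap.mul' k H ∘ₗ TensorProduct.map (LinearMap.mulRight k Q.β) LinearMap.id) ∘ₗ
    TensorProduct.map LinearMap.id (TensorProduct.map LinearMap.id Q.evα)
  have hF : F = TensorProduct.map LinearMap.id
      (LinearMap.mul' k H ∘ₗ TensorProduct.map (LinearMap.mulRight k Q.α) LinearMap.id) ∘ₗ
      TensorProduct.map LinearMap.id (Q.evβFst H) := by
    ext t
    · simp [F, mul_assoc]
  have h1 : mulMap (LinearMap.mulRight k Q.pR ∘ₗ Q.comul.toLinearMap)
      (TensorProduct.mk k H H 1) Q.qS = F (Q.comulFst Q.Φ.val * inclInit Q.Φ.inv) := by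
    rw [qS, pR]
    generalize Q.Φ.val = t
    generalize Q.Φ.inv = x
    induction t using tensor_induction_right with
    | zero => simp
    | add x y hx hy => simp only [map_add, add_mul, hx, hy]
    | tmul a b c =>
      simp only [LinearMap.comp_apply, TensorProduct.map_tmul, mulMap_tmul,
        AlgHom.toLinearMap_apply, LinearMap.mulRight_apply, LinearMap.id_apply,
        TensorProduct.mk_apply, comulFst_tmul]
      generalize Q.comul a = d
      induction d using TensorProduct.induction_on with
      | zero => simp
      | add x y hx hy => simp only [map_add, add_mul, TensorProduct.add_tmul, hx, hy]
      | tmul d e =>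
        induction x using tensor_induction_right with
        | zero => simp
        | add x y hx hy => simp only [map_add, add_mul, mul_add, hx, hy]
        | tmul x y z => simp [F, Q.S_mul, mul_assoc]
  rw [h1, comulFst_mul_inclInit_inv]
  have h2 : F (Q.comulThd Q.Φ.inv * (inclTail Q.Φ.val * Q.comulSnd Q.Φ.val)) =
      F (inclTail Q.Φ.val * Q.comulSnd Q.Φ.val) := by
    simp only [F, LinearMap.comp_apply]
    congr 1
    refine ((Q.evα_equivariant.tmul_left (A := H)).tmul_left (A := H) _ _).trans ?_
    rw [Q.isCounital_Φ_inv.map_right, one_mul]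
  have h3 : F (inclTail Q.Φ.val * Q.comulSnd Q.Φ.val) = F (inclTail Q.Φ.val) := by
    rw [hF]
    simp only [LinearMap.comp_apply]
    congr 1
    have h : RightEquivariant (Q.evβFst H) ((Algebra.TensorProduct.assoc k k k H H H).toAlgHom.comp
      (Algebra.TensorProduct.map Q.comul (AlgHom.id k H)))
      (Algebra.TensorProduct.map (Q.counitAlg H) (AlgHom.id k H)) :=
      fun t c => Q.evβFst_mul t c
    refine (h.tmul_left (A := H) _ _).trans ?_
    rw [Q.isCounital_Φ.map_middle, mul_one]
  rw [h2, h3]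
  simp only [F, inclTail_apply, TensorProduct.map_tmul, LinearMap.id_apply, LinearMap.comp_apply]
  have h4 := Q.antipode_Φ
  rw [← LinearMap.comp_id (LinearMap.mulRight k Q.β),
    ← LinearMap.id_comp (antipodeLeft Q.S.toLinearMap Q.α), TensorProduct.map_comp] at h4
  exact congrArg (fun h : H => (1 : H) ⊗ₜ[k] h) h4

end QuasiHopfAlgebra

/-! ### The Drinfeld twist and its removal from the coaction -/

namespace QuasiHopfAlgebra

open QuasiBialgebra

variable {k H : Type*} [Field k] [Ring H] [Algebra k H] (Q : QuasiHopfAlgebra k H)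

/-- `a ⊗ b ↦ S(b) ⊗ S(a)`. -/
def antipodeSwap : H ⊗[k] H →ₗ[k] H ⊗[k] H :=
  TensorProduct.map Q.S.toLinearMap Q.S.toLinearMap ∘ₗ (TensorProduct.comm k H H).toLinearMap

@[simp]
theorem antipodeSwap_tmul (a b : H) : Q.antipodeSwap (a ⊗ₜ b) = Q.S b ⊗ₜ Q.S a := by
  simp [antipodeSwap]

theorem antipodeSwap_mul (t u : H ⊗[k] H) :
    Q.antipodeSwap (t * u) = Q.antipodeSwap u * Q.antipodeSwap t := by
  induction t using TensorProduct.induction_on with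
  | zero => simp
  | add x y hx hy => simp only [map_add, add_mul, mul_add, hx, hy]
  | tmul a b =>
    induction u using TensorProduct.induction_on with
    | zero => simp
    | add x y hx hy => simp only [map_add, add_mul, mul_add, hx, hy]
    | tmul c d => simp [Q.S_mul]

theorem antipodeCop_apply (h : H) : Q.antipodeCop h = Q.antipodeSwap (Q.comul h) := rfl

theorem antipodeCop_mul (a b : H) :
    Q.antipodeCop (a * b) = Q.antipodeCop b * Q.antipodeCop a := by
  simp only [antipodeCop_apply, map_mul, antipodeSwap_mul]

/-- `b ⊗ c ↦ (S(b) ⊗ 1) (S(x¹) α x² ⊗ x³) Δ(c)`. -/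
def qLMap : H ⊗[k] H →ₗ[k] H ⊗[k] H :=
  mulMap (LinearMap.mulRight k Q.qL ∘ₗ (TensorProduct.mk k H H).flip 1 ∘ₗ Q.S.toLinearMap)
    Q.comul.toLinearMap

theorem qLMap_tmul (b c : H) : Q.qLMap (b ⊗ₜ c) = (Q.S b ⊗ₜ 1) * Q.qL * Q.comul c := by
  simp [qLMap]

theorem qLMap_eq (t : H ⊗[k] H) : Q.qLMap t =
    Q.evαFst H (Q.Φ.inv * Algebra.TensorProduct.map (AlgHom.id k H) Q.comul t) := by
  rw [qLMap, qL]
  generalize Q.Φ.inv = x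
  induction t using TensorProduct.induction_on with
  | zero => simp
  | add x y hx hy => simp only [map_add, mul_add, hx, hy]
  | tmul a b =>
    simp only [LinearMap.comp_apply, mulMap_tmul,
      Algebra.TensorProduct.map_tmul, AlgHom.toLinearMap_apply, LinearMap.mulRight_apply,
      AlgHom.coe_id, id_eq, TensorProduct.mk_apply, LinearEquiv.coe_coe, LinearMap.flip_apply]
    generalize Q.comul b = c
    induction c using TensorProduct.induction_on with
    | zero => simp
    | add x y hx hy => simp only [map_add, mul_add, TensorProduct.tmul_add, hx, hy]
    | tmul c d =>
      induction x using tensor_induction_right with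
      | zero => simp
      | add x y hx hy => simp only [map_add, add_mul, mul_add, hx, hy]
      | tmul x y z => simp [Q.S_mul, mul_assoc]

theorem elementD_eq_qLMap : Q.elementD = TensorProduct.map LinearMap.id Q.qLMap Q.Φ.val := by
  rw [elementD, starElement]
  generalize Q.Φ.val = t
  induction t using tensor_induction_right with
  | zero => simp
  | add x y hx hy => simp only [map_add, mul_add, hx, hy]
  | tmul a b c =>
    simp only [TensorProduct.map_tmul, LinearMap.id_apply, qLMap_eq, Algebra.TensorProduct.map_tmul,
      AlgHom.coe_id, id_eq, AlgHom.toLinearMap_apply, Algebra.TensorProduct.tmul_mul_tmul, one_mul]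

/-- `S(h₁) q¹ h₂ ⊗ q² h₃ = q¹ ⊗ h q²` for `q = S(x¹) α x² ⊗ x³`. -/
theorem qLMap_comul (h : H) : Q.qLMap (Q.comul h) = (1 ⊗ₜ h) * Q.qL := by
  rw [qLMap_eq, ← comul_mul_Φ_inv]
  refine (Q.evαFst_mul _ _).trans ?_
  rw [map_counitAlg_id_comul, qL]

/-- `a ⊗ b ↦ Δ(a) p (1 ⊗ S(b))`. -/
def pRMap : H ⊗[k] H →ₗ[k] H ⊗[k] H :=
  mulMap (LinearMap.mulRight k Q.pR ∘ₗ Q.comul.toLinearMap)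
    (TensorProduct.mk k H H 1 ∘ₗ Q.S.toLinearMap)

theorem pRMap_tmul (a b : H) : Q.pRMap (a ⊗ₜ b) = Q.comul a * Q.pR * (1 ⊗ₜ Q.S b) := by
  simp [pRMap]

theorem pRMap_comul (h : H) : Q.pRMap (Q.comul h) = Q.pR * (h ⊗ₜ 1) := Q.comul_mul_pR h

theorem pRMap_mul (a b : H) (t : H ⊗[k] H) :
    Q.pRMap ((a ⊗ₜ b) * t) = Q.comul a * Q.pRMap t * (1 ⊗ₜ Q.S b) := by
  induction t using TensorProduct.induction_on with
  | zero => simp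
  | add x y hx hy => simp only [map_add, add_mul, mul_add, hx, hy]
  | tmul c d => simp [pRMap_tmul, Q.S_mul, mul_assoc]

/-- `Δ(S(x¹) α x²) p (1 ⊗ S(x³))`. -/
def elementG : H ⊗[k] H := Q.pRMap Q.qL

theorem one_tmul_mul_tmul_one (a b : H) :
    (a ⊗ₜ[k] (1 : H)) * ((1 : H) ⊗ₜ[k] b) = (1 ⊗ₜ b) * (a ⊗ₜ 1) := by simp

/-- The element p swallows a coproduct as Δ(h₁) p (1 ⊗ S(h₂)) = p (h ⊗ 1), and h ⊗ 1 commutes with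
the outer factor 1 ⊗ S(b). -/
theorem pRMap_mul_comul (t : H ⊗[k] H) (h : H) :
    Q.pRMap (t * Q.comul h) = Q.pRMap t * (h ⊗ₜ 1) := by
  induction t using TensorProduct.induction_on with
  | zero => simp
  | add x y hx hy => simp only [map_add, add_mul, hx, hy]
  | tmul a b =>
    rw [pRMap_mul, pRMap_comul, pRMap_tmul, mul_assoc, mul_assoc, mul_assoc, mul_assoc,
      one_tmul_mul_tmul_one]

theorem pRMap_qLMap (b c : H) :
    Q.pRMap (Q.qLMap (b ⊗ₜ c)) = Q.comul (Q.S b) * Q.elementG * (c ⊗ₜ 1) := by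
  rw [qLMap_tmul, pRMap_mul_comul, pRMap_mul, Q.S_one, elementG]
  congr 1
  exact mul_one _

/-- `a ⊗ b ↦ Δ(S(a)) G (b ⊗ 1)`. -/
def elementGMap : H ⊗[k] H →ₗ[k] H ⊗[k] H :=
  mulMap (LinearMap.mulRight k Q.elementG ∘ₗ Q.comul.toLinearMap ∘ₗ Q.S.toLinearMap)
    ((TensorProduct.mk k H H).flip 1)

theorem elementGMap_tmul (a b : H) :
    Q.elementGMap (a ⊗ₜ b) = Q.comul (Q.S a) * Q.elementG * (b ⊗ₜ 1) := by
  simp [elementGMap]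

theorem elementGMap_eq (t : H ⊗[k] H) : Q.elementGMap t = Q.pRMap (Q.qLMap t) := by
  induction t using TensorProduct.induction_on with
  | zero => simp
  | add x y hx hy => simp only [map_add, hx, hy]
  | tmul a b => rw [pRMap_qLMap, elementGMap_tmul]

/-- G inherits this from its two constituents: `qLMap` sends Δ(h) to (1 ⊗ h) `qL`, and `pRMap` turns
the factor 1 ⊗ h on the left into 1 ⊗ S(h) on the right. -/
theorem elementGMap_comul (h : H) :
    Q.elementGMap (Q.comul h) = Q.elementG * (1 ⊗ₜ Q.S h) := by
  rw [elementGMap_eq, qLMap_comul, pRMap_mul, map_one, one_mul, elementG]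

theorem elementGMap_mul (t : H ⊗[k] H) (a b : H) :
    Q.elementGMap (t * (a ⊗ₜ b)) = Q.comul (Q.S a) * Q.elementGMap t * (b ⊗ₜ 1) := by
  induction t using TensorProduct.induction_on with
  | zero => simp
  | add x y hx hy => simp only [map_add, add_mul, mul_add, hx, hy]
  | tmul c d => simp [elementGMap_tmul, Q.S_mul, mul_assoc]

/-- `a ⊗ t ↦ Δ(a) p (β ⊗ 1) (S ⊗ S)(t₂ ⊗ t₁)`. -/
def betaMap : H ⊗[k] (H ⊗[k] H) →ₗ[k] H ⊗[k] H :=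
  mulMap (LinearMap.mulRight k (Q.pR * (Q.β ⊗ₜ 1)) ∘ₗ Q.comul.toLinearMap) Q.antipodeSwap

theorem betaMap_tmul (a : H) (t : H ⊗[k] H) :
    Q.betaMap (a ⊗ₜ t) = Q.comul a * (Q.pR * (Q.β ⊗ₜ 1)) * Q.antipodeSwap t := by
  simp [betaMap, mul_assoc]

/-- The legs x² β S(x³) combine into p, so that δ = Δ(X¹) p (β ⊗ 1) (S(X³) ⊗ S(X²)). In this form
the properties of δ follow from those of p. -/
theorem delta_eq : Q.delta = Q.betaMap Q.Φ.val := by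
  rw [delta, elementB, betaMap, pR]
  generalize Q.Φ.val = t
  generalize Q.Φ.inv = x
  induction t using tensor_induction_right with
  | zero => simp
  | add x y hx hy => simp only [map_add, add_mul, hx, hy]
  | tmul a b c =>
    simp only [LinearMap.comp_apply, TensorProduct.map_tmul, mulMap_tmul,
      AlgHom.toLinearMap_apply, LinearMap.mulRight_apply, LinearMap.id_apply]
    generalize Q.comul a = d
    induction d using TensorProduct.induction_on with
    | zero => simp
    | add x y hx hy => simp only [map_add, add_mul, TensorProduct.add_tmul, hx, hy]
    | tmul d e =>
      induction x using tensor_induction_right with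
      | zero => simp
      | add x y hx hy => simp only [map_add, add_mul, mul_add, hx, hy]
      | tmul x y z => simp [deltaMap, Q.S_mul, mul_assoc]

/-- `a ⊗ b ↦ Δ(a) δ (S ⊗ S)(Δᶜᵒᵖ(b))`. -/
def deltaSandwich : H ⊗[k] H →ₗ[k] H ⊗[k] H :=
  mulMap (LinearMap.mulRight k Q.delta ∘ₗ Q.comul.toLinearMap) Q.antipodeCop

theorem deltaSandwich_tmul (a b : H) :
    Q.deltaSandwich (a ⊗ₜ b) = Q.comul a * Q.delta * Q.antipodeCop b := by
  simp [deltaSandwich]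

theorem deltaSandwich_eq (t : H ⊗[k] H) : Q.deltaSandwich t =
    Q.betaMap (Algebra.TensorProduct.map (AlgHom.id k H) Q.comul t * Q.Φ.val) := by
  rw [deltaSandwich, delta_eq]
  generalize Q.Φ.val = x
  induction t using TensorProduct.induction_on with
  | zero => simp
  | add x y hx hy => simp only [map_add, add_mul, hx, hy]
  | tmul a b =>
    induction x using TensorProduct.induction_on with
    | zero => simp
    | add x y hx hy =>
      simp only [map_add, mul_add, mulMap_tmul, LinearMap.comp_apply, LinearMap.mulRight_apply,
        add_mul] at hx hy ⊢
      rw [hx, hy]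
    | tmul x u => simp [betaMap_tmul, antipodeSwap_mul, antipodeCop_apply, mul_assoc]

theorem betaMap_mul_assoc (u : H ⊗[k] (H ⊗[k] H)) (a b : H) :
    Q.betaMap (u * TensorProduct.assoc k H H H (Q.comul a ⊗ₜ b)) =
      mulMap (LinearMap.mulRight k (Q.pR * (Q.evβ (a ⊗ₜ b) ⊗ₜ 1)) ∘ₗ Q.comul.toLinearMap)
        Q.antipodeSwap u := by
  have h : ∀ (x y z : H) (t : H ⊗[k] H), Q.betaMap ((x ⊗ₜ (y ⊗ₜ z)) *
      TensorProduct.assoc k H H H (t ⊗ₜ b)) =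
      Q.comul x * Q.pRMap t * ((Q.β * Q.S b * Q.S z) ⊗ₜ Q.S y) := by
    intro x y z t
    induction t using TensorProduct.induction_on with
    | zero => simp
    | add x y hx hy => simp only [map_add, add_mul, mul_add, TensorProduct.add_tmul, hx, hy]
    | tmul c d => simp [betaMap_tmul, pRMap_tmul, Q.S_mul, mul_assoc]
  induction u using tensor_induction_right with
  | zero => simp
  | add x y hx hy => simp only [map_add, add_mul, hx, hy]
  | tmul x y z =>
    rw [h, pRMap_comul]
    simp [mul_assoc]

/-- Quasi-coassociativity moves Φ to the left of (Δ ⊗ id)Δ(h). Then Δ(h₁) p (1 ⊗ S(h₂)) = p (h ⊗ 1)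
handles the inner coproduct, and the outer one meets β as h₁ β S(h₂) = ε(h) β. -/
theorem deltaSandwich_comul (h : H) :
    Q.deltaSandwich (Q.comul h) = Q.counit h • Q.delta := by
  rw [deltaSandwich_eq, ← Φ_mul_comul]
  have h1 : ∀ t : H ⊗[k] H, Q.betaMap (Q.Φ.val * TensorProduct.assoc k H H H
      (Algebra.TensorProduct.map Q.comul (AlgHom.id k H) t)) =
      mulMap (LinearMap.mulRight k (Q.pR * (Q.evβ t ⊗ₜ 1)) ∘ₗ Q.comul.toLinearMap)
        Q.antipodeSwap Q.Φ.val := by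
    intro t
    induction t using TensorProduct.induction_on with
    | zero => simp [mulMap]
    | add x y hx hy =>
      simp only [map_add, mul_add, hx, hy, TensorProduct.add_tmul]
      generalize Q.Φ.val = u
      induction u using TensorProduct.induction_on with
      | zero => simp
      | add x y hx hy => simp only [map_add, ← hx, ← hy]; abel
      | tmul a b => simp [mul_add, add_mul, mul_assoc]
    | tmul a b =>
      refine (Q.betaMap_mul_assoc _ a b)
  rw [h1, Q.antipode_right, delta_eq, betaMap]
  generalize Q.Φ.val = u
  induction u using TensorProduct.induction_on with
  | zero => simp
  | add x y hx hy => simp only [map_add, hx, hy, smul_add]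
  | tmul a b => simp [← TensorProduct.smul_tmul', mul_assoc]

theorem deltaSandwich_mul (a b : H) (t : H ⊗[k] H) :
    Q.deltaSandwich ((a ⊗ₜ b) * t) = Q.comul a * Q.deltaSandwich t * Q.antipodeCop b := by
  induction t using TensorProduct.induction_on with
  | zero => simp
  | add x y hx hy => simp only [map_add, add_mul, mul_add, hx, hy]
  | tmul c d => simp [deltaSandwich_tmul, antipodeCop_mul, mul_assoc]

theorem twistInv_eq : Q.twistInv = Q.deltaSandwich Q.qL := by
  rw [twistInv, qL]
  generalize Q.Φ.inv = x
  induction x using tensor_induction_right with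
  | zero => simp
  | add x y hx hy => simp only [map_add, hx, hy]
  | tmul x y z => simp [twistInvMap, deltaSandwich_tmul]

theorem antipodeCop_one : Q.antipodeCop 1 = 1 := by
  simp [antipodeCop_apply, Algebra.TensorProduct.one_def, Q.S_one]

/-- `f⁻¹ (S ⊗ S)(Δᶜᵒᵖ(h)) = Δ(S(h)) f⁻¹`. -/
theorem twistInv_mul_antipodeCop (h : H) :
    Q.twistInv * Q.antipodeCop h = Q.comul (Q.S h) * Q.twistInv := by
  have h1 : ∀ t b, Q.deltaSandwich (t * Q.comul b) = Q.counit b • Q.deltaSandwich t := by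
    intro t b
    induction t using TensorProduct.induction_on with
    | zero => simp
    | add x y hx hy => simp only [map_add, add_mul, hx, hy, smul_add]
    | tmul c d => rw [deltaSandwich_mul, deltaSandwich_comul]; simp [deltaSandwich_tmul]
  -- `deltaSandwich` of `qLMap` (Δ(h)) is evaluated in two ways. Collapsing Δ(h) against `qL` gives
  -- the left side of the claim; letting δ absorb the second coproduct leaves a counit, and hence
  -- the right side.
  have h2 := congrArg Q.deltaSandwich (Q.qLMap_comul h)
  rw [deltaSandwich_mul, map_one, one_mul, ← twistInv_eq] at h2
  rw [← h2]
  have h3 : ∀ a b, Q.deltaSandwich (Q.qLMap (a ⊗ₜ b)) =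
      Q.counit b • (Q.comul (Q.S a) * Q.twistInv) := by
    intro a b
    rw [qLMap_tmul, h1, deltaSandwich_mul, antipodeCop_one, twistInv_eq]
    congr 1
    exact mul_one _
  have h4 := Q.comul_counit_right (Q.deltaSandwich ∘ₗ Q.qLMap) (fun a b => ?_) h
  · simp only [LinearMap.comp_apply] at h4
    rw [h4, h3, map_one, one_smul]
  · simp only [LinearMap.comp_apply, h3, map_one, one_smul]

/-- `(id ⊗ Δ)(q) Φ`, for `q = S(x¹) α x² ⊗ x³`. -/
theorem map_comul_qL_mul_Φ : Algebra.TensorProduct.map (AlgHom.id k H) Q.comul Q.qL * Q.Φ.val =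
    Q.evαFst (H ⊗[k] H) (inclInit Q.Φ.inv * Q.comulSnd Q.Φ.inv) := by
  have h1 : Algebra.TensorProduct.map (AlgHom.id k H) Q.comul Q.qL * Q.Φ.val =
      Q.evαFst (H ⊗[k] H) (Q.comulThd Q.Φ.inv * inclTail Q.Φ.val) := by
    rw [qL]
    generalize Q.Φ.val = t
    generalize Q.Φ.inv = x
    induction x using tensor_induction_right with
    | zero => simp
    | add x y hx hy => simp only [map_add, add_mul, hx, hy]
    | tmul x y z =>
      induction t using TensorProduct.induction_on with
      | zero => simp
      | add x y hx hy => simp only [map_add, mul_add, hx, hy]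
      | tmul a b => simp [mul_assoc]
  rw [h1, comulThd_inv_mul_inclTail]
  refine (Q.evαFst_mul (A := H ⊗[k] H) _ _).trans ?_
  rw [Q.isCounital_Φ.map_left, one_mul]

/-- `S(q²) ⊗ S(q¹) = S(X²) α X³ ⊗ S(X¹)`. -/
theorem antipodeSwap_qR : Q.antipodeSwap Q.qR =
    (TensorProduct.map LinearMap.id Q.S.toLinearMap ∘ₗ (TensorProduct.comm k H H).toLinearMap)
      Q.qS := by
  rw [qR, qS]
  generalize Q.Φ.val = t
  induction t using tensor_induction_right with
  | zero => simp
  | add x y hx hy => simp only [map_add, hx, hy]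
  | tmul x y z => simp [qMap, Q.S_mul, mul_assoc]

/-- `f⁻¹ (S(q²) ⊗ S(q¹)) = Δ(S(x¹) α x²) p (1 ⊗ S(x³))`. -/
theorem twistInv_mul_antipodeSwap_qR : Q.twistInv * Q.antipodeSwap Q.qR = Q.elementG := by
  set w := Q.antipodeSwap Q.qR with hw
  have h1 : Q.twistInv = Q.betaMap
      (Algebra.TensorProduct.map (AlgHom.id k H) Q.comul Q.qL * Q.Φ.val) := by
    rw [twistInv_eq, deltaSandwich_eq]
  rw [h1, map_comul_qL_mul_Φ]
  -- At t = Φ⁻¹ this says f⁻¹ = Δ(S(p¹)) G (p² ⊗ 1), with p = `pR`.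
  have h2 : ∀ t : H ⊗[k] (H ⊗[k] H), Q.betaMap (Q.evαFst (H ⊗[k] H)
      (inclInit Q.Φ.inv * Q.comulSnd t)) =
      Q.elementGMap (TensorProduct.map LinearMap.id Q.evβ t) := by
    intro t
    rw [elementGMap, elementG, qL]
    generalize Q.Φ.inv = x
    induction t using tensor_induction_right with
    | zero => simp
    | add x y hx hy => simp only [map_add, mul_add, hx, hy]
    | tmul a b c =>
      induction x using tensor_induction_right with
      | zero => simp [mulMap]
      | add x y hx hy => simp [add_mul, mul_add] at hx hy ⊢; rw [hx, hy]
      | tmul x y z =>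
        have h3 : ∀ u : H ⊗[k] H, Q.betaMap (Q.evαFst (H ⊗[k] H)
            (inclInit (x ⊗ₜ (y ⊗ₜ z)) * (a ⊗ₜ TensorProduct.assoc k H H H (u ⊗ₜ c)))) =
            Q.comul (Q.S a * Q.S x * Q.α * y) * Q.pRMap u * ((Q.β * Q.S c) ⊗ₜ Q.S z) := by
          intro u
          induction u using TensorProduct.induction_on with
          | zero => simp
          | add x y hx hy =>
            simp only [map_add, mul_add, add_mul, TensorProduct.add_tmul, TensorProduct.tmul_add,
              hx, hy]
          | tmul u v => simp [betaMap_tmul, pRMap_tmul, Q.S_mul, mul_assoc]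
        rw [comulSnd_tmul, h3, pRMap_comul]
        simp [pRMap_tmul, mul_assoc]
  rw [h2]
  -- Here w = q² ⊗ S(q¹) for q = `qS`. By `elementGMap_comul` the factor 1 ⊗ S(q¹) passes through G
  -- as a coproduct of q¹, so multiplication by w replaces p by Δ(q¹) p (1 ⊗ q²), which is 1.
  have h3 : ∀ t : H ⊗[k] H, Q.elementGMap t * w = Q.elementGMap
      (mulMap (LinearMap.mulRight k t ∘ₗ Q.comul.toLinearMap) (TensorProduct.mk k H H 1) Q.qS) := by
    intro t
    rw [hw, antipodeSwap_qR]
    generalize Q.qS = q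
    induction q using TensorProduct.induction_on with
    | zero => simp
    | add x y hx hy => simp only [map_add, mul_add, hx, hy]
    | tmul z e =>
      induction t using TensorProduct.induction_on with
      | zero => simp [mulMap]
      | add x y hx hy =>
        simp only [mulMap_tmul, LinearMap.comp_apply, LinearMap.mulRight_apply] at hx hy ⊢
        simp only [map_add, mul_add, add_mul, hx, hy]
      | tmul a b =>
        simp only [mulMap_tmul, LinearMap.comp_apply, LinearMap.mulRight_apply,
          AlgHom.toLinearMap_apply, TensorProduct.mk_apply]
        rw [mul_assoc, Algebra.TensorProduct.tmul_mul_tmul, mul_one, elementGMap_mul,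
          elementGMap_comul, elementGMap_tmul]
        simp [mul_assoc]
  have h4 := h3 Q.pR
  rw [comul_qS_mul_pR] at h4
  refine h4.trans ?_
  rw [Algebra.TensorProduct.one_def, elementGMap_tmul, Q.S_one, map_one, one_mul]
  exact mul_one _

/-- The coaction element in terms of `elementD` and `pR`. -/
theorem elementK_eq : Q.elementK =
    mulMap (LinearMap.mulRight k (TensorProduct.map Q.comul.toLinearMap Q.pRMap Q.elementD) ∘ₗ
        (TensorProduct.mk k (H ⊗[k] H) (H ⊗[k] H)).flip 1)
      (TensorProduct.mk k (H ⊗[k] H) (H ⊗[k] H) 1 ∘ₗ TensorProduct.mk k H H 1 ∘ₗ Q.S.toLinearMap)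
      ((TensorProduct.assoc k H H H).symm Q.Φ.val) := by
  -- Read from right to left: f⁻¹ passes (S ⊗ S)Δᶜᵒᵖ(Y²), which becomes Δ(S(Y²)), and then meets
  -- S(q²) ⊗ S(q¹) from `qR`, where it turns into G. The twist thus disappears from the coaction
  -- element.
  have h1 : TensorProduct.map Q.comul.toLinearMap Q.pRMap Q.elementD =
      TensorProduct.map Q.comul.toLinearMap (mulMap (LinearMap.mulLeft k Q.twistInv ∘ₗ
        LinearMap.mulRight k (Q.antipodeSwap Q.qR) ∘ₗ Q.antipodeCop)
        ((TensorProduct.mk k H H).flip 1)) Q.Φ.val := by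
    rw [elementD_eq_qLMap]
    generalize Q.Φ.val = t
    induction t using tensor_induction_right with
    | zero => simp
    | add x y hx hy => simp only [map_add, hx, hy]
    | tmul x y z =>
      simp only [TensorProduct.map_tmul, LinearMap.id_apply, mulMap_tmul, LinearMap.comp_apply,
        LinearMap.mulLeft_apply, LinearMap.mulRight_apply]
      rw [pRMap_qLMap, ← mul_assoc, twistInv_mul_antipodeCop, mul_assoc (Q.comul (Q.S y)) Q.twistInv,
        twistInv_mul_antipodeSwap_qR]
      rfl
  rw [h1, elementK, coactElement, coactRightMap]
  -- The twist identities have been used up. What is left holds for arbitrary g and q, because S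
  -- reverses products.
  generalize Q.twistInv = g
  generalize Q.qR = q
  have key : ∀ t u : H ⊗[k] (H ⊗[k] H),
      TensorProduct.map LinearMap.id (LinearMap.mulLeft k g ∘ₗ
        (TensorProduct.comm k H H).toLinearMap ∘ₗ
        TensorProduct.map Q.S.toLinearMap (antipodeLeft Q.S.toLinearMap 1))
      (TensorProduct.map LinearMap.id
      ((Algebra.TensorProduct.includeLeft : H →ₐ[k] H ⊗[k] (H ⊗[k] H)).toLinearMap)
      ((TensorProduct.assoc k H H H).symm t) *
    ((1 : H ⊗[k] H) ⊗ₜ[k] TensorProduct.map LinearMap.id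
      ((Algebra.TensorProduct.includeLeft : H →ₐ[k] H ⊗[k] H).toLinearMap) q) *
    TensorProduct.map Q.comul.toLinearMap
      ((TensorProduct.assoc k H H H).toLinearMap ∘ₗ
        TensorProduct.map Q.comul.toLinearMap LinearMap.id) u) =
      mulMap (LinearMap.mulRight k (TensorProduct.map Q.comul.toLinearMap
          (mulMap (LinearMap.mulLeft k g ∘ₗ
          LinearMap.mulRight k (Q.antipodeSwap q) ∘ₗ Q.antipodeCop)
          ((TensorProduct.mk k H H).flip 1)) u) ∘ₗ
        (TensorProduct.mk k (H ⊗[k] H) (H ⊗[k] H)).flip 1)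
      (TensorProduct.mk k (H ⊗[k] H) (H ⊗[k] H) 1 ∘ₗ TensorProduct.mk k H H 1 ∘ₗ Q.S.toLinearMap)
      ((TensorProduct.assoc k H H H).symm t) := by
    intro t u
    induction t using tensor_induction_right with
    | zero => simp
    | add x y hx hy => simp only [map_add, add_mul, hx, hy]
    | tmul x y z =>
      induction u using tensor_induction_right with
      | zero => simp [mulMap]
      | add x y hx hy =>
        simp only [TensorProduct.assoc_symm_tmul, mulMap_tmul, LinearMap.comp_apply,
          LinearMap.mulRight_apply] at hx hy ⊢
        simp only [map_add, add_mul, mul_add, hx, hy]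
      | tmul a b c =>
        simp only [TensorProduct.assoc_symm_tmul, mulMap_tmul, LinearMap.comp_apply,
          LinearMap.mulRight_apply, TensorProduct.map_tmul, AlgHom.toLinearMap_apply,
          LinearMap.id_apply, LinearMap.mulLeft_apply, antipodeCop_apply, LinearEquiv.coe_coe,
          TensorProduct.mk_apply, LinearMap.flip_apply]
        generalize Q.comul a = d
        generalize Q.comul b = e
        induction q using TensorProduct.induction_on with
        | zero => simp
        | add x y hx hy =>
          simp only [map_add, add_mul, mul_add, TensorProduct.tmul_add, hx, hy]
        | tmul q r =>
          induction e using TensorProduct.induction_on with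
          | zero => simp
          | add x y hx hy =>
            simp only [map_add, add_mul, mul_add, TensorProduct.tmul_add, TensorProduct.add_tmul,
              hx, hy]
          | tmul e f => simp [Q.S_mul, mul_assoc]
  exact key _ _

end QuasiHopfAlgebra

/-! ### Dressings into a comodule algebra and right invariant maps -/

section Dressing

open QuasiBialgebra

variable {k H : Type*} [Field k] [Ring H] [Algebra k H] (Q : QuasiBialgebra k H)
variable {C : Type*} [Ring C] [Algebra k C]
variable {M N P V : Type*} [AddCommGroup M] [Module k M] [AddCommGroup N] [Module k N]
  [AddCommGroup P] [Module k P] [AddCommGroup V] [Module k V]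

/-- An algebra `C` with an algebra map `v : H → C` and an algebra map `lam : C → H ⊗ C` which is
a counital coaction, coassociative up to conjugation with `Φ`. -/
structure IsComoduleAlgebra (v : H →ₐ[k] C) (lam : C →ₐ[k] H ⊗[k] C) : Prop where
  lam_v : ∀ h, lam (v h) = Algebra.TensorProduct.map (AlgHom.id k H) v (Q.comul h)
  quasi_coassoc : ∀ c,
    Algebra.TensorProduct.map (AlgHom.id k H) lam (lam c) *
        Algebra.TensorProduct.map (AlgHom.id k H) (Algebra.TensorProduct.map (AlgHom.id k H) v)
          Q.Φ.val =
      Algebra.TensorProduct.map (AlgHom.id k H) (Algebra.TensorProduct.map (AlgHom.id k H) v)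
          Q.Φ.val *
        TensorProduct.assoc k H H C
          (Algebra.TensorProduct.map Q.comul (AlgHom.id k C) (lam c))
  counit : ∀ c, Algebra.TensorProduct.map Q.counit (AlgHom.id k C) (lam c) = 1 ⊗ₜ c

/-- `v(h) D(m) = D(h₁ · m) v(h₂)`. -/
def Intertwines (aM : H →ₗ[k] M →ₗ[k] M) (v : H →ₐ[k] C) (D : M →ₗ[k] C) : Prop :=
  ∀ h m, v h * D m = mulMap (D ∘ₗ aM.flip m) v.toLinearMap (Q.comul h)

/-- `m ↦ X¹ m₍₋₁₎ ⊗ D(X² · m₍₀₎) v(X³)`, as a function of `m₍₋₁₎ ⊗ m₍₀₎`. -/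
def dressCoact (aM : H →ₗ[k] M →ₗ[k] M) (v : H →ₐ[k] C) (D : M →ₗ[k] C) :
    H ⊗[k] M →ₗ[k] H ⊗[k] C :=
  TensorProduct.map LinearMap.id (mulMap D v.toLinearMap) ∘ₗ
    associator Q regAct aM regAct ∘ₗ (TensorProduct.mk k (H ⊗[k] M) H).flip 1

/-- `X¹ m₍₋₁₎ ⊗ D(X² · m₍₀₎) v(X³) = lam(D(X¹ · m)) (X² ⊗ v(X³))`. -/
def Cointertwines (aM : H →ₗ[k] M →ₗ[k] M) (cM : M →ₗ[k] H ⊗[k] M) (v : H →ₐ[k] C)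
    (lam : C →ₐ[k] H ⊗[k] C) (D : M →ₗ[k] C) : Prop :=
  ∀ m, dressCoact Q aM v D (cM m) =
    mulMap (lam.toLinearMap ∘ₗ D ∘ₗ aM.flip m)
      (TensorProduct.map LinearMap.id v.toLinearMap) Q.Φ.val

/-- `a ⊗ b ↦ D(X¹ · a) D'(X² · b) v(X³)`. -/
def dressMul (aM : H →ₗ[k] M →ₗ[k] M) (aN : H →ₗ[k] N →ₗ[k] N) (v : H →ₐ[k] C)
    (D : M →ₗ[k] C) (D' : N →ₗ[k] C) : M ⊗[k] N →ₗ[k] C :=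
  mulMap D (mulMap D' v.toLinearMap) ∘ₗ associator Q aM aN regAct ∘ₗ
    (TensorProduct.mk k (M ⊗[k] N) H).flip 1

variable {Q}
variable {aM : H →ₗ[k] M →ₗ[k] M} {cM : M →ₗ[k] H ⊗[k] M} {aN : H →ₗ[k] N →ₗ[k] N}
  {cN : N →ₗ[k] H ⊗[k] N} {v : H →ₐ[k] C} {lam : C →ₐ[k] H ⊗[k] C} {D : M →ₗ[k] C}
  {D' : N →ₗ[k] C} {κ : C →ₗ[k] P}

theorem dressMul_tmul (m : M) (n : N) : dressMul Q aM aN v D D' (m ⊗ₜ n) =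
    mulMap (D ∘ₗ aM.flip m) (mulMap (D' ∘ₗ aN.flip n) v.toLinearMap) Q.Φ.val := by
  simp only [dressMul, LinearMap.comp_apply, LinearMap.flip_apply, TensorProduct.mk_apply,
    associator_tmul]
  generalize Q.Φ.val = t
  induction t using tensor_induction_right with
  | zero => simp
  | add x y hx hy => simp only [map_add, hx, hy]
  | tmul x y z => simp

theorem dressCoact_tmul (g : H) (m : M) : dressCoact Q aM v D (g ⊗ₜ m) =
    TensorProduct.map (LinearMap.mulRight k g) (mulMap (D ∘ₗ aM.flip m) v.toLinearMap)
      Q.Φ.val := by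
  simp only [dressCoact, LinearMap.comp_apply, LinearMap.flip_apply, TensorProduct.mk_apply,
    associator_tmul]
  generalize Q.Φ.val = t
  induction t using tensor_induction_right with
  | zero => simp
  | add x y hx hy => simp only [map_add, hx, hy]
  | tmul x y z => simp

/-- A linear map that kills the right multiplications by `v(h)`. -/
def RightInvariant (Q : QuasiBialgebra k H) (v : H →ₐ[k] C) (κ : C →ₗ[k] P) : Prop :=
  ∀ c h, κ (c * v h) = Q.counit h • κ c

/-- Passing v(h) across D leaves v(h₂) at the right end, where κ sees only ε(h₂). Under κ,
multiplying by v(h) is therefore the action of h. -/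
theorem Intertwines.apply_mul (hD : Intertwines Q aM v D) (hκ : RightInvariant Q v κ)
    (c : C) (h : H) (m : M) : κ (c * (v h * D m)) = κ (c * D (aM h m)) := by
  rw [hD h m]
  have := Q.comul_counit_right (κ ∘ₗ LinearMap.mulLeft k c ∘ₗ
    mulMap (D ∘ₗ aM.flip m) v.toLinearMap) (fun a b => ?_) h
  · simpa using this
  · simp only [LinearMap.comp_apply, LinearMap.mulLeft_apply, mulMap_tmul,
      AlgHom.toLinearMap_apply, map_one, mul_one, ← mul_assoc, hκ _ b]

theorem Intertwines.apply_mul_right (hD : Intertwines Q aM v D) (hκ : RightInvariant Q v κ)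
    (h : H) (m : M) : κ (v h * D m) = κ (D (aM h m)) := by
  simpa using hD.apply_mul hκ 1 h m

/-- The leg v(X³) stands at the right end, so κ replaces it by its counit and the whole correction
by Φ becomes trivial. -/
theorem RightInvariant.dressMul (hκ : RightInvariant Q v κ) (hM : ∀ m, aM 1 m = m)
    (hN : ∀ n, aN 1 n = n) (m : M) (n : N) :
    κ (dressMul Q aM aN v D D' (m ⊗ₜ n)) = κ (D m * D' n) := by
  rw [dressMul_tmul]
  have := Q.isCounital_Φ.apply_right (κ ∘ₗ
    mulMap (D ∘ₗ aM.flip m) (mulMap (D' ∘ₗ aN.flip n) v.toLinearMap)) (fun a b c => ?_)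
  · simpa [Algebra.TensorProduct.one_def, hM, hN] using this
  · simp only [LinearMap.comp_apply, mulMap_tmul, AlgHom.toLinearMap_apply, map_one, mul_one,
      ← mul_assoc, hκ _ c]

/-- The right translation of the last factor in `H ⊗ C`. -/
theorem RightInvariant.coact {Ψ : H ⊗[k] C →ₗ[k] P}
    (hΨ : ∀ z h, Ψ (z * (1 ⊗ₜ v h)) = Q.counit h • Ψ z) (hM : ∀ m, aM 1 m = m)
    (hD : Cointertwines Q aM cM v lam D) (m : M) :
    Ψ (lam (D m)) = Ψ (TensorProduct.map LinearMap.id D (cM m)) := by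
  have h1 := congrArg Ψ (hD m)
  -- On both sides of the cointertwining relation the third leg of Φ is a right factor 1 ⊗ v(X³).
  -- Hence Ψ sees only its counit, and both copies of Φ drop out.
  have h2 : ∀ w, Ψ (dressCoact Q aM v D w) = Ψ (TensorProduct.map LinearMap.id D w) := by
    intro w
    induction w using TensorProduct.induction_on with
    | zero => simp
    | add x y hx hy => simp only [map_add, hx, hy]
    | tmul g m =>
      rw [dressCoact_tmul]
      have := Q.isCounital_Φ.apply_right (Ψ ∘ₗ TensorProduct.map (LinearMap.mulRight k g)
        (mulMap (D ∘ₗ aM.flip m) v.toLinearMap)) (fun a b c => ?_)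
      · simpa [Algebra.TensorProduct.one_def, hM] using this
      · have := hΨ ((a * g) ⊗ₜ D (aM b m)) c
        simpa using this
  rw [h2] at h1
  rw [h1]
  have := Q.isCounital_Φ.apply_right (Ψ ∘ₗ mulMap (lam.toLinearMap ∘ₗ D ∘ₗ aM.flip m)
      (TensorProduct.map LinearMap.id v.toLinearMap)) (fun a b c => ?_)
  · simp only [Algebra.TensorProduct.one_def, LinearMap.comp_apply, mulMap_tmul,
      AlgHom.toLinearMap_apply, LinearMap.flip_apply, hM, TensorProduct.map_tmul,
      LinearMap.id_apply, map_one] at this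
    rw [this, ← Algebra.TensorProduct.one_def, mul_one]
  · have := hΨ (lam (D (aM a m)) * (b ⊗ₜ 1)) c
    rw [mul_assoc, Algebra.TensorProduct.tmul_mul_tmul, mul_one, one_mul] at this
    simpa using this

/-- The cointertwining relation is solved for lam(D(m)): it is applied to x¹·m and multiplied on the
right by x² ⊗ v(x³), so that Φ Φ⁻¹ = 1 appears. -/
theorem Cointertwines.lam_eq (hD : Cointertwines Q aM cM v lam D) (hM : ∀ m, aM 1 m = m)
    (hM' : ∀ g h m, aM (g * h) m = aM g (aM h m)) (m : M) :
    lam (D m) = mulMap (dressCoact Q aM v D ∘ₗ cM ∘ₗ aM.flip m)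
      (TensorProduct.map LinearMap.id v.toLinearMap) Q.Φ.inv := by
  have h1 : ∀ t : H ⊗[k] (H ⊗[k] H), mulMap (dressCoact Q aM v D ∘ₗ cM ∘ₗ aM.flip m)
      (TensorProduct.map LinearMap.id v.toLinearMap) t =
      mulMap (lam.toLinearMap ∘ₗ D ∘ₗ aM.flip m)
        (TensorProduct.map LinearMap.id v.toLinearMap) (Q.Φ.val * t) := by
    intro t
    induction t using tensor_induction_right with
    | zero => simp
    | add x y hx hy => simp only [map_add, mul_add, hx, hy]
    | tmul a b c =>
      simp only [mulMap_tmul, LinearMap.comp_apply, LinearMap.flip_apply, hD _]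
      generalize Q.Φ.val = u
      induction u using tensor_induction_right with
      | zero => simp
      | add x y hx hy => simp only [map_add, add_mul, hx, hy]
      | tmul x y z => simp [hM', mul_assoc]
  have h2 : TensorProduct.map LinearMap.id v.toLinearMap (1 : H ⊗[k] H) = 1 :=
    map_one (Algebra.TensorProduct.map (AlgHom.id k H) v)
  rw [h1, Units.val_inv, Algebra.TensorProduct.one_def, mulMap_tmul, h2]
  simp [hM]

theorem RightInvariant.map_id (hκ : RightInvariant Q v κ) (c z : H ⊗[k] C) (b : H) (h : H) :
    TensorProduct.map LinearMap.id κ (c * (z * (1 ⊗ₜ v h)) * (b ⊗ₜ 1)) =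
      Q.counit h • TensorProduct.map LinearMap.id κ (c * z * (b ⊗ₜ 1)) := by
  induction c using TensorProduct.induction_on with
  | zero => simp
  | add x y hx hy => simp only [map_add, add_mul, hx, hy, smul_add]
  | tmul a c =>
    induction z using TensorProduct.induction_on with
    | zero => simp
    | add x y hx hy => simp only [map_add, add_mul, mul_add, hx, hy, smul_add]
    | tmul a' c' => simp [← mul_assoc, hκ _ h]

/-- A factor b ⊗ 1 on the right commutes with 1 ⊗ v(h), and a factor on the left is harmless. So id
⊗ κ stays right invariant after both multiplications, and lam(D(m)) may be replaced by the coaction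
of m. -/
theorem RightInvariant.map_lam (hκ : RightInvariant Q v κ) (hM : ∀ m, aM 1 m = m)
    (hD : Cointertwines Q aM cM v lam D) (c : H ⊗[k] C) (b : H) (m : M) :
    TensorProduct.map LinearMap.id κ (c * lam (D m) * (b ⊗ₜ 1)) =
      TensorProduct.map LinearMap.id κ (c * TensorProduct.map LinearMap.id D (cM m) *
        (b ⊗ₜ 1)) := by
  have := RightInvariant.coact (Ψ := TensorProduct.map LinearMap.id κ ∘ₗ
    LinearMap.mulRight k (b ⊗ₜ 1) ∘ₗ LinearMap.mulLeft k c) (Q := Q) (v := v)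
    (fun z h => ?_) hM hD m
  · simpa using this
  · simpa using hκ.map_id c z b h

theorem RightInvariant.map_lam_one (hκ : RightInvariant Q v κ) (hM : ∀ m, aM 1 m = m)
    (hD : Cointertwines Q aM cM v lam D) (m : M) :
    TensorProduct.map LinearMap.id κ (lam (D m)) =
      TensorProduct.map LinearMap.id (κ ∘ₗ D) (cM m) := by
  have := hκ.map_lam hM hD 1 1 m
  rw [← Algebra.TensorProduct.one_def, one_mul, mul_one, one_mul, mul_one] at this
  rw [this, ← LinearMap.comp_apply, ← TensorProduct.map_comp, LinearMap.id_comp]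

theorem RightInvariant.map_mul_lam_v (hκ : RightInvariant Q v κ) (hC : IsComoduleAlgebra Q v lam)
    (z : H ⊗[k] C) (h : H) : TensorProduct.map LinearMap.id κ (z * lam (v h)) =
      TensorProduct.map LinearMap.id κ (z * (h ⊗ₜ 1)) := by
  rw [hC.lam_v]
  have := Q.comul_counit_right (TensorProduct.map LinearMap.id κ ∘ₗ LinearMap.mulLeft k z ∘ₗ
    (Algebra.TensorProduct.map (AlgHom.id k H) v).toLinearMap) (fun a b => ?_) h
  · simpa only [LinearMap.comp_apply, LinearMap.mulLeft_apply, AlgHom.toLinearMap_apply,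
      Algebra.TensorProduct.map_tmul, AlgHom.coe_id, id_eq, map_one] using this
  · have := hκ.map_id z (a ⊗ₜ 1) 1 b
    rw [← Algebra.TensorProduct.one_def, mul_one, mul_one] at this
    simpa using this

/-- `X¹ (x¹ · m)₍₋₁₎ x² g ⊗ (X² · (x¹ · m)₍₀₎ ⊗ X³x³ · n)`. -/
def tensorCoactStep (Q : QuasiBialgebra k H) (aM : H →ₗ[k] M →ₗ[k] M) (cM : M →ₗ[k] H ⊗[k] M)
    (aN : H →ₗ[k] N →ₗ[k] N) : M ⊗[k] (H ⊗[k] N) →ₗ[k] H ⊗[k] (M ⊗[k] N) :=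
  associator Q regAct aM aN ∘ₗ TensorProduct.map (coactMul cM) LinearMap.id ∘ₗ
    associatorInv Q aM regAct aN

theorem map_tensorCoactStep (hκ : RightInvariant Q v κ) (hM : ∀ m, aM 1 m = m)
    (hM' : ∀ g h m, aM (g * h) m = aM g (aM h m))
    (hN' : ∀ g h n, aN (g * h) n = aN g (aN h n))
    (hD : Cointertwines Q aM cM v lam D) (hD' : Intertwines Q aN v D') (m : M) (g : H) (n : N) :
    TensorProduct.map LinearMap.id (κ ∘ₗ mulMap D D')
      (tensorCoactStep Q aM cM aN (m ⊗ₜ (g ⊗ₜ n))) =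
    TensorProduct.map LinearMap.id κ (lam (D m) * (g ⊗ₜ D' n)) := by
  rw [hD.lam_eq hM hM']
  simp only [tensorCoactStep, LinearMap.comp_apply, associatorInv, LinearEquiv.coe_coe]
  generalize Q.Φ.inv = t
  induction t using tensor_induction_right with
  | zero => simp
  | add x y hx hy => simp only [map_add, add_mul, LinearMap.add_apply, hx, hy]
  | tmul x y z =>
    simp only [TensorProduct.map₂_apply_tmul, TensorProduct.map_tmul,
      TensorProduct.assoc_symm_tmul, coactMul_tmul, mulMap_tmul, LinearMap.comp_apply,
      LinearMap.flip_apply, LinearMap.id_apply, AlgHom.toLinearMap_apply]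
    generalize cM (aM x m) = w
    induction w using TensorProduct.induction_on with
    | zero => simp
    | add x y hx hy => simp only [map_add, add_mul, TensorProduct.add_tmul, hx, hy]
    | tmul g' m' =>
      rw [dressCoact_tmul]
      simp only [TensorProduct.map_tmul, LinearMap.id_apply, associator_tmul]
      generalize Q.Φ.val = u
      induction u using tensor_induction_right with
      | zero => simp
      | add x y hx hy => simp only [map_add, add_mul, hx, hy]
      | tmul a b c =>
        simp only [TensorProduct.map_tmul, mulMap_tmul, LinearMap.comp_apply,
          LinearMap.flip_apply, LinearMap.id_apply, AlgHom.toLinearMap_apply,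
          Algebra.TensorProduct.tmul_mul_tmul, LinearMap.mulRight_apply, LinearMap.mul_apply']
        rw [mul_assoc (D _), ← map_mul, mul_assoc (D _), hD'.apply_mul hκ, hN']
        simp only [mul_assoc]

/-- The coaction of a tensor product is the multiplicativity of lam in disguise. In lam(D(X¹·m))
lam(D'(X²·n)) lam(v(X³)) the last factor reduces to X³ ⊗ 1, the middle one to the coaction on N, and
the first is expanded by `lam_eq`; this produces the three copies of Φ and Φ⁻¹ in `tensorCoact`. -/
theorem map_tensorCoact (hκ : RightInvariant Q v κ) (hM : ∀ m, aM 1 m = m)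
    (hM' : ∀ g h m, aM (g * h) m = aM g (aM h m))
    (hN : ∀ n, aN 1 n = n) (hN' : ∀ g h n, aN (g * h) n = aN g (aN h n))
    (hD : Cointertwines Q aM cM v lam D) (hD' : Intertwines Q aN v D')
    (hD'' : Cointertwines Q aN cN v lam D') (hC : IsComoduleAlgebra Q v lam) (m : M) (n : N) :
    TensorProduct.map LinearMap.id κ (lam (dressMul Q aM aN v D D' (m ⊗ₜ n))) =
      TensorProduct.map LinearMap.id (κ ∘ₗ mulMap D D')
        (tensorCoact Q aM cM aN cN (m ⊗ₜ n)) := by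
  have h1 : ∀ (m : M) (n : N) (h : H), TensorProduct.map LinearMap.id (κ ∘ₗ mulMap D D')
      (tensorCoactStep Q aM cM aN (m ⊗ₜ coactMul cN (n ⊗ₜ h))) =
      TensorProduct.map LinearMap.id κ (lam (D m) * lam (D' n) * (h ⊗ₜ 1)) := by
    intro m n h
    rw [hκ.map_lam hN hD'', coactMul_tmul]
    generalize cN n = w
    induction w using TensorProduct.induction_on with
    | zero => simp
    | add x y hx hy =>
      simp only [map_add, add_mul, mul_add, TensorProduct.tmul_add, hx, hy]
    | tmul g n =>
      rw [TensorProduct.map_tmul, LinearMap.id_apply,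
        map_tensorCoactStep hκ hM hM' hN' hD hD']
      simp [mul_assoc]
  have h2 : TensorProduct.map LinearMap.id (κ ∘ₗ mulMap D D')
        (tensorCoact Q aM cM aN cN (m ⊗ₜ n)) =
      (TensorProduct.map LinearMap.id (κ ∘ₗ mulMap D D') ∘ₗ tensorCoactStep Q aM cM aN ∘ₗ
        TensorProduct.map LinearMap.id (coactMul cN) ∘ₗ TensorProduct.map (aM.flip m)
          (TensorProduct.map (aN.flip n) (regAct.flip 1))) Q.Φ.val := by
    simp only [tensorCoact, tensorCoactStep, LinearMap.comp_apply, LinearMap.flip_apply,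
      TensorProduct.mk_apply, associator_tmul]
  rw [h2, dressMul_tmul]
  generalize Q.Φ.val = t
  induction t using tensor_induction_right with
  | zero => simp
  | add x y hx hy => simp only [map_add, hx, hy]
  | tmul x y z =>
    simp only [mulMap_tmul, map_mul, LinearMap.comp_apply, TensorProduct.map_tmul,
      LinearMap.flip_apply, AlgHom.toLinearMap_apply, LinearMap.id_apply, ← mul_assoc,
      LinearMap.mul_apply', mul_one]
    rw [h1, hκ.map_mul_lam_v hC]

end Dressing

/-! ### Yetter–Drinfeld axioms from a dressing with a retraction -/

section Recognition

open QuasiBialgebra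

variable {k H : Type*} [Field k] [Ring H] [Algebra k H] {Q : QuasiBialgebra k H}
variable {C : Type*} [Ring C] [Algebra k C]
variable {M : Type*} [AddCommGroup M] [Module k M]
variable {aM : H →ₗ[k] M →ₗ[k] M} {cM : M →ₗ[k] H ⊗[k] M} {v : H →ₐ[k] C}
  {lam : C →ₐ[k] H ⊗[k] C} {D : M →ₗ[k] C} {κ : C →ₗ[k] M}

/-- The action is recovered as h·m = κ(v(h) D(m)), so the module axioms are those of left
multiplication through v. -/
theorem Intertwines.one_act (hD : Intertwines Q aM v D) (hκ : RightInvariant Q v κ)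
    (hκD : ∀ m, κ (D m) = m) (m : M) : aM 1 m = m := by
  rw [← hκD (aM 1 m), ← hD.apply_mul_right hκ, map_one, one_mul, hκD]

theorem Intertwines.mul_act (hD : Intertwines Q aM v D) (hκ : RightInvariant Q v κ)
    (hκD : ∀ m, κ (D m) = m) (g h : H) (m : M) : aM (g * h) m = aM g (aM h m) := by
  rw [← hκD (aM (g * h) m), ← hD.apply_mul_right hκ, map_mul v g h, mul_assoc, hD.apply_mul hκ,
    hD.apply_mul_right hκ, hκD]

theorem RightInvariant.map_mul_leg (hκ : RightInvariant Q v κ) (c : H ⊗[k] (H ⊗[k] C))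
    (x y z : H) :
    TensorProduct.map LinearMap.id (TensorProduct.map LinearMap.id κ)
        (c * (x ⊗ₜ (y ⊗ₜ v z))) =
      Q.counit z • TensorProduct.map LinearMap.id (TensorProduct.map LinearMap.id κ)
        (c * (x ⊗ₜ (y ⊗ₜ 1))) := by
  induction c using tensor_induction_right with
  | zero => simp
  | add x y hx hy => simp only [map_add, add_mul, hx, hy, smul_add]
  | tmul a b c => simp [hκ c z]

theorem RightInvariant.map_mul_Φ_inv (hκ : RightInvariant Q v κ) (c : H ⊗[k] (H ⊗[k] C))
    (w : H ⊗[k] (H ⊗[k] H)) :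
    TensorProduct.map LinearMap.id (TensorProduct.map LinearMap.id κ)
        (c * Algebra.TensorProduct.map (AlgHom.id k H)
          (Algebra.TensorProduct.map (AlgHom.id k H) v) (Q.Φ.inv * w)) =
      TensorProduct.map LinearMap.id (TensorProduct.map LinearMap.id κ)
        (c * Algebra.TensorProduct.map (AlgHom.id k H)
          (Algebra.TensorProduct.map (AlgHom.id k H) v) w) := by
  induction w using tensor_induction_right with
  | zero => simp
  | add x y hx hy => simp only [map_add, mul_add, hx, hy]
  | tmul x y z =>
    have := Q.isCounital_Φ_inv.apply_right
      (TensorProduct.map LinearMap.id (TensorProduct.map LinearMap.id κ) ∘ₗ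
        LinearMap.mulLeft k c ∘ₗ (Algebra.TensorProduct.map (AlgHom.id k H)
          (Algebra.TensorProduct.map (AlgHom.id k H) v)).toLinearMap ∘ₗ
        LinearMap.mulRight k (x ⊗ₜ (y ⊗ₜ z))) (fun a b e => ?_)
    · simpa only [LinearMap.comp_apply, LinearMap.mulLeft_apply, LinearMap.mulRight_apply,
        AlgHom.toLinearMap_apply, one_mul] using this
    · simp only [LinearMap.comp_apply, LinearMap.mulLeft_apply, LinearMap.mulRight_apply,
        AlgHom.toLinearMap_apply, Algebra.TensorProduct.tmul_mul_tmul, one_mul,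
        Algebra.TensorProduct.map_tmul, AlgHom.coe_id, id_eq]
      rw [hκ.map_mul_leg, hκ.map_mul_leg c _ _ z, map_mul, mul_smul]

theorem Cointertwines.coactMul_eq (hD : Cointertwines Q aM cM v lam D)
    (hκ : RightInvariant Q v κ) (hM : ∀ m, aM 1 m = m) (hC : IsComoduleAlgebra Q v lam)
    (hκD : ∀ m, κ (D m) = m) (m : M) (h : H) :
    coactMul cM (m ⊗ₜ h) = TensorProduct.map LinearMap.id κ (lam (D m * v h)) := by
  rw [map_mul, hκ.map_mul_lam_v hC, ← one_mul (lam (D m)), hκ.map_lam hM hD, coactMul_tmul,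
    one_mul]
  generalize cM m = w
  induction w using TensorProduct.induction_on with
  | zero => simp
  | add x y hx hy => simp only [map_add, add_mul, hx, hy]
  | tmul a b => simp [hκD]

/-- Both structures are read off from C: h·m = κ(v(h) D(m)) and the coaction is (id ⊗ κ) lam D. Each
axiom is the image under κ of the corresponding property of v and lam. -/
theorem isYetterDrinfeld_of_dressing (hC : IsComoduleAlgebra Q v lam)
    (hκ : RightInvariant Q v κ) (hκD : ∀ m, κ (D m) = m) (hD : Intertwines Q aM v D)
    (hD' : Cointertwines Q aM cM v lam D) : IsYetterDrinfeld Q aM cM := by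
  have hM := hD.one_act hκ hκD
  have hM' := hD.mul_act hκ hκD
  have hκD' : κ ∘ₗ D = LinearMap.id := LinearMap.ext hκD
  have hc : ∀ m, TensorProduct.map LinearMap.id κ (lam (D m)) = cM m := by
    intro m
    rw [hκ.map_lam_one hM hD', hκD', TensorProduct.map_id, LinearMap.id_apply]
  have hmul := hD'.coactMul_eq hκ hM hC hκD
  refine ⟨hM, hM', fun m => ?_, fun m => ?_, fun h m => ?_⟩
  · have h1 : coactMul cM =
        (TensorProduct.map LinearMap.id κ ∘ₗ lam.toLinearMap) ∘ₗ mulMap D v.toLinearMap :=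
      TensorProduct.ext' fun m h => by simpa using hmul m h
    have h2 : TensorProduct.map LinearMap.id (coactMul cM)
        (associator Q regAct aM regAct (cM m ⊗ₜ[k] (1 : H))) =
        TensorProduct.map LinearMap.id (TensorProduct.map LinearMap.id κ ∘ₗ lam.toLinearMap)
          (dressCoact Q aM v D (cM m)) := by
      rw [h1, ← LinearMap.id_comp (LinearMap.id : H →ₗ[k] H), TensorProduct.map_comp]
      rfl
    rw [h2, hD' m]
    -- Quasi-coassociativity of lam produces a trailing Φ⁻¹, and lam(v(z)) a trailing Δ(z). In both
    -- cases κ sees one leg only through ε, which leaves y ⊗ z ⊗ 1.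
    have h3 : ∀ x y z : H, TensorProduct.map LinearMap.id
        (TensorProduct.map LinearMap.id κ ∘ₗ lam.toLinearMap)
        (lam (D (aM x m)) * (y ⊗ₜ v z)) =
        TensorProduct.map LinearMap.id (TensorProduct.map LinearMap.id κ)
          (Algebra.TensorProduct.map (AlgHom.id k H) (Algebra.TensorProduct.map (AlgHom.id k H) v)
            Q.Φ.val * TensorProduct.assoc k H H C
              (Algebra.TensorProduct.map Q.comul (AlgHom.id k C) (lam (D (aM x m)))) *
            (y ⊗ₜ (z ⊗ₜ 1))) := by
      intro x y z
      have h4 : TensorProduct.map LinearMap.id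
          (TensorProduct.map LinearMap.id κ ∘ₗ lam.toLinearMap)
          (lam (D (aM x m)) * (y ⊗ₜ v z)) = TensorProduct.map LinearMap.id
          (TensorProduct.map LinearMap.id κ) (Algebra.TensorProduct.map (AlgHom.id k H) lam
            (lam (D (aM x m)) * (y ⊗ₜ v z))) := by
        rw [← LinearMap.id_comp (LinearMap.id : H →ₗ[k] H), TensorProduct.map_comp]
        rfl
      have h5 : Algebra.TensorProduct.map (AlgHom.id k H) lam (lam (D (aM x m))) =
          Algebra.TensorProduct.map (AlgHom.id k H) (Algebra.TensorProduct.map (AlgHom.id k H) v)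
            Q.Φ.val * TensorProduct.assoc k H H C
              (Algebra.TensorProduct.map Q.comul (AlgHom.id k C) (lam (D (aM x m)))) *
          Algebra.TensorProduct.map (AlgHom.id k H) (Algebra.TensorProduct.map (AlgHom.id k H) v)
            Q.Φ.inv := by
        rw [← hC.quasi_coassoc, mul_assoc, ← map_mul, Units.val_inv, map_one, mul_one]
      have h6 : Algebra.TensorProduct.map (AlgHom.id k H) lam (y ⊗ₜ v z) =
          Algebra.TensorProduct.map (AlgHom.id k H) (Algebra.TensorProduct.map (AlgHom.id k H) v)
            (y ⊗ₜ Q.comul z) := by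
        simp [hC.lam_v]
      rw [h4, map_mul, h5, h6, mul_assoc, ← map_mul, hκ.map_mul_Φ_inv]
      have := Q.comul_counit_right
        (TensorProduct.map LinearMap.id (TensorProduct.map LinearMap.id κ) ∘ₗ
        LinearMap.mulLeft k (Algebra.TensorProduct.map (AlgHom.id k H)
          (Algebra.TensorProduct.map (AlgHom.id k H) v)
            Q.Φ.val * TensorProduct.assoc k H H C
              (Algebra.TensorProduct.map Q.comul (AlgHom.id k C) (lam (D (aM x m))))) ∘ₗ
        (Algebra.TensorProduct.map (AlgHom.id k H)
          (Algebra.TensorProduct.map (AlgHom.id k H) v)).toLinearMap ∘ₗ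
        TensorProduct.mk k H (H ⊗[k] H) y) (fun a b => ?_) z
      · simpa only [LinearMap.comp_apply, LinearMap.mulLeft_apply, AlgHom.toLinearMap_apply,
          TensorProduct.mk_apply, Algebra.TensorProduct.map_tmul, AlgHom.coe_id, id_eq,
          map_one] using this
      · simp only [LinearMap.comp_apply, LinearMap.mulLeft_apply, AlgHom.toLinearMap_apply,
          TensorProduct.mk_apply, Algebra.TensorProduct.map_tmul, AlgHom.coe_id, id_eq,
          map_one]
        exact hκ.map_mul_leg _ _ _ _
    -- The other side of the axiom reaches the same element: κ turns the leg v(X³) of the outer Φ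
    -- into the action of X³.
    have h7 : ∀ (n : M) (y z : H), associator Q regAct regAct aM
        (coactMul (TensorProduct.map Q.comul.toLinearMap LinearMap.id ∘ₗ cM)
          (n ⊗ₜ (y ⊗ₜ z))) =
        TensorProduct.map LinearMap.id (TensorProduct.map LinearMap.id κ)
          (Algebra.TensorProduct.map (AlgHom.id k H) (Algebra.TensorProduct.map (AlgHom.id k H) v)
            Q.Φ.val * TensorProduct.assoc k H H C
              (Algebra.TensorProduct.map Q.comul (AlgHom.id k C) (lam (D n))) *
            (y ⊗ₜ (z ⊗ₜ 1))) := by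
      intro n y z
      have := RightInvariant.coact (Q := Q) (v := v)
        (Ψ := TensorProduct.map LinearMap.id (TensorProduct.map LinearMap.id κ) ∘ₗ
        LinearMap.mulRight k ((y ⊗ₜ (z ⊗ₜ 1) : H ⊗[k] (H ⊗[k] C))) ∘ₗ
        LinearMap.mulLeft k (Algebra.TensorProduct.map (AlgHom.id k H)
          (Algebra.TensorProduct.map (AlgHom.id k H) v) Q.Φ.val) ∘ₗ
        (TensorProduct.assoc k H H C).toLinearMap ∘ₗ
        (Algebra.TensorProduct.map Q.comul (AlgHom.id k C)).toLinearMap) (fun w h => ?_) hM hD' n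
      · simp only [LinearMap.comp_apply, LinearMap.mulLeft_apply, AlgHom.toLinearMap_apply,
          LinearMap.mulRight_apply, LinearEquiv.coe_coe] at this
        rw [this, coactMul_tmul, LinearMap.comp_apply]
        generalize cM n = w
        induction w using TensorProduct.induction_on with
        | zero => simp
        | add x y hx hy => simp only [map_add, add_mul, mul_add, hx, hy]
        | tmul g m =>
          simp only [TensorProduct.map_tmul, LinearMap.id_apply, AlgHom.toLinearMap_apply,
            Algebra.TensorProduct.map_tmul, AlgHom.coe_id, id_eq]
          generalize Q.comul g = t
          induction t using TensorProduct.induction_on with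
          | zero => simp
          | add x y hx hy => simp only [map_add, add_mul, mul_add, TensorProduct.add_tmul, hx, hy]
          | tmul g g' =>
            simp only [LinearMap.mulRight_apply, Algebra.TensorProduct.tmul_mul_tmul,
              associator_tmul, TensorProduct.assoc_tmul]
            generalize Q.Φ.val = u
            induction u using tensor_induction_right with
            | zero => simp
            | add x y hx hy => simp only [map_add, add_mul, hx, hy]
            | tmul a b c => simp [hD.apply_mul_right hκ, hκD, mul_assoc]
      · simp only [LinearMap.comp_apply, LinearMap.mulLeft_apply, AlgHom.toLinearMap_apply,
          LinearMap.mulRight_apply, LinearEquiv.coe_coe, map_mul, Algebra.TensorProduct.map_tmul,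
          map_one, AlgHom.coe_id, id_eq]
        have hassoc : ∀ x y : (H ⊗[k] H) ⊗[k] C, TensorProduct.assoc k H H C (x * y) =
            TensorProduct.assoc k H H C x * TensorProduct.assoc k H H C y :=
          fun x y => map_mul (Algebra.TensorProduct.assoc k k k H H C) x y
        have hone : TensorProduct.assoc k H H C ((1 : H ⊗[k] H) ⊗ₜ v h) = 1 ⊗ₜ (1 ⊗ₜ v h) := by
          rw [Algebra.TensorProduct.one_def, TensorProduct.assoc_tmul]
        have hcomm : ((1 : H) ⊗ₜ[k] ((1 : H) ⊗ₜ[k] v h)) * (y ⊗ₜ (z ⊗ₜ 1)) =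
            y ⊗ₜ (z ⊗ₜ v h) := by simp
        rw [hassoc, hone, ← mul_assoc, mul_assoc _ _ (y ⊗ₜ (z ⊗ₜ 1)), hcomm, hκ.map_mul_leg]
    -- Only the Φ displayed in the goal becomes arbitrary. The Φ occurring in `h3` and `h7` is
    -- restored, because it belongs to the coassociativity and must stay.
    generalize hu : Q.Φ.val = u at h3 h7
    rw [← hu] at h3 h7
    clear hu
    induction u using tensor_induction_right with
    | zero => simp
    | add x y hx hy => simp only [map_add, hx, hy]
    | tmul x y z =>
      simp only [mulMap_tmul, LinearMap.comp_apply, LinearMap.flip_apply, TensorProduct.map_tmul,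
        AlgHom.toLinearMap_apply, LinearMap.id_apply] at h3 h7 ⊢
      rw [h3, h7]
  · rw [← hc m]
    have h1 : ∀ z : H ⊗[k] C, TensorProduct.lid k M (TensorProduct.map Q.counit.toLinearMap
        LinearMap.id (TensorProduct.map LinearMap.id κ z)) = κ (TensorProduct.lid k C
        (Algebra.TensorProduct.map Q.counit (AlgHom.id k C) z)) := by
      intro z
      induction z using TensorProduct.induction_on with
      | zero => simp
      | add x y hx hy => simp only [map_add, hx, hy]
      | tmul a b => simp
    rw [h1, hC.counit, TensorProduct.lid_tmul, one_smul, hκD]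
  · have h1 : ∀ w, tensorAct Q regAct aM h w = TensorProduct.map LinearMap.id κ
        (Algebra.TensorProduct.map (AlgHom.id k H) v (Q.comul h) *
          TensorProduct.map LinearMap.id D w) := by
      intro w
      simp only [tensorAct, LinearMap.comp_apply, AlgHom.toLinearMap_apply]
      generalize Q.comul h = t
      induction t using TensorProduct.induction_on with
      | zero => simp
      | add x y hx hy => simp only [map_add, add_mul, LinearMap.add_apply, hx, hy]
      | tmul a b =>
        induction w using TensorProduct.induction_on with
        | zero => simp
        | add x y hx hy => simp only [map_add, mul_add, hx, hy]
        | tmul g n => simp [hD.apply_mul_right hκ, hκD]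
    -- The compatibility axiom is v(h) D(m) = D(h₁·m) v(h₂) after applying lam and then id ⊗ κ.
    have h2 := hκ.map_lam hM hD' (Algebra.TensorProduct.map (AlgHom.id k H) v (Q.comul h)) 1 m
    rw [← Algebra.TensorProduct.one_def, mul_one, mul_one, ← hC.lam_v, ← map_mul, hD h m,
      hC.lam_v] at h2
    rw [h1, ← h2]
    generalize Q.comul h = t
    induction t using TensorProduct.induction_on with
    | zero => simp
    | add x y hx hy => simp only [map_add, hx, hy]
    | tmul a b => simp [hmul]

end Recognition

/-! ### Algebras in the category from a dressing with a retraction -/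

namespace YDAlgebraData

open QuasiBialgebra

variable {k H : Type*} [Field k] [Ring H] [Algebra k H] {Q : QuasiBialgebra k H}
variable {C : Type*} [Ring C] [Algebra k C]
variable {A : Type*} [AddCommGroup A] [Module k A]
variable {v : H →ₐ[k] C} {lam : C →ₐ[k] H ⊗[k] C}

/-- A linear map `D : A → C` into a comodule algebra that is compatible with all structure maps. -/
structure IsDressing (Q : QuasiBialgebra k H) (v : H →ₐ[k] C) (lam : C →ₐ[k] H ⊗[k] C)
    (X : YDAlgebraData k H A) (D : A →ₗ[k] C) : Prop where
  intertwines : Intertwines Q X.act v D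
  cointertwines : Cointertwines Q X.act X.coact v lam D
  map_mul : ∀ a b, D (X.mul (a ⊗ₜ b)) = dressMul Q X.act X.act v D D (a ⊗ₜ b)
  map_one : D X.one = 1

variable {X : YDAlgebraData k H A} {D : A →ₗ[k] C} {κ : C →ₗ[k] A}

theorem IsDressing.mul_eq (hD : IsDressing Q v lam X D) (hκ : RightInvariant Q v κ)
    (hκD : ∀ m, κ (D m) = m) (a b : A) : X.mul (a ⊗ₜ b) = κ (D a * D b) := by
  have hM := hD.intertwines.one_act hκ hκD
  rw [← hκ.dressMul hM hM, ← hD.map_mul, hκD]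

/-- With ab = κ(D(a) D(b)), the associativity of C yields associativity up to the constraint, since
the Φ in D(ab) = D(X¹·a) D(X²·b) v(X³) is exactly that constraint. Colinearity of the product is
`map_tensorCoact`. -/
theorem IsDressing.isAlgebra (hD : IsDressing Q v lam X D) (hC : IsComoduleAlgebra Q v lam)
    (hκ : RightInvariant Q v κ) (hκD : ∀ m, κ (D m) = m) : X.IsAlgebra Q := by
  have hM := hD.intertwines.one_act hκ hκD
  have hM' := hD.intertwines.mul_act hκ hκD
  have hmul := hD.mul_eq hκ hκD
  have hκ' : ∀ c, RightInvariant Q v (κ ∘ₗ LinearMap.mulLeft k c) := by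
    intro c c' h
    simp [← mul_assoc, hκ _ h]
  have hκD' : κ ∘ₗ D = LinearMap.id := LinearMap.ext hκD
  have hc : ∀ m, X.coact m = TensorProduct.map LinearMap.id κ (lam (D m)) := by
    intro m
    rw [hκ.map_lam_one hM hD.cointertwines, hκD', TensorProduct.map_id, LinearMap.id_apply]
  refine ⟨isYetterDrinfeld_of_dressing hC hκ hκD hD.intertwines hD.cointertwines,
    fun a b c => ?_, fun a => ?_, fun a => ?_, fun h a b => ?_, fun h => ?_, fun a b => ?_, ?_⟩
  · rw [hmul (X.mul _), hD.map_mul, dressMul_tmul, associator_tmul]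
    generalize Q.Φ.val = t
    induction t using tensor_induction_right with
    | zero => simp
    | add x y hx hy => simp only [map_add, add_mul, hx, hy]
    | tmul x y z =>
      have h1 := (hκ' (D (X.act x a))).dressMul (D := D) (D' := D) hM hM (X.act y b) (X.act z c)
      simp only [LinearMap.comp_apply, LinearMap.mulLeft_apply] at h1
      simp only [TensorProduct.map_tmul, LinearMap.flip_apply, LinearMap.id_apply]
      rw [hmul (X.act x a), hD.map_mul, h1]
      simp only [mulMap_tmul, LinearMap.comp_apply, LinearMap.flip_apply,
        AlgHom.toLinearMap_apply]
      rw [← mul_assoc, mul_assoc, hD.intertwines.apply_mul hκ, mul_assoc]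
  · rw [hmul, hD.map_one, one_mul, hκD]
  · rw [hmul, hD.map_one, mul_one, hκD]
  · have h1 : X.act h (X.mul (a ⊗ₜ b)) = κ (v h * D a * D b) := by
      rw [← hκD (X.act h (X.mul (a ⊗ₜ b))), ← hD.intertwines.apply_mul_right hκ, hD.map_mul,
        mul_assoc]
      exact (hκ' (v h)).dressMul hM hM a b
    rw [h1, hD.intertwines]
    simp only [tensorAct, LinearMap.comp_apply, AlgHom.toLinearMap_apply]
    generalize Q.comul h = t
    induction t using TensorProduct.induction_on with
    | zero => simp
    | add x y hx hy => simp only [map_add, add_mul, LinearMap.add_apply, hx, hy]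
    | tmul x y =>
      simp only [mulMap_tmul, LinearMap.comp_apply, LinearMap.flip_apply,
        AlgHom.toLinearMap_apply, TensorProduct.map₂_apply_tmul, TensorProduct.map_tmul]
      rw [mul_assoc, hD.intertwines.apply_mul hκ, hmul]
  · rw [← hκD (X.act h X.one), ← hD.intertwines.apply_mul_right hκ, hD.map_one, mul_one,
      ← one_mul (v h), hκ, ← hD.map_one, hκD]
  · have h1 : X.mul = κ ∘ₗ mulMap D D := TensorProduct.ext' fun a b => by simp [hmul]
    rw [hc, hD.map_mul, map_tensorCoact hκ hM hM' hM hM' hD.cointertwines hD.intertwines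
      hD.cointertwines hC, h1]
  · rw [hc, hD.map_one, _root_.map_one, Algebra.TensorProduct.one_def, TensorProduct.map_tmul,
      ← hD.map_one, hκD]
    rfl

end YDAlgebraData

section Conjugation

variable {k A R : Type*} [Field k] [Ring A] [Algebra k A] [Ring R] [Algebra k R]

/-- The algebra map `a ↦ u f(a) u⁻¹`. -/
def conjAlgHom (u : Rˣ) (f : A →ₐ[k] R) : A →ₐ[k] R :=
  AlgHom.ofLinearMap (LinearMap.mulRight k u.inv ∘ₗ LinearMap.mulLeft k u.val ∘ₗ f.toLinearMap)
    (by simp) (fun x y => by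
      simp only [LinearMap.comp_apply, LinearMap.mulRight_apply, LinearMap.mulLeft_apply,
        AlgHom.toLinearMap_apply, map_mul, mul_assoc]
      rw [← mul_assoc u.inv u.val, u.inv_val, one_mul])

theorem assoc_mul {B C : Type*} [Ring B] [Algebra k B] [Ring C] [Algebra k C]
    (x y : (A ⊗[k] B) ⊗[k] C) : TensorProduct.assoc k A B C (x * y) =
      TensorProduct.assoc k A B C x * TensorProduct.assoc k A B C y :=
  map_mul (Algebra.TensorProduct.assoc k k k A B C) x y

end Conjugation

/-! ### The comodule algebra B ⊗ H attached to a comodule algebra B -/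

section Extension

open QuasiBialgebra

variable {k H : Type*} [Field k] [Ring H] [Algebra k H] (Q : QuasiBialgebra k H)
variable {B : Type*} [Ring B] [Algebra k B]

/-- `h ↦ v(h₁) ⊗ h₂`. -/
def comulMap (v : H →ₐ[k] B) : H →ₐ[k] B ⊗[k] H :=
  (Algebra.TensorProduct.map v (AlgHom.id k H)).comp Q.comul

/-- `id ⊗ v ⊗ id`. -/
def mapMiddle (v : H →ₐ[k] B) : H ⊗[k] (H ⊗[k] H) →ₐ[k] H ⊗[k] (B ⊗[k] H) :=
  Algebra.TensorProduct.map (AlgHom.id k H) (Algebra.TensorProduct.map v (AlgHom.id k H))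

/-- `id ⊗ id ⊗ v ⊗ id`. -/
def mapThird (v : H →ₐ[k] B) :
    H ⊗[k] (H ⊗[k] (H ⊗[k] H)) →ₐ[k] H ⊗[k] (H ⊗[k] (B ⊗[k] H)) :=
  Algebra.TensorProduct.map (AlgHom.id k H) (mapMiddle v)

/-- `lam ⊗ id`. -/
def coactExt (lam : B →ₐ[k] H ⊗[k] B) : B ⊗[k] H →ₐ[k] H ⊗[k] (B ⊗[k] H) :=
  (Algebra.TensorProduct.assoc k k k H B H).toAlgHom.comp
    (Algebra.TensorProduct.map lam (AlgHom.id k H))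

/-- `b ⊗ h ↦ Φ (lam(b) ⊗ h) Φ⁻¹`. -/
def coactConj (v : H →ₐ[k] B) (lam : B →ₐ[k] H ⊗[k] B) : B ⊗[k] H →ₐ[k] H ⊗[k] (B ⊗[k] H) :=
  conjAlgHom (Q.mapΦ (mapMiddle v)) (coactExt lam)

theorem comulMap_apply (v : H →ₐ[k] B) (h : H) :
    comulMap Q v h = Algebra.TensorProduct.map v (AlgHom.id k H) (Q.comul h) := rfl

@[simp]
theorem mapMiddle_tmul (v : H →ₐ[k] B) (a b c : H) :
    mapMiddle v (a ⊗ₜ (b ⊗ₜ c)) = a ⊗ₜ (v b ⊗ₜ c) := rfl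

@[simp]
theorem mapThird_tmul (v : H →ₐ[k] B) (a b c d : H) :
    mapThird v (a ⊗ₜ (b ⊗ₜ (c ⊗ₜ d))) = a ⊗ₜ (b ⊗ₜ (v c ⊗ₜ d)) := rfl

@[simp]
theorem coactExt_tmul (lam : B →ₐ[k] H ⊗[k] B) (b : B) (h : H) :
    coactExt lam (b ⊗ₜ h) = TensorProduct.assoc k H B H (lam b ⊗ₜ h) := rfl

theorem coactConj_apply (v : H →ₐ[k] B) (lam : B →ₐ[k] H ⊗[k] B) (c : B ⊗[k] H) :
    coactConj Q v lam c = mapMiddle v Q.Φ.val * coactExt lam c * mapMiddle v Q.Φ.inv := rfl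

variable {Q} {v : H →ₐ[k] B} {lam : B →ₐ[k] H ⊗[k] B}

theorem map_comulMap (t : H ⊗[k] (H ⊗[k] H)) :
    Algebra.TensorProduct.map (AlgHom.id k H)
      (Algebra.TensorProduct.map (AlgHom.id k H) (comulMap Q v)) t =
      mapThird v (Q.comulThd t) := by
  induction t using tensor_induction_right with
  | zero => simp
  | add x y hx hy => simp only [map_add, hx, hy]
  | tmul a b c => rfl

theorem coactExt_comulMap (hC : IsComoduleAlgebra Q v lam) (t : H ⊗[k] H) :
    coactExt lam (Algebra.TensorProduct.map v (AlgHom.id k H) t) = mapMiddle v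
      (TensorProduct.assoc k H H H (Algebra.TensorProduct.map Q.comul (AlgHom.id k H) t)) := by
  induction t using tensor_induction with
  | zero => simp
  | add x y hx hy => simp only [map_add, hx, hy]
  | tmul a b =>
    simp only [Algebra.TensorProduct.map_tmul, AlgHom.coe_id, id_eq, coactExt_tmul, hC.lam_v]
    generalize Q.comul a = u
    induction u using tensor_induction with
    | zero => simp
    | add x y hx hy => simp only [map_add, TensorProduct.add_tmul, hx, hy]
    | tmul c d => simp

theorem map_coactExt_mapMiddle (hC : IsComoduleAlgebra Q v lam) (t : H ⊗[k] (H ⊗[k] H)) :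
    Algebra.TensorProduct.map (AlgHom.id k H) (coactExt lam) (mapMiddle v t) =
      mapThird v (Q.comulSnd t) := by
  induction t using TensorProduct.induction_on with
  | zero => simp
  | add x y hx hy => simp only [map_add, hx, hy]
  | tmul a t =>
    simp only [mapMiddle, mapThird, comulSnd, Algebra.TensorProduct.map_tmul, AlgHom.coe_id, id_eq]
    rw [coactExt_comulMap hC]
    rfl

theorem map_comul_mapMiddle (t : H ⊗[k] (H ⊗[k] H)) :
    TensorProduct.assoc k H H (B ⊗[k] H) (Algebra.TensorProduct.map Q.comul
      (AlgHom.id k (B ⊗[k] H)) (mapMiddle v t)) = mapThird v (Q.comulFst t) := by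
  induction t using tensor_induction_right with
  | zero => simp
  | add x y hx hy => simp only [map_add, hx, hy]
  | tmul a b c =>
    simp only [Algebra.TensorProduct.map_tmul, AlgHom.coe_id, id_eq, mapMiddle_tmul, comulFst_tmul]
    generalize Q.comul a = u
    induction u using tensor_induction with
    | zero => simp
    | add x y hx hy => simp only [map_add, TensorProduct.add_tmul, hx, hy]
    | tmul c d => simp

/-- `Φ ⊗ 1` intertwines `(id ⊗ lam)lam ⊗ id` and `(Δ ⊗ id)lam ⊗ id`. -/
theorem map_coactExt_coactExt (hC : IsComoduleAlgebra Q v lam) (c : B ⊗[k] H) :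
    Algebra.TensorProduct.map (AlgHom.id k H) (coactExt lam) (coactExt lam c) *
        mapThird v (inclInit Q.Φ.val) =
      mapThird v (inclInit Q.Φ.val) * TensorProduct.assoc k H H (B ⊗[k] H)
        (Algebra.TensorProduct.map Q.comul (AlgHom.id k (B ⊗[k] H)) (coactExt lam c)) := by
  induction c using tensor_induction with
  | zero => simp
  | add x y hx hy => simp only [map_add, add_mul, mul_add, hx, hy]
  | tmul b h =>
    -- Insertion of h as last leg. Multiplication by Φ ⊗ 1 leaves that leg alone, so the claim is
    -- the quasi-coassociativity of lam at b.
    let s : H ⊗[k] (H ⊗[k] B) →ₗ[k] H ⊗[k] (H ⊗[k] (B ⊗[k] H)) := TensorProduct.map LinearMap.id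
      (TensorProduct.map LinearMap.id ((TensorProduct.mk k B H).flip h))
    have h1 : ∀ y : H ⊗[k] B, Algebra.TensorProduct.map (AlgHom.id k H) (coactExt lam)
        (TensorProduct.assoc k H B H (y ⊗ₜ h)) =
        s (Algebra.TensorProduct.map (AlgHom.id k H) lam y) := by
      intro y
      induction y using tensor_induction with
      | zero => simp
      | add x y hx hy => simp only [map_add, TensorProduct.add_tmul, hx, hy]
      | tmul a b =>
        simp only [s, TensorProduct.assoc_tmul, Algebra.TensorProduct.map_tmul, AlgHom.coe_id,
          id_eq, coactExt_tmul, TensorProduct.map_tmul, LinearMap.id_apply]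
        generalize lam b = u
        induction u using tensor_induction with
        | zero => simp
        | add x y hx hy => simp only [map_add, TensorProduct.add_tmul, TensorProduct.tmul_add,
            hx, hy]
        | tmul c d => simp
    have h2 : ∀ y : H ⊗[k] B, TensorProduct.assoc k H H (B ⊗[k] H)
        (Algebra.TensorProduct.map Q.comul (AlgHom.id k (B ⊗[k] H))
          (TensorProduct.assoc k H B H (y ⊗ₜ h))) =
        s (TensorProduct.assoc k H H B
          (Algebra.TensorProduct.map Q.comul (AlgHom.id k B) y)) := by
      intro y
      induction y using tensor_induction with
      | zero => simp
      | add x y hx hy => simp only [map_add, TensorProduct.add_tmul, hx, hy]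
      | tmul a b =>
        simp only [s, TensorProduct.assoc_tmul, Algebra.TensorProduct.map_tmul, AlgHom.coe_id,
          id_eq]
        generalize Q.comul a = u
        induction u using tensor_induction with
        | zero => simp
        | add x y hx hy => simp only [map_add, TensorProduct.add_tmul, hx, hy]
        | tmul c d => simp
    have h3 : ∀ (x : H ⊗[k] (H ⊗[k] B)) (t : H ⊗[k] (H ⊗[k] H)),
        s x * mapThird v (inclInit t) = s (x * Algebra.TensorProduct.map (AlgHom.id k H)
          (Algebra.TensorProduct.map (AlgHom.id k H) v) t) := by
      intro x t
      induction x using tensor_induction_right with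
      | zero => simp
      | add x y hx hy => simp only [map_add, add_mul, hx, hy]
      | tmul a b c =>
        induction t using tensor_induction_right with
        | zero => simp
        | add x y hx hy => simp only [map_add, mul_add, hx, hy]
        | tmul a b c => simp [s]
    have h4 : ∀ (x : H ⊗[k] (H ⊗[k] B)) (t : H ⊗[k] (H ⊗[k] H)),
        mapThird v (inclInit t) * s x = s (Algebra.TensorProduct.map (AlgHom.id k H)
          (Algebra.TensorProduct.map (AlgHom.id k H) v) t * x) := by
      intro x t
      induction x using tensor_induction_right with
      | zero => simp
      | add x y hx hy => simp only [map_add, mul_add, hx, hy]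
      | tmul a b c =>
        induction t using tensor_induction_right with
        | zero => simp
        | add x y hx hy => simp only [map_add, add_mul, hx, hy]
        | tmul a b c => simp [s]
    rw [coactExt_tmul, h1, h2, h3, h4, hC.quasi_coassoc]

/-- This is why the coaction is conjugated: lam ⊗ id alone sends v(h₁) ⊗ h₂ to the image of (Δ ⊗
id)Δ(h), and conjugation by Φ turns it into (id ⊗ Δ)Δ(h). -/
theorem coactConj_comulMap (hC : IsComoduleAlgebra Q v lam) (h : H) :
    coactConj Q v lam (comulMap Q v h) =
      Algebra.TensorProduct.map (AlgHom.id k H) (comulMap Q v) (Q.comul h) := by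
  rw [coactConj_apply, comulMap_apply, coactExt_comulMap hC, ← map_mul, ← map_mul,
    ← Q.comul_quasi_coassoc]
  generalize Q.comul h = t
  induction t using tensor_induction with
  | zero => simp
  | add x y hx hy => simp only [map_add, hx, hy]
  | tmul a b => rfl

/-- Iterating the conjugated coaction surrounds the quasi-coassociativity of lam with copies of Φ.
The pentagon combines those on the left, and its inverse form those on the right. The construction
can be repeated, and it is used for H, H ⊗ H and (H ⊗ H) ⊗ H. -/
theorem IsComoduleAlgebra.coactConj (hC : IsComoduleAlgebra Q v lam) :
    IsComoduleAlgebra Q (comulMap Q v) (coactConj Q v lam) := by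
  refine ⟨coactConj_comulMap hC, fun c => ?_, fun c => ?_⟩
  · have h1 : ∀ y : H ⊗[k] (B ⊗[k] H),
        Algebra.TensorProduct.map (AlgHom.id k H) (QuasiHopf.coactConj Q v lam) y =
        mapThird v (inclTail Q.Φ.val) *
          Algebra.TensorProduct.map (AlgHom.id k H) (coactExt lam) y *
          mapThird v (inclTail Q.Φ.inv) := by
      intro y
      induction y using TensorProduct.induction_on with
      | zero => simp
      | add x y hx hy => simp only [map_add, add_mul, mul_add, hx, hy]
      | tmul a c => simp [mapThird, coactConj_apply]
    rw [h1, coactConj_apply, map_mul, map_mul, map_coactExt_mapMiddle hC,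
      map_coactExt_mapMiddle hC, map_comulMap, map_mul (Algebra.TensorProduct.map Q.comul _),
      map_mul (Algebra.TensorProduct.map Q.comul _), assoc_mul, assoc_mul, map_comul_mapMiddle,
      map_comul_mapMiddle]
    set Y := Algebra.TensorProduct.map (AlgHom.id k H) (coactExt lam) (coactExt lam c)
    set Z := TensorProduct.assoc k H H (B ⊗[k] H)
        (Algebra.TensorProduct.map Q.comul (AlgHom.id k (B ⊗[k] H)) (coactExt lam c))
    have hYZ : Y = mapThird v (inclInit Q.Φ.val) * Z * mapThird v (inclInit Q.Φ.inv) := by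
      rw [← map_coactExt_coactExt hC, mul_assoc, ← map_mul, ← map_mul, Units.val_inv, map_one,
        map_one, mul_one]
    have h2 : inclTail Q.Φ.val * Q.comulSnd Q.Φ.val * inclInit Q.Φ.val =
      Q.comulThd Q.Φ.val * Q.comulFst Q.Φ.val := Q.pentagon
    have h3 : inclInit Q.Φ.inv * Q.comulSnd Q.Φ.inv * inclTail Q.Φ.inv * Q.comulThd Q.Φ.val =
        Q.comulFst Q.Φ.inv := by
      rw [mul_assoc, mul_assoc, ← inclInit_mul_comulFst_inv, ← mul_assoc, ← map_mul,
        Units.inv_val, map_one, one_mul]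
    calc _ = mapThird v (inclTail Q.Φ.val * Q.comulSnd Q.Φ.val * inclInit Q.Φ.val) * Z *
          mapThird v (inclInit Q.Φ.inv * Q.comulSnd Q.Φ.inv * inclTail Q.Φ.inv *
            Q.comulThd Q.Φ.val) := by
          rw [hYZ]; simp only [map_mul, mul_assoc]
      _ = _ := by rw [h2, h3]; simp only [map_mul, mul_assoc]
  · have h1 : ∀ t : H ⊗[k] (H ⊗[k] H), Algebra.TensorProduct.map Q.counit
        (AlgHom.id k (B ⊗[k] H)) (mapMiddle v t) = Algebra.TensorProduct.map (AlgHom.id k k)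
        (Algebra.TensorProduct.map v (AlgHom.id k H)) (Algebra.TensorProduct.map Q.counit
        (AlgHom.id k (H ⊗[k] H)) t) := by
      intro t
      induction t using tensor_induction_right with
      | zero => simp
      | add x y hx hy => simp only [map_add, hx, hy]
      | tmul a b c => simp
    rw [coactConj_apply, map_mul, map_mul, h1, h1, Q.isCounital_Φ.left, Q.isCounital_Φ_inv.left,
      map_one, one_mul, mul_one]
    induction c using tensor_induction with
    | zero => simp
    | add x y hx hy => simp only [map_add, TensorProduct.tmul_add, hx, hy]
    | tmul b h =>
      have h2 : ∀ y : H ⊗[k] B, Algebra.TensorProduct.map Q.counit (AlgHom.id k (B ⊗[k] H))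
          (TensorProduct.assoc k H B H (y ⊗ₜ h)) = TensorProduct.assoc k k B H
          ((Algebra.TensorProduct.map Q.counit (AlgHom.id k B) y) ⊗ₜ h) := by
        intro y
        induction y using tensor_induction with
        | zero => simp
        | add x y hx hy => simp only [map_add, TensorProduct.add_tmul, hx, hy]
        | tmul a b => simp
      rw [coactExt_tmul, h2, hC.counit, TensorProduct.assoc_tmul]

theorem isComoduleAlgebra_self (Q : QuasiBialgebra k H) :
    IsComoduleAlgebra Q (AlgHom.id k H) Q.comul := by
  refine ⟨fun h => by rw [Algebra.TensorProduct.map_id]; rfl, fun h => ?_, Q.counit_comul⟩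
  rw [Algebra.TensorProduct.map_id, Algebra.TensorProduct.map_id]
  exact (Q.Φ_mul_comul h).symm

end Extension

/-! ### Lifting dressings from B to B ⊗ H -/

section Lift

open QuasiBialgebra

variable {k H : Type*} [Field k] [Ring H] [Algebra k H] (Q : QuasiBialgebra k H)
variable {B : Type*} [Ring B] [Algebra k B]
variable {M N : Type*} [AddCommGroup M] [Module k M] [AddCommGroup N] [Module k N]

/-- `a ⊗ b ⊗ c ↦ E(a · m) v(b) ⊗ c`. -/
def liftMap (aM : H →ₗ[k] M →ₗ[k] M) (v : H →ₐ[k] B) (E : M →ₗ[k] B) (m : M) :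
    H ⊗[k] (H ⊗[k] H) →ₗ[k] B ⊗[k] H :=
  mulMap ((TensorProduct.mk k B H).flip 1 ∘ₗ E ∘ₗ aM.flip m)
    (TensorProduct.map v.toLinearMap LinearMap.id)

/-- `m ↦ E(x¹ · m) v(x²) ⊗ x³`. -/
def liftDress (aM : H →ₗ[k] M →ₗ[k] M) (v : H →ₐ[k] B) (E : M →ₗ[k] B) : M →ₗ[k] B ⊗[k] H :=
  TensorProduct.map (mulMap E v.toLinearMap) LinearMap.id ∘ₗ associatorInv Q aM regAct regAct ∘ₗ
    (TensorProduct.mk k M (H ⊗[k] H)).flip (1 ⊗ₜ 1)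

variable {Q}
variable {aM : H →ₗ[k] M →ₗ[k] M} {cM : M →ₗ[k] H ⊗[k] M} {aN : H →ₗ[k] N →ₗ[k] N}
  {v : H →ₐ[k] B} {lam : B →ₐ[k] H ⊗[k] B} {E : M →ₗ[k] B} {E' : N →ₗ[k] B}

@[simp]
theorem liftMap_tmul (m : M) (a b c : H) :
    liftMap aM v E m (a ⊗ₜ (b ⊗ₜ c)) = (E (aM a m) * v b) ⊗ₜ c := by
  simp [liftMap]

theorem liftDress_apply (m : M) : liftDress Q aM v E m = liftMap aM v E m Q.Φ.inv := by
  simp only [liftDress, LinearMap.comp_apply, associatorInv, LinearMap.flip_apply,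
    TensorProduct.mk_apply]
  generalize Q.Φ.inv = t
  induction t using tensor_induction_right with
  | zero => simp
  | add x y hx hy => simp only [map_add, LinearMap.add_apply, hx, hy]
  | tmul a b c => simp

theorem liftMap_act (hM' : ∀ g h m, aM (g * h) m = aM g (aM h m)) (h : H) (m : M)
    (t : H ⊗[k] (H ⊗[k] H)) : liftMap aM v E (aM h m) t =
      liftMap aM v E m (t * (h ⊗ₜ (1 ⊗ₜ 1))) := by
  induction t using tensor_induction_right with
  | zero => simp
  | add x y hx hy => simp only [map_add, add_mul, hx, hy]
  | tmul a b c => simp [hM']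

theorem Intertwines.map_mul_liftMap (hE : Intertwines Q aM v E)
    (hM' : ∀ g h m, aM (g * h) m = aM g (aM h m)) (u : H ⊗[k] H) (m : M)
    (t : H ⊗[k] (H ⊗[k] H)) :
    Algebra.TensorProduct.map v (AlgHom.id k H) u * liftMap aM v E m t =
      liftMap aM v E m (TensorProduct.assoc k H H H
        (Algebra.TensorProduct.map Q.comul (AlgHom.id k H) u) * t) := by
  induction u using tensor_induction with
  | zero => simp
  | add x y hx hy => simp only [map_add, add_mul, hx, hy]
  | tmul g g' =>
    induction t using tensor_induction_right with
    | zero => simp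
    | add x y hx hy => simp only [map_add, mul_add, hx, hy]
    | tmul a b c =>
      simp only [liftMap_tmul, Algebra.TensorProduct.map_tmul, AlgHom.coe_id, id_eq,
        Algebra.TensorProduct.tmul_mul_tmul]
      rw [← mul_assoc, hE]
      generalize Q.comul g = w
      induction w using tensor_induction with
      | zero => simp
      | add x y hx hy => simp only [map_add, add_mul, TensorProduct.add_tmul, hx, hy]
      | tmul d e => simp [hM', mul_assoc]

/-- Passing h through E produces (Δ ⊗ id)Δ(h) Φ⁻¹. Quasi-coassociativity rewrites it as Φ⁻¹ (id ⊗
Δ)Δ(h), which is the lift at h₁·m followed by v(h₂) ⊗ h₃. -/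
theorem Intertwines.liftDress (hE : Intertwines Q aM v E)
    (hM' : ∀ g h m, aM (g * h) m = aM g (aM h m)) :
    Intertwines Q aM (comulMap Q v) (liftDress Q aM v E) := by
  intro h m
  rw [liftDress_apply, comulMap_apply, hE.map_mul_liftMap hM', comul_mul_Φ_inv]
  generalize Q.comul h = u
  induction u using tensor_induction with
  | zero => simp
  | add x y hx hy => simp only [map_add, mul_add, hx, hy]
  | tmul g g' =>
    simp only [mulMap_tmul, LinearMap.comp_apply, LinearMap.flip_apply, liftDress_apply,
      AlgHom.toLinearMap_apply, liftMap_act hM', Algebra.TensorProduct.map_tmul, AlgHom.coe_id,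
      id_eq, comulMap_apply]
    generalize Q.comul g' = w
    generalize Q.Φ.inv = t
    induction t using tensor_induction_right with
    | zero => simp
    | add x y hx hy => simp only [map_add, add_mul, hx, hy]
    | tmul a b c =>
      induction w using tensor_induction with
      | zero => simp
      | add x y hx hy => simp only [map_add, mul_add, TensorProduct.tmul_add, hx, hy]
      | tmul d e => simp [mul_assoc]

/-- `a ⊗ b ⊗ c ⊗ d ↦ E(a · m) E'(b · n) v(c) ⊗ d`. -/
def liftMulMap (aM : H →ₗ[k] M →ₗ[k] M) (aN : H →ₗ[k] N →ₗ[k] N) (v : H →ₐ[k] B) (E : M →ₗ[k] B)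
    (E' : N →ₗ[k] B) (m : M) (n : N) : H ⊗[k] (H ⊗[k] (H ⊗[k] H)) →ₗ[k] B ⊗[k] H :=
  mulMap ((TensorProduct.mk k B H).flip 1 ∘ₗ E ∘ₗ aM.flip m) (liftMap aN v E' n)

@[simp]
theorem liftMulMap_tmul (m : M) (n : N) (a b c d : H) :
    liftMulMap aM aN v E E' m n (a ⊗ₜ (b ⊗ₜ (c ⊗ₜ d))) =
      (E (aM a m) * (E' (aN b n) * v c)) ⊗ₜ d := by
  simp [liftMulMap]

/-- Both sides are values of one linear map on H⊗H⊗H⊗H, at (Φ ⊗ 1)(Δ ⊗ id ⊗ id)(Φ⁻¹) and at (id ⊗ Δ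
⊗ id)(Φ⁻¹)(1 ⊗ Φ⁻¹)(id ⊗ id ⊗ Δ)(Φ). These elements agree by the pentagon. -/
theorem liftDress_dressMul (hM' : ∀ g h m, aM (g * h) m = aM g (aM h m))
    (hN' : ∀ g h n, aN (g * h) n = aN g (aN h n)) (hE' : Intertwines Q aN v E') :
    liftDress Q (tensorAct Q aM aN) v (dressMul Q aM aN v E E') =
      dressMul Q aM aN (comulMap Q v) (liftDress Q aM v E) (liftDress Q aN v E') := by
  refine TensorProduct.ext' fun m n => ?_
  have h1 : liftDress Q (tensorAct Q aM aN) v (dressMul Q aM aN v E E') (m ⊗ₜ n) =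
      liftMulMap aM aN v E E' m n (inclInit Q.Φ.val * Q.comulFst Q.Φ.inv) := by
    rw [liftDress_apply]
    generalize Q.Φ.inv = t
    induction t using tensor_induction_right with
    | zero => simp
    | add x y hx hy => simp only [map_add, mul_add, hx, hy]
    | tmul a b c =>
      simp only [liftMap_tmul, comulFst_tmul, tensorAct, LinearMap.comp_apply,
        AlgHom.toLinearMap_apply]
      generalize Q.comul a = u
      induction u using tensor_induction with
      | zero => simp
      | add x y hx hy =>
        simp only [map_add, add_mul, mul_add, LinearMap.add_apply, TensorProduct.add_tmul, hx, hy]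
      | tmul p q =>
        rw [TensorProduct.map₂_apply_tmul, TensorProduct.map_tmul, dressMul_tmul]
        generalize Q.Φ.val = w
        induction w using tensor_induction_right with
        | zero => simp
        | add x y hx hy => simp only [map_add, add_mul, TensorProduct.add_tmul, hx, hy]
        | tmul d e f => simp [hM', hN', mul_assoc]
  have h2 : dressMul Q aM aN (comulMap Q v) (liftDress Q aM v E) (liftDress Q aN v E')
      (m ⊗ₜ n) = liftMulMap aM aN v E E' m n
        (Q.comulSnd Q.Φ.inv * (inclTail Q.Φ.inv * Q.comulThd Q.Φ.val)) := by
    rw [dressMul_tmul]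
    have h3 : ∀ (n : N) (x : H) (t : H ⊗[k] (H ⊗[k] H)),
        mulMap (QuasiHopf.liftDress Q aM v E ∘ₗ aM.flip m) (LinearMap.id) (x ⊗ₜ (liftMap aN v E' n t)) =
        liftMulMap aM aN v E E' m n (Q.comulSnd Q.Φ.inv * (x ⊗ₜ t)) := by
      intro n x t
      simp only [mulMap_tmul, LinearMap.comp_apply, LinearMap.flip_apply, liftDress_apply,
        LinearMap.id_apply]
      generalize Q.Φ.inv = w
      induction w using tensor_induction_right with
      | zero => simp
      | add x y hx hy => simp only [map_add, add_mul, hx, hy]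
      | tmul a b c =>
        induction t using tensor_induction_right with
        | zero => simp
        | add x y hx hy => simp only [map_add, mul_add, TensorProduct.tmul_add, hx, hy]
        | tmul p q r =>
          simp only [liftMap_tmul, Algebra.TensorProduct.tmul_mul_tmul, comulSnd_tmul]
          rw [mul_assoc (E _), ← mul_assoc (v b), hE']
          generalize Q.comul b = u
          induction u using tensor_induction with
          | zero => simp
          | add x y hx hy =>
            simp only [map_add, add_mul, mul_add, TensorProduct.add_tmul, TensorProduct.tmul_add,
              hx, hy]
          | tmul d e => simp [hM', hN', mul_assoc]
    generalize Q.Φ.val = w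
    induction w using tensor_induction_right with
    | zero => simp
    | add x y hx hy => simp only [map_add, mul_add, hx, hy]
    | tmul x y z =>
      have h4 : liftDress Q aN v E' (aN y n) * comulMap Q v z = liftMap aN v E' n
          (Q.Φ.inv * (y ⊗ₜ Q.comul z)) := by
        rw [liftDress_apply, liftMap_act hN', comulMap_apply]
        generalize Q.comul z = u
        generalize Q.Φ.inv = t
        induction t using tensor_induction_right with
        | zero => simp
        | add x y hx hy => simp only [map_add, add_mul, hx, hy]
        | tmul a b c =>
          induction u using tensor_induction with
          | zero => simp
          | add x y hx hy => simp only [map_add, mul_add, TensorProduct.tmul_add, hx, hy]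
          | tmul d e => simp [mul_assoc]
      have h5 := h3 n x (Q.Φ.inv * (y ⊗ₜ Q.comul z))
      rw [← h4] at h5
      simpa using h5
  rw [h1, h2, inclInit_mul_comulFst_inv]

/-- Moving v(h) across D and then across D' multiplies Φ on the left by (id ⊗ Δ)Δ(h).
Quasi-coassociativity turns this into Φ (Δ ⊗ id)Δ(h), that is, the tensor product action followed by
v(h₂). -/
theorem Intertwines.dressMul {D : M →ₗ[k] B} {D' : N →ₗ[k] B}
    (hM' : ∀ g h m, aM (g * h) m = aM g (aM h m))
    (hN' : ∀ g h n, aN (g * h) n = aN g (aN h n)) (hD : Intertwines Q aM v D)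
    (hD' : Intertwines Q aN v D') :
    Intertwines Q (tensorAct Q aM aN) v (dressMul Q aM aN v D D') := by
  intro h w
  induction w using tensor_induction with
  | zero => simp [mulMap]
  | add x y hx hy =>
    rw [map_add, mul_add, hx, hy]
    generalize Q.comul h = u
    induction u using tensor_induction with
    | zero => simp
    | add a b ha hb => rw [map_add, map_add, map_add, ← ha, ← hb]; abel
    | tmul a b => simp [add_mul]
  | tmul m n =>
    let F : H ⊗[k] (H ⊗[k] H) →ₗ[k] B :=
      mulMap (D ∘ₗ aM.flip m) (mulMap (D' ∘ₗ aN.flip n) v.toLinearMap)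
    have h1 : ∀ t : H ⊗[k] (H ⊗[k] H), v h * F t =
        F (Algebra.TensorProduct.map (AlgHom.id k H) Q.comul (Q.comul h) * t) := by
      intro t
      induction t using tensor_induction_right with
      | zero => simp
      | add x y hx hy => simp only [map_add, mul_add, hx, hy]
      | tmul a b c =>
        simp only [F, mulMap_tmul, LinearMap.comp_apply, LinearMap.flip_apply,
          AlgHom.toLinearMap_apply]
        rw [← mul_assoc, hD]
        generalize Q.comul h = u
        induction u using tensor_induction with
        | zero => simp
        | add x y hx hy => simp only [map_add, add_mul, hx, hy]
        | tmul p q =>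
          simp only [mulMap_tmul, LinearMap.comp_apply, LinearMap.flip_apply,
            AlgHom.toLinearMap_apply, Algebra.TensorProduct.map_tmul, AlgHom.coe_id, id_eq,
            Algebra.TensorProduct.tmul_mul_tmul]
          rw [mul_assoc, ← mul_assoc (v q), hD']
          generalize Q.comul q = u
          induction u using tensor_induction with
          | zero => simp
          | add x y hx hy => simp only [map_add, add_mul, mul_add, hx, hy]
          | tmul p q => simp [hM', hN', mul_assoc]
    have h2 : ∀ t : H ⊗[k] H, mulMap (QuasiHopf.dressMul Q aM aN v D D' ∘ₗ
        (tensorAct Q aM aN).flip (m ⊗ₜ n)) v.toLinearMap t = F (Q.Φ.val *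
          TensorProduct.assoc k H H H (Algebra.TensorProduct.map Q.comul (AlgHom.id k H) t)) := by
      intro t
      induction t using tensor_induction with
      | zero => simp
      | add x y hx hy => simp only [map_add, mul_add, hx, hy]
      | tmul a b =>
        simp only [mulMap_tmul, LinearMap.comp_apply, LinearMap.flip_apply, tensorAct,
          AlgHom.toLinearMap_apply, Algebra.TensorProduct.map_tmul, AlgHom.coe_id, id_eq]
        generalize Q.comul a = u
        induction u using tensor_induction with
        | zero => simp
        | add x y hx hy =>
          simp only [map_add, add_mul, mul_add, LinearMap.add_apply, TensorProduct.add_tmul, hx, hy]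
        | tmul p q =>
          rw [TensorProduct.map₂_apply_tmul, TensorProduct.map_tmul, dressMul_tmul]
          generalize Q.Φ.val = w
          induction w using tensor_induction_right with
          | zero => simp
          | add x y hx hy => simp only [map_add, add_mul, hx, hy]
          | tmul d e f => simp [F, hM', hN', mul_assoc]
    rw [h2, Φ_mul_comul, ← h1, dressMul_tmul]

/-- `(a ⊗ b ⊗ c ⊗ d, g ⊗ m) ↦ a g ⊗ (E(b · m) v(c) ⊗ d)`. -/
def liftCoactMap (aM : H →ₗ[k] M →ₗ[k] M) (v : H →ₐ[k] B) (E : M →ₗ[k] B) :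
    H ⊗[k] (H ⊗[k] (H ⊗[k] H)) →ₗ[k] H ⊗[k] M →ₗ[k] H ⊗[k] (B ⊗[k] H) :=
  TensorProduct.map₂ regAct (LinearMap.mk₂ k (fun t m => liftMap aM v E m t)
    (fun _ _ _ => map_add _ _ _) (fun _ _ _ => map_smul _ _ _)
    (fun t m n => by
      induction t using tensor_induction_right with
      | zero => simp
      | add x y hx hy => simp only [map_add, hx, hy]; abel
      | tmul a b c => simp [add_mul, TensorProduct.add_tmul])
    (fun r t m => by
      induction t using tensor_induction_right with
      | zero => simp
      | add x y hx hy => simp only [map_add, hx, hy, smul_add]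
      | tmul a b c => simp [TensorProduct.smul_tmul']))

@[simp]
theorem liftCoactMap_tmul (a : H) (t : H ⊗[k] (H ⊗[k] H)) (g : H) (m : M) :
    liftCoactMap aM v E (a ⊗ₜ t) (g ⊗ₜ m) = (a * g) ⊗ₜ liftMap aM v E m t := by
  simp [liftCoactMap]

theorem mapMiddle_mul_liftCoactMap (hM' : ∀ g h m, aM (g * h) m = aM g (aM h m))
    (hE : Intertwines Q aM v E) (x : H ⊗[k] (H ⊗[k] H)) (t : H ⊗[k] (H ⊗[k] (H ⊗[k] H)))
    (w : H ⊗[k] M) : mapMiddle v x * liftCoactMap aM v E t w =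
      liftCoactMap aM v E (Q.comulSnd x * t) w := by
  induction x using tensor_induction_right with
  | zero => simp
  | add x y hx hy => simp only [map_add, add_mul, LinearMap.add_apply, hx, hy]
  | tmul x y z =>
    induction w using tensor_induction with
    | zero => simp
    | add x y hx hy => simp only [map_add, mul_add, hx, hy]
    | tmul g m =>
      induction t using tensor_induction_right_right with
      | zero => simp
      | add x y hx hy => simp only [map_add, mul_add, LinearMap.add_apply, hx, hy]
      | tmul a b c d =>
        simp only [liftCoactMap_tmul, liftMap_tmul, mapMiddle_tmul, comulSnd_tmul,
          Algebra.TensorProduct.tmul_mul_tmul]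
        rw [← mul_assoc (v y), hE]
        generalize Q.comul y = u
        induction u using tensor_induction with
        | zero => simp
        | add x y hx hy =>
          simp only [map_add, add_mul, TensorProduct.add_tmul, TensorProduct.tmul_add,
            hx, hy]
        | tmul d e => simp [hM', mul_assoc]

theorem dressCoact_liftDress (hM' : ∀ g h m, aM (g * h) m = aM g (aM h m)) (w : H ⊗[k] M) :
    dressCoact Q aM (comulMap Q v) (liftDress Q aM v E) w =
      liftCoactMap aM v E (inclTail Q.Φ.inv * Q.comulThd Q.Φ.val) w := by
  induction w using tensor_induction with
  | zero => simp
  | add x y hx hy => simp only [map_add, hx, hy]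
  | tmul g m =>
    rw [dressCoact_tmul]
    generalize Q.Φ.val = w
    induction w using tensor_induction_right with
    | zero => simp
    | add x y hx hy => simp only [map_add, mul_add, LinearMap.add_apply, hx, hy]
    | tmul x y z =>
      simp only [TensorProduct.map_tmul, mulMap_tmul, LinearMap.comp_apply, LinearMap.flip_apply,
        liftDress_apply, liftMap_act hM', AlgHom.toLinearMap_apply, comulThd_tmul, inclTail_apply,
        Algebra.TensorProduct.tmul_mul_tmul, liftCoactMap_tmul, LinearMap.mulRight_apply, one_mul,
        comulMap_apply]
      congr 1
      generalize Q.comul z = u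
      generalize Q.Φ.inv = t
      induction t using tensor_induction_right with
      | zero => simp
      | add x y hx hy => simp only [map_add, add_mul, hx, hy]
      | tmul a b c =>
        induction u using tensor_induction with
        | zero => simp
        | add x y hx hy => simp only [map_add, mul_add, TensorProduct.tmul_add, hx, hy]
        | tmul d e => simp [mul_assoc]

/-- `a ⊗ w ↦ lam(E(a · m)) (id ⊗ v)(w)`, extended by a last tensor factor. -/
def coactLiftMap (aM : H →ₗ[k] M →ₗ[k] M) (v : H →ₐ[k] B) (lam : B →ₐ[k] H ⊗[k] B)
    (E : M →ₗ[k] B) (m : M) :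
    H ⊗[k] (H ⊗[k] (H ⊗[k] H)) →ₗ[k] H ⊗[k] (B ⊗[k] H) :=
  mulMap ((coactExt lam).toLinearMap ∘ₗ (TensorProduct.mk k B H).flip 1 ∘ₗ E ∘ₗ aM.flip m)
    (mapMiddle v).toLinearMap

@[simp]
theorem coactLiftMap_tmul (m : M) (a : H) (t : H ⊗[k] (H ⊗[k] H)) :
    coactLiftMap aM v lam E m (a ⊗ₜ t) =
      TensorProduct.assoc k H B H (lam (E (aM a m)) ⊗ₜ 1) * mapMiddle v t := by
  simp [coactLiftMap]

theorem coactExt_liftDress (hC : IsComoduleAlgebra Q v lam) (m : M) :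
    coactExt lam (liftDress Q aM v E m) = coactLiftMap aM v lam E m (Q.comulSnd Q.Φ.inv) := by
  rw [liftDress_apply]
  generalize Q.Φ.inv = t
  induction t using tensor_induction_right with
  | zero => simp
  | add x y hx hy => simp only [map_add, hx, hy]
  | tmul a b c =>
    have h1 : mapMiddle v (TensorProduct.assoc k H H H (Q.comul b ⊗ₜ c)) =
        coactExt lam (v b ⊗ₜ c) :=
      (coactExt_comulMap hC (b ⊗ₜ c)).symm
    rw [liftMap_tmul, comulSnd_tmul, coactLiftMap_tmul, h1, ← coactExt_tmul, ← map_mul]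
    simp

/-- The pentagon brings both sides to the element (Φ ⊗ 1)(Δ ⊗ id ⊗ id)(Φ⁻¹), evaluated once with lam
before E and once with the coaction of M. The relation for E and the compatibility of action and
coaction identify the two evaluations. -/
theorem Cointertwines.liftDress (hM' : ∀ g h m, aM (g * h) m = aM g (aM h m))
    (hcompat : ∀ (h : H) (m : M), tensorAct Q regAct aM h (cM m) =
      coactMul cM (TensorProduct.map (aM.flip m) LinearMap.id (Q.comul h)))
    (hC : IsComoduleAlgebra Q v lam) (hE : Intertwines Q aM v E)
    (hE' : Cointertwines Q aM cM v lam E) :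
    Cointertwines Q aM cM (comulMap Q v) (coactConj Q v lam) (liftDress Q aM v E) := by
  intro m
  have h1 : mulMap ((coactConj Q v lam).toLinearMap ∘ₗ QuasiHopf.liftDress Q aM v E ∘ₗ aM.flip m)
      (TensorProduct.map LinearMap.id (comulMap Q v).toLinearMap) Q.Φ.val =
      mapMiddle v Q.Φ.val * coactLiftMap aM v lam E m
        (Q.comulSnd Q.Φ.inv * (inclTail Q.Φ.inv * Q.comulThd Q.Φ.val)) := by
    have h3 : ∀ (x y z : H), coactConj Q v lam (QuasiHopf.liftDress Q aM v E (aM x m)) *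
        (y ⊗ₜ comulMap Q v z) = mapMiddle v Q.Φ.val * coactLiftMap aM v lam E m
        (Q.comulSnd Q.Φ.inv * (inclTail Q.Φ.inv * Q.comulThd (x ⊗ₜ (y ⊗ₜ z)))) := by
      intro x y z
      have h4 : mapMiddle v Q.Φ.inv * (y ⊗ₜ comulMap Q v z) =
          mapMiddle v (Q.Φ.inv * (y ⊗ₜ Q.comul z)) := by
        rw [map_mul]; rfl
      have h5 : ∀ (s : H ⊗[k] (H ⊗[k] (H ⊗[k] H))) (u : H ⊗[k] (H ⊗[k] H)),
          coactLiftMap aM v lam E (aM x m) s * mapMiddle v u =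
            coactLiftMap aM v lam E m (s * (x ⊗ₜ u)) := by
        intro s u
        induction s using TensorProduct.induction_on with
        | zero => simp
        | add x y hx hy => simp only [map_add, add_mul, hx, hy]
        | tmul a t => simp [hM', mul_assoc]
      rw [coactConj_apply, mul_assoc, mul_assoc, h4, coactExt_liftDress hC, h5]
      congr 3
      simp
    have h6 : ∀ w, mulMap ((coactConj Q v lam).toLinearMap ∘ₗ QuasiHopf.liftDress Q aM v E ∘ₗ
        aM.flip m) (TensorProduct.map LinearMap.id (comulMap Q v).toLinearMap) w =
        mapMiddle v Q.Φ.val * coactLiftMap aM v lam E m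
          (Q.comulSnd Q.Φ.inv * (inclTail Q.Φ.inv * Q.comulThd w)) := by
      intro w
      induction w using tensor_induction_right with
      | zero => simp
      | add x y hx hy => simp only [map_add, mul_add, hx, hy]
      | tmul x y z =>
        rw [← h3]
        simp
    exact h6 _
  -- The factor Φ ⊗ 1 is consumed by the cointertwining relation of E at a₁·m. The pair a₁, a₂ is
  -- then carried across the coaction by the compatibility axiom.
  have h2 : ∀ t : H ⊗[k] (H ⊗[k] H), coactLiftMap aM v lam E m
      (inclInit Q.Φ.val * Q.comulFst t) =
      liftCoactMap aM v E (inclInit Q.Φ.val * Q.comulFst t) (cM m) := by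
    intro t
    induction t using tensor_induction_right with
    | zero => simp
    | add x y hx hy => simp only [map_add, mul_add, LinearMap.add_apply, hx, hy]
    | tmul a b c =>
      let R : H ⊗[k] M →ₗ[k] H ⊗[k] (B ⊗[k] H) :=
        liftCoactMap aM v E (inclInit Q.Φ.val * (1 ⊗ₜ (1 ⊗ₜ (b ⊗ₜ c))))
      have h3 : ∀ u : H ⊗[k] H, coactLiftMap aM v lam E m (inclInit Q.Φ.val *
          TensorProduct.assoc k H H (H ⊗[k] H) (u ⊗ₜ (b ⊗ₜ c))) =
          R (coactMul cM (TensorProduct.map (aM.flip m) LinearMap.id u)) := by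
        intro u
        induction u using tensor_induction with
        | zero => simp
        | add x y hx hy => simp only [map_add, mul_add, TensorProduct.add_tmul, hx, hy]
        | tmul p q =>
          rw [TensorProduct.assoc_tmul, TensorProduct.map_tmul, coactMul_tmul]
          have h4 : coactLiftMap aM v lam E m (inclInit Q.Φ.val * (p ⊗ₜ (q ⊗ₜ (b ⊗ₜ c)))) =
              TensorProduct.assoc k H B H (mulMap (lam.toLinearMap ∘ₗ E ∘ₗ aM.flip (aM p m))
                (TensorProduct.map LinearMap.id v.toLinearMap) Q.Φ.val ⊗ₜ 1) *
                (q ⊗ₜ (v b ⊗ₜ c)) := by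
            generalize Q.Φ.val = x
            induction x using tensor_induction_right with
            | zero => simp
            | add x y hx hy => simp only [map_add, add_mul, TensorProduct.add_tmul, hx, hy]
            | tmul x y z =>
              simp only [inclInit_tmul, Algebra.TensorProduct.tmul_mul_tmul, coactLiftMap_tmul,
                mapMiddle_tmul, mulMap_tmul, LinearMap.comp_apply, LinearMap.flip_apply,
                AlgHom.toLinearMap_apply, TensorProduct.map_tmul, LinearMap.id_apply, hM', one_mul,
                map_mul]
              generalize lam (E (aM x (aM p m))) = e
              induction e using tensor_induction with
              | zero => simp
              | add x y hx hy => simp only [map_add, add_mul, TensorProduct.add_tmul, hx, hy]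
              | tmul e f => simp [mul_assoc]
          rw [h4, ← hE']
          simp only [R, LinearMap.flip_apply, LinearMap.id_apply]
          generalize cM (aM p m) = w
          induction w using tensor_induction with
          | zero => simp
          | add x y hx hy => simp only [map_add, add_mul, TensorProduct.add_tmul, hx, hy]
          | tmul g n =>
            rw [dressCoact_tmul, TensorProduct.map_tmul]
            generalize Q.Φ.val = x
            induction x using tensor_induction_right with
            | zero => simp
            | add x y hx hy =>
              simp only [map_add, add_mul, TensorProduct.add_tmul, LinearMap.add_apply, hx, hy]
            | tmul x y z => simp [mul_assoc]
      rw [comulFst_tmul, h3, ← hcompat, tensorAct, LinearMap.comp_apply, AlgHom.toLinearMap_apply]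
      simp only [R]
      generalize Q.comul a = u
      induction u using tensor_induction with
      | zero => simp
      | add x y hx hy =>
        simp only [map_add, mul_add, TensorProduct.add_tmul, LinearMap.add_apply, hx, hy]
      | tmul p q =>
        generalize cM m = w
        induction w using tensor_induction with
        | zero => simp
        | add x y hx hy => simp only [map_add, hx, hy]
        | tmul g n =>
          generalize Q.Φ.val = x
          induction x using tensor_induction_right with
          | zero => simp
          | add x y hx hy => simp only [map_add, add_mul, LinearMap.add_apply, hx, hy]
          | tmul x y z => simp [hM', mul_assoc]
  rw [h1, ← inclInit_mul_comulFst_inv, h2, mapMiddle_mul_liftCoactMap hM' hE,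
    dressCoact_liftDress hM', inclTail_inv_mul_comulThd]

end Lift

section TensorAct

variable {k H : Type*} [Field k] [Ring H] [Algebra k H] {Q : QuasiBialgebra k H}
variable {M N : Type*} [AddCommGroup M] [Module k M] [AddCommGroup N] [Module k N]
variable {aM : H →ₗ[k] M →ₗ[k] M} {aN : H →ₗ[k] N →ₗ[k] N}

theorem tensorAct_one (hM : ∀ m, aM 1 m = m) (hN : ∀ n, aN 1 n = n) (w : M ⊗[k] N) :
    tensorAct Q aM aN 1 w = w := by
  simp only [tensorAct, LinearMap.comp_apply, AlgHom.toLinearMap_apply, map_one,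
    Algebra.TensorProduct.one_def]
  induction w using tensor_induction with
  | zero => simp
  | add x y hx hy => simp only [map_add, hx, hy]
  | tmul x y => simp [hM, hN]

theorem tensorAct_mul (hM' : ∀ g h m, aM (g * h) m = aM g (aM h m))
    (hN' : ∀ g h n, aN (g * h) n = aN g (aN h n)) (g h : H) (w : M ⊗[k] N) :
    tensorAct Q aM aN (g * h) w = tensorAct Q aM aN g (tensorAct Q aM aN h w) := by
  simp only [tensorAct, LinearMap.comp_apply, AlgHom.toLinearMap_apply, map_mul]
  generalize Q.comul g = t
  generalize Q.comul h = u
  induction t using tensor_induction with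
  | zero => simp
  | add x y hx hy => simp only [map_add, add_mul, LinearMap.add_apply, hx, hy]
  | tmul a c =>
    induction u using tensor_induction with
    | zero => simp
    | add x y hx hy => simp only [map_add, mul_add, LinearMap.add_apply, hx, hy]
    | tmul d e =>
      induction w using tensor_induction with
      | zero => simp
      | add x y hx hy => simp only [map_add, hx, hy]
      | tmul x y => simp [hM', hN']

end TensorAct

/-! ### Dressing the twisted algebra Bᵛ in B ⊗ H -/

namespace QuasiHopfAlgebra

open QuasiBialgebra

variable {k H : Type*} [Field k] [Ring H] [Algebra k H] (Q : QuasiHopfAlgebra k H)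
variable {B : Type*} [Ring B] [Algebra k B] (v : H →ₐ[k] B) (lam : B →ₐ[k] H ⊗[k] B)

theorem twistedAct_one (b : B) : Q.twistedAct v 1 b = b := by
  simp [twistedAct, Algebra.TensorProduct.one_def, Q.S_one]

theorem twistedAct_mul (g h : H) (b : B) :
    Q.twistedAct v (g * h) b = Q.twistedAct v g (Q.twistedAct v h b) := by
  simp only [twistedAct, LinearMap.comp_apply, AlgHom.toLinearMap_apply, map_mul]
  generalize Q.comul g = t
  generalize Q.comul h = u
  induction t using tensor_induction with
  | zero => simp
  | add x y hx hy => simp only [map_add, add_mul, LinearMap.add_apply, hx, hy]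
  | tmul a c =>
    induction u using tensor_induction with
    | zero => simp
    | add x y hx hy => simp only [map_add, mul_add, LinearMap.add_apply, hx, hy]
    | tmul d e => simp [Q.S_mul, mul_assoc]

/-- `b ↦ v(X¹) b v(S(X²) α X³)`. -/
def flatDress : B →ₗ[k] B := bimul (TensorProduct.map v.toLinearMap v.toLinearMap Q.qS)

/-- `b ↦ v(X¹) b v(S(y¹X²) α y²X³₁) ⊗ y³X³₂`. -/
def dress : B →ₗ[k] B ⊗[k] H := liftDress Q.toQuasiBialgebra (Q.twistedAct v) v (Q.flatDress v)

/-- `b ⊗ h ↦ b v(β S(h))`. -/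
def undress : B ⊗[k] H →ₗ[k] B :=
  mulMap (LinearMap.mulRight k (v Q.β)) (v.toLinearMap ∘ₗ Q.S.toLinearMap)

@[simp]
theorem undress_tmul (b : B) (h : H) : Q.undress v (b ⊗ₜ h) = b * v Q.β * v (Q.S h) := by
  simp [undress]

/-- The product D(h₁·b) v(h₂) is b sandwiched by (id ⊗ S(·) α (·)) applied to Φ (Δ ⊗ id)Δ(h). Moving
Φ to the right lets α absorb h₂, which leaves the single factor v(h) on the left. -/
theorem flatDress_intertwines :
    Intertwines Q.toQuasiBialgebra (Q.twistedAct v) v (Q.flatDress v) := by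
  intro h b
  have h1 : ∀ t : H ⊗[k] H, mulMap (Q.flatDress v ∘ₗ (Q.twistedAct v).flip b) v.toLinearMap t =
      bimul (TensorProduct.map v.toLinearMap v.toLinearMap (TensorProduct.map LinearMap.id Q.evα
        (Q.Φ.val * TensorProduct.assoc k H H H
          (Algebra.TensorProduct.map Q.comul (AlgHom.id k H) t)))) b := by
    intro t
    induction t using tensor_induction with
    | zero => simp
    | add x y hx hy => simp only [map_add, mul_add, LinearMap.add_apply, hx, hy]
    | tmul a c =>
      simp only [mulMap_tmul, LinearMap.comp_apply, LinearMap.flip_apply, flatDress, twistedAct,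
        AlgHom.toLinearMap_apply, qS, Algebra.TensorProduct.map_tmul, AlgHom.coe_id, id_eq]
      generalize Q.comul a = u
      generalize Q.Φ.val = x
      induction u using tensor_induction with
      | zero => simp
      | add x y hx hy =>
        simp only [map_add, add_mul, mul_add, LinearMap.add_apply, TensorProduct.add_tmul, hx, hy]
      | tmul d e =>
        induction x using tensor_induction_right with
        | zero => simp
        | add x y hx hy => simp only [map_add, add_mul, LinearMap.add_apply, hx, hy]
        | tmul x y z => simp [Q.S_mul, mul_assoc]
  rw [h1, map_evα_Φ_mul_comul, flatDress]
  generalize Q.qS = q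
  induction q using tensor_induction with
  | zero => simp
  | add x y hx hy => simp only [map_add, mul_add, LinearMap.add_apply, hx, hy]
  | tmul a c => simp [mul_assoc]

/-- `a ⊗ b ⊗ c ↦ v(a) x v(b) ⊗ c`. -/
def sandwichMap (x : B) : H ⊗[k] (H ⊗[k] H) →ₗ[k] B ⊗[k] H :=
  mulMap ((TensorProduct.mk k B H).flip 1 ∘ₗ LinearMap.mulRight k x ∘ₗ v.toLinearMap)
    (TensorProduct.map v.toLinearMap LinearMap.id)

@[simp]
theorem sandwichMap_tmul (x : B) (a b c : H) :
    sandwichMap v x (a ⊗ₜ[k] (b ⊗ₜ[k] c)) = (v a * x * v b) ⊗ₜ c := by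
  simp [sandwichMap]

theorem dress_apply (b : B) : Q.dress v b = sandwichMap v b Q.elementD := by
  rw [dress, liftDress_apply, elementD_eq]
  generalize Q.Φ.inv = t
  induction t using tensor_induction_right with
  | zero => simp
  | add x y hx hy => simp only [map_add, mul_add, hx, hy]
  | tmul a c d =>
    simp only [liftMap_tmul, flatDress, twistedAct, LinearMap.comp_apply,
        AlgHom.toLinearMap_apply, qS, comulFst_tmul]
    generalize Q.comul a = u
    generalize Q.Φ.val = x
    induction u using tensor_induction with
    | zero => simp
    | add x y hx hy =>
      simp only [map_add, add_mul, mul_add, LinearMap.add_apply, TensorProduct.add_tmul, hx, hy]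
    | tmul e f =>
      induction x using tensor_induction_right with
      | zero => simp
      | add x y hx hy =>
        simp only [map_add, add_mul, LinearMap.add_apply, TensorProduct.add_tmul, hx, hy]
      | tmul x y z => simp [Q.S_mul, mul_assoc]

/-- Undressing pairs the last two legs of `elementD` through (·) β S(·), and that pairing collapses
to 1 ⊗ 1. -/
theorem undress_dress (b : B) : Q.undress v (Q.dress v b) = b := by
  rw [dress_apply]
  have h1 : ∀ t : H ⊗[k] (H ⊗[k] H), Q.undress v (sandwichMap v b t) =
      bimul (TensorProduct.map v.toLinearMap v.toLinearMap
        (TensorProduct.map LinearMap.id Q.evβ t)) b := by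
    intro t
    induction t using tensor_induction_right with
    | zero => simp
    | add x y hx hy => simp only [map_add, LinearMap.add_apply, hx, hy]
    | tmul x y z => simp [mul_assoc]
  rw [h1, map_evβ_elementD, Algebra.TensorProduct.one_def]
  simp

theorem undress_rightInvariant :
    RightInvariant Q.toQuasiBialgebra (comulMap Q.toQuasiBialgebra v) (Q.undress v) := by
  intro c h
  induction c using tensor_induction with
  | zero => simp
  | add x y hx hy => simp only [map_add, add_mul, smul_add, hx, hy]
  | tmul b l =>
    have h1 : ∀ t : H ⊗[k] H, Q.undress v ((b ⊗ₜ l) *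
        Algebra.TensorProduct.map v (AlgHom.id k H) t) = b * v (Q.evβ t) * v (Q.S l) := by
      intro t
      induction t using tensor_induction with
      | zero => simp
      | add x y hx hy => simp only [map_add, mul_add, add_mul, hx, hy]
      | tmul x y => simp [Q.S_mul, mul_assoc]
    rw [comulMap_apply, h1, Q.antipode_right]
    simp

theorem twistedAct_undress (h : H) (z : B ⊗[k] H) :
    Q.twistedAct v h (Q.undress v z) = Q.undress v (comulMap Q.toQuasiBialgebra v h * z) := by
  simp only [twistedAct, LinearMap.comp_apply, AlgHom.toLinearMap_apply, comulMap_apply]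
  generalize Q.comul h = t
  induction t using tensor_induction with
  | zero => simp
  | add x y hx hy => simp only [map_add, add_mul, LinearMap.add_apply, hx, hy]
  | tmul a c =>
    induction z using tensor_induction with
    | zero => simp
    | add x y hx hy => simp only [map_add, mul_add, hx, hy]
    | tmul d e => simp [Q.S_mul, mul_assoc]

theorem undress_one_tmul_mul (h : H) (z : B ⊗[k] H) :
    Q.undress v ((1 ⊗ₜ h) * z) = Q.undress v z * v (Q.S h) := by
  induction z using tensor_induction with
  | zero => simp
  | add x y hx hy => simp only [map_add, mul_add, add_mul, hx, hy]
  | tmul d e => simp [Q.S_mul, mul_assoc]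

theorem undress_tmul_one_mul (b : B) (z : B ⊗[k] H) :
    Q.undress v ((b ⊗ₜ 1) * z) = b * Q.undress v z := by
  induction z using tensor_induction with
  | zero => simp
  | add x y hx hy => simp only [map_add, mul_add, hx, hy]
  | tmul d e => simp [mul_assoc]

theorem dress_β : Q.dress v (v Q.β) = 1 := by
  rw [dress_apply]
  have h1 : ∀ t : H ⊗[k] (H ⊗[k] H), sandwichMap v (v Q.β) t =
      Algebra.TensorProduct.map v (AlgHom.id k H) ((TensorProduct.map (LinearMap.mul' k H ∘ₗ
        TensorProduct.map (LinearMap.mulRight k Q.β) LinearMap.id) LinearMap.id ∘ₗ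
        (TensorProduct.assoc k H H H).symm.toLinearMap) t) := by
    intro t
    induction t using tensor_induction_right with
    | zero => simp
    | add x y hx hy => simp only [map_add, hx, hy]
    | tmul x y z => simp
  rw [h1, map_mul_β_elementD, map_one]

/-- The last leg of `dress` b acts, under `undress`, as right multiplication by its antipode. The
remaining `undress` of `dress` c is c, so `elementD` with S on its last leg appears, which is
`elementP`. -/
theorem twistedMul_eq (b c : B) :
    Q.twistedMul v b c = Q.undress v (Q.dress v b * Q.dress v c) := by
  have h1 : ∀ z, Q.undress v (sandwichMap v b z * Q.dress v c) = bimul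
      (TensorProduct.map v.toLinearMap (bimul.flip c ∘ₗ TensorProduct.map v.toLinearMap
        v.toLinearMap) (TensorProduct.map LinearMap.id
          (TensorProduct.map LinearMap.id Q.S.toLinearMap) z)) b := by
    intro z
    induction z using tensor_induction_right with
    | zero => simp
    | add x y hx hy => simp only [map_add, add_mul, LinearMap.add_apply, hx, hy]
    | tmul x y z =>
      have h2 : (v x * b * v y) ⊗ₜ[k] z = ((v x * b * v y) ⊗ₜ[k] (1 : H)) * (1 ⊗ₜ z) := by simp
      rw [sandwichMap_tmul, h2, mul_assoc, undress_tmul_one_mul, undress_one_tmul_mul,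
        undress_dress]
      simp [mul_assoc]
  rw [dress_apply Q v b, h1, ← elementP_eq]
  rfl

section Universal

variable {M : Type*} [AddCommGroup M] [Module k M]
variable {v} {aM : H →ₗ[k] M →ₗ[k] M} {E : M →ₗ[k] B}

/-- Undressing gives E(p¹·m) v(p²). Sandwiching with q = `qS` and moving v(q¹) across E inserts
Δ(q¹) p (1 ⊗ q²), which is 1. -/
theorem flatDress_undress_liftDress (hM : ∀ m, aM 1 m = m)
    (hM' : ∀ g h m, aM (g * h) m = aM g (aM h m))
    (hE : Intertwines Q.toQuasiBialgebra aM v E) (m : M) :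
    Q.flatDress v (Q.undress v (liftDress Q.toQuasiBialgebra aM v E m)) = E m := by
  let F : H ⊗[k] H →ₗ[k] B := mulMap (E ∘ₗ aM.flip m) v.toLinearMap
  have h1 : Q.undress v (liftDress Q.toQuasiBialgebra aM v E m) = F Q.pR := by
    rw [liftDress_apply, pR]
    generalize Q.Φ.inv = t
    induction t using tensor_induction_right with
    | zero => simp
    | add x y hx hy => simp only [map_add, hx, hy]
    | tmul x y z => simp [F, mul_assoc]
  have h2 : ∀ q : H ⊗[k] H, bimul (TensorProduct.map v.toLinearMap v.toLinearMap q) (F Q.pR) =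
      F (mulMap (LinearMap.mulRight k Q.pR ∘ₗ Q.comul.toLinearMap)
        (TensorProduct.mk k H H 1) q) := by
    intro q
    generalize Q.pR = p
    induction q using tensor_induction with
    | zero => simp
    | add x y hx hy => simp only [map_add, LinearMap.add_apply, hx, hy]
    | tmul a c =>
      simp only [mulMap_tmul, LinearMap.comp_apply, TensorProduct.map_tmul, bimul_tmul,
        AlgHom.toLinearMap_apply, TensorProduct.mk_apply, LinearMap.mulRight_apply]
      induction p using tensor_induction with
      | zero => simp
      | add x y hx hy => simp only [map_add, add_mul, mul_add, hx, hy]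
      | tmul d e =>
        have h3 := hE a (aM d m)
        simp only [F, mulMap_tmul, LinearMap.comp_apply, LinearMap.flip_apply,
          AlgHom.toLinearMap_apply]
        rw [← mul_assoc, h3]
        generalize Q.comul a = u
        induction u using tensor_induction with
        | zero => simp
        | add x y hx hy => simp only [map_add, add_mul, hx, hy]
        | tmul f g => simp [hM', mul_assoc]
  rw [h1, flatDress, h2, comul_qS_mul_pR, Algebra.TensorProduct.one_def]
  simp [F, hM]

/-- Undressing a lift is H-linear, so the previous identity applies to every x¹·m. This is the
universal property of `dress`: each lift of an intertwining map into B factors through it, and the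
factor is obtained by undressing. -/
theorem dress_undress_liftDress (hM : ∀ m, aM 1 m = m)
    (hM' : ∀ g h m, aM (g * h) m = aM g (aM h m))
    (hE : Intertwines Q.toQuasiBialgebra aM v E) (m : M) :
    Q.dress v (Q.undress v (liftDress Q.toQuasiBialgebra aM v E m)) =
      liftDress Q.toQuasiBialgebra aM v E m := by
  have h1 : ∀ h, Q.twistedAct v h (Q.undress v (liftDress Q.toQuasiBialgebra aM v E m)) =
      Q.undress v (liftDress Q.toQuasiBialgebra aM v E (aM h m)) := fun h => by
    rw [twistedAct_undress,
      (hE.liftDress hM').apply_mul_right (Q.undress_rightInvariant v)]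
  have h2 : ∀ t, liftMap (Q.twistedAct v) v (Q.flatDress v)
      (Q.undress v (liftDress Q.toQuasiBialgebra aM v E m)) t = liftMap aM v E m t := by
    intro t
    induction t using tensor_induction_right with
    | zero => simp
    | add x y hx hy => simp only [map_add, hx, hy]
    | tmul x y z =>
      rw [liftMap_tmul, liftMap_tmul, h1, flatDress_undress_liftDress Q hM hM' hE]
  rw [dress, liftDress_apply, h2, liftDress_apply]

end Universal

/-- The product of two lifts is a lift from the tensor product module (`liftDress_dressMul`), so the
universal property gives it back after undressing; its undressing is the twisted product. -/
theorem dress_twistedMul (b c : B) : Q.dress v (Q.twistedMul v b c) =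
    dressMul Q.toQuasiBialgebra (Q.twistedAct v) (Q.twistedAct v)
      (comulMap Q.toQuasiBialgebra v) (Q.dress v) (Q.dress v) (b ⊗ₜ c) := by
  rw [twistedMul_eq, ← (Q.undress_rightInvariant v).dressMul (Q.twistedAct_one v)
    (Q.twistedAct_one v), dress, ← liftDress_dressMul (Q.twistedAct_mul v) (Q.twistedAct_mul v)
      (Q.flatDress_intertwines v)]
  exact Q.dress_undress_liftDress (tensorAct_one (Q.twistedAct_one v) (Q.twistedAct_one v))
    (tensorAct_mul (Q.twistedAct_mul v) (Q.twistedAct_mul v))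
    ((Q.flatDress_intertwines v).dressMul (Q.twistedAct_mul v) (Q.twistedAct_mul v)
      (Q.flatDress_intertwines v)) _

end QuasiHopfAlgebra

/-! ### The twisted coaction, and the twisted algebras as algebras in the category -/

namespace QuasiHopfAlgebra

open QuasiBialgebra

variable {k H : Type*} [Field k] [Ring H] [Algebra k H] (Q : QuasiHopfAlgebra k H)

theorem pRMap_eq (t : H ⊗[k] H) : Q.pRMap t =
    TensorProduct.map LinearMap.id Q.evβ (TensorProduct.assoc k H H H
        (Algebra.TensorProduct.map Q.comul (AlgHom.id k H) t) * Q.Φ.inv) := by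
  rw [pRMap, pR]
  induction t using TensorProduct.induction_on with
  | zero => simp
  | add x y hx hy => simp only [map_add, add_mul, hx, hy]
  | tmul a b =>
    simp only [LinearMap.comp_apply, mulMap_tmul,
      Algebra.TensorProduct.map_tmul, AlgHom.toLinearMap_apply, LinearMap.mulRight_apply,
      AlgHom.coe_id, id_eq, TensorProduct.mk_apply, LinearEquiv.coe_coe]
    generalize Q.comul a = c
    generalize Q.Φ.inv = x
    induction c using TensorProduct.induction_on with
    | zero => simp
    | add x y hx hy => simp only [map_add, add_mul, TensorProduct.add_tmul, hx, hy]
    | tmul c d =>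
      induction x using tensor_induction_right with
      | zero => simp
      | add x y hx hy => simp only [map_add, add_mul, mul_add, hx, hy]
      | tmul x y z => simp [Q.S_mul, mul_assoc]

/-- `x¹ ⊗ Δ(x²) p (1 ⊗ S(x³)) = Φ (Δ(p¹) ⊗ p²)`. -/
theorem map_pRMap_Φ_inv : TensorProduct.map LinearMap.id Q.pRMap Q.Φ.inv =
    Q.Φ.val * TensorProduct.assoc k H H H
      (Algebra.TensorProduct.map Q.comul (AlgHom.id k H) Q.pR) := by
  have h1 : ∀ t, TensorProduct.map LinearMap.id Q.pRMap t = TensorProduct.map LinearMap.id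
      (TensorProduct.map LinearMap.id Q.evβ) (Q.comulSnd t * inclTail Q.Φ.inv) := by
    intro t
    induction t using tensor_induction_right with
    | zero => simp
    | add x y hx hy => simp only [map_add, add_mul, hx, hy]
    | tmul a b c => simp [pRMap_eq]
  have h2 : Q.comulSnd Q.Φ.inv * inclTail Q.Φ.inv =
      inclInit Q.Φ.val * Q.comulFst Q.Φ.inv * Q.comulThd Q.Φ.inv := by
    rw [inclInit_mul_comulFst_inv, mul_assoc, mul_assoc, ← map_mul, Units.val_inv, map_one, mul_one]
  have h3 : ∀ t u, TensorProduct.map LinearMap.id (TensorProduct.map LinearMap.id Q.evβ)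
      (inclInit u * Q.comulFst t) = u * TensorProduct.assoc k H H H
      (Algebra.TensorProduct.map Q.comul (AlgHom.id k H) (TensorProduct.map LinearMap.id Q.evβ t)) := by
    intro t u
    induction t using tensor_induction_right with
    | zero => simp
    | add x y hx hy => simp only [map_add, mul_add, hx, hy]
    | tmul a b c =>
      simp only [comulFst_tmul, TensorProduct.map_tmul, Algebra.TensorProduct.map_tmul,
        LinearMap.id_apply, AlgHom.coe_id, id_eq]
      generalize Q.comul a = w
      induction w using tensor_induction with
      | zero => simp
      | add x y hx hy => simp only [map_add, mul_add, TensorProduct.add_tmul, hx, hy]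
      | tmul d e =>
        induction u using tensor_induction_right with
        | zero => simp
        | add x y hx hy => simp only [map_add, add_mul, hx, hy]
        | tmul x y z => simp [mul_assoc]
  rw [h1, h2]
  refine ((Q.evβ_equivariant.tmul_left (A := H)).tmul_left (A := H) _ _).trans ?_
  rw [Q.isCounital_Φ_inv.map_right, mul_one, h3, pR]

/-- `(id ⊗ Δ)(Δ(q¹)) (x¹ ⊗ Δ(x²) p (1 ⊗ S(x³) q²)) = Φ` for `q = X¹ ⊗ S(X²) α X³`. -/
theorem comul_qS_mul_map_pRMap :
    mulMap (LinearMap.mulRight k (TensorProduct.map LinearMap.id Q.pRMap Q.Φ.inv) ∘ₗ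
        (Algebra.TensorProduct.map (AlgHom.id k H) Q.comul).toLinearMap ∘ₗ Q.comul.toLinearMap)
      (TensorProduct.mk k H (H ⊗[k] H) 1 ∘ₗ TensorProduct.mk k H H 1) Q.qS = Q.Φ.val := by
  have h1 : ∀ q : H ⊗[k] H, mulMap
      (LinearMap.mulRight k (TensorProduct.map LinearMap.id Q.pRMap Q.Φ.inv) ∘ₗ
        (Algebra.TensorProduct.map (AlgHom.id k H) Q.comul).toLinearMap ∘ₗ Q.comul.toLinearMap)
      (TensorProduct.mk k H (H ⊗[k] H) 1 ∘ₗ TensorProduct.mk k H H 1) q =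
      Q.Φ.val * TensorProduct.assoc k H H H (Algebra.TensorProduct.map Q.comul (AlgHom.id k H)
        (mulMap (LinearMap.mulRight k Q.pR ∘ₗ Q.comul.toLinearMap)
          (TensorProduct.mk k H H 1) q)) := by
    intro q
    induction q using tensor_induction with
    | zero => simp
    | add x y hx hy => simp only [map_add, mul_add, hx, hy]
    | tmul a c =>
      have h2 : TensorProduct.assoc k H H H (Algebra.TensorProduct.map Q.comul (AlgHom.id k H)
          (1 ⊗ₜ c)) = 1 ⊗ₜ (1 ⊗ₜ c) := by
        simp [Algebra.TensorProduct.one_def]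
      simp only [mulMap_tmul, LinearMap.comp_apply, LinearMap.mulRight_apply, TensorProduct.mk_apply,
        AlgHom.toLinearMap_apply, map_mul, assoc_mul]
      rw [map_pRMap_Φ_inv, h2, ← mul_assoc, ← mul_assoc, ← Φ_mul_comul, mul_assoc, mul_assoc,
        mul_assoc, mul_assoc]
  rw [h1, comul_qS_mul_pR, map_one]
  exact mul_one _

variable {B : Type*} [Ring B] [Algebra k B] (v : H →ₐ[k] B) (lam : B →ₐ[k] H ⊗[k] B)

/-- `a ⊗ b ⊗ x ↦ (a ⊗ v(b)) y (1 ⊗ v(f(x)))`. -/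
def outerMap {A : Type*} [AddCommGroup A] [Module k A] (f : A →ₗ[k] H) (y : H ⊗[k] B) :
    H ⊗[k] (H ⊗[k] A) →ₗ[k] H ⊗[k] B :=
  mulMap (LinearMap.mulRight k y ∘ₗ (Algebra.TensorProduct.map (AlgHom.id k H) v).toLinearMap)
    (TensorProduct.mk k H B 1 ∘ₗ v.toLinearMap ∘ₗ f) ∘ₗ
    (TensorProduct.assoc k H H A).symm.toLinearMap

@[simp]
theorem outerMap_tmul {A : Type*} [AddCommGroup A] [Module k A] (f : A →ₗ[k] H) (y : H ⊗[k] B)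
    (a b : H) (x : A) :
    outerMap v f y (a ⊗ₜ (b ⊗ₜ x)) = (a ⊗ₜ v b) * y * (1 ⊗ₜ v (f x)) := by
  simp [outerMap]

theorem map_undress_mapMiddle_mul (t : H ⊗[k] (H ⊗[k] H)) (z : H ⊗[k] (B ⊗[k] H)) :
    TensorProduct.map LinearMap.id (Q.undress v) (mapMiddle v t * z) =
      outerMap v Q.S.toLinearMap (TensorProduct.map LinearMap.id (Q.undress v) z) t := by
  induction t using tensor_induction_right with
  | zero => simp
  | add x y hx hy => simp only [map_add, add_mul, hx, hy]
  | tmul a b c =>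
    induction z using tensor_induction_right with
    | zero => simp
    | add x y hx hy =>
      simp only [outerMap_tmul] at hx hy ⊢
      simp only [map_add, mul_add, add_mul, hx, hy]
    | tmul x y z => simp [Q.S_mul, mul_assoc]

theorem map_undress_mul_mapMiddle (y : H ⊗[k] B) (d : H) (t : H ⊗[k] (H ⊗[k] H)) :
    TensorProduct.map LinearMap.id (Q.undress v)
      (TensorProduct.assoc k H B H (y ⊗ₜ d) * mapMiddle v t) =
      y * Algebra.TensorProduct.map (AlgHom.id k H) v
        (TensorProduct.map LinearMap.id Q.evβ t * (1 ⊗ₜ Q.S d)) := by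
  induction t using tensor_induction_right with
  | zero => simp
  | add x y hx hy => simp only [map_add, add_mul, mul_add, hx, hy]
  | tmul a b c =>
    induction y using tensor_induction with
    | zero => simp
    | add x y hx hy => simp only [map_add, TensorProduct.add_tmul, add_mul, hx, hy]
    | tmul x y => simp [Q.S_mul, mul_assoc]

variable {v lam}

/-- In the form `elementK_eq` the coaction has no twist left. Its outer Φ is the left factor of the
conjugation, and its p comes from the right factor Φ⁻¹ by evaluation with β; `elementD` inside is
the dressing of b. -/
theorem twistedCoact_eq (hC : IsComoduleAlgebra Q.toQuasiBialgebra v lam) (b : B) :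
    Q.twistedCoact v lam.toLinearMap b = TensorProduct.map LinearMap.id (Q.undress v)
      (coactConj Q.toQuasiBialgebra v lam (Q.dress v b)) := by
  rw [coactConj_apply, mul_assoc, map_undress_mapMiddle_mul, dress_apply, twistedCoact, elementK_eq]
  have h1 : ∀ t d : H ⊗[k] (H ⊗[k] H), bimul
      (TensorProduct.map (TensorProduct.map LinearMap.id v.toLinearMap)
        (TensorProduct.map LinearMap.id v.toLinearMap)
        (mulMap (LinearMap.mulRight k (TensorProduct.map Q.comul.toLinearMap Q.pRMap d) ∘ₗ
          (TensorProduct.mk k (H ⊗[k] H) (H ⊗[k] H)).flip 1)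
          (TensorProduct.mk k (H ⊗[k] H) (H ⊗[k] H) 1 ∘ₗ TensorProduct.mk k H H 1 ∘ₗ
            Q.S.toLinearMap) ((TensorProduct.assoc k H H H).symm t))) (lam b) =
      outerMap v Q.S.toLinearMap (TensorProduct.map LinearMap.id (Q.undress v)
        (coactExt lam (sandwichMap v b d) * mapMiddle v Q.Φ.inv)) t := by
    intro t d
    induction t using tensor_induction_right with
    | zero => simp
    | add x y hx hy => simp only [map_add, LinearMap.add_apply, hx, hy]
    | tmul x y z =>
      rw [outerMap_tmul]
      induction d using tensor_induction_right with
      | zero => simp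
      | add d e hd he =>
        simp only [TensorProduct.assoc_symm_tmul, mulMap_tmul, LinearMap.comp_apply,
          LinearMap.mulRight_apply] at hd he ⊢
        simp only [map_add, mul_add, add_mul, LinearMap.add_apply, hd, he]
      | tmul p q r =>
        have h2 : ∀ u : H ⊗[k] H, TensorProduct.map LinearMap.id v.toLinearMap u =
          Algebra.TensorProduct.map (AlgHom.id k H) v u := fun _ => rfl
        rw [sandwichMap_tmul, coactExt_tmul, map_undress_mul_mapMiddle, ← pR, map_mul lam,
          map_mul lam, hC.lam_v, hC.lam_v]
        simp only [TensorProduct.assoc_symm_tmul, mulMap_tmul, LinearMap.comp_apply,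
          LinearMap.mulRight_apply, TensorProduct.map_tmul, AlgHom.toLinearMap_apply,
          LinearMap.flip_apply, TensorProduct.mk_apply, Algebra.TensorProduct.tmul_mul_tmul,
          mul_one, one_mul, bimul_tmul, h2, pRMap_tmul, map_mul, Algebra.TensorProduct.map_tmul,
          AlgHom.coe_id, id_eq, LinearEquiv.coe_coe, map_one, mul_assoc]
  exact h1 _ _

/-- The Φ of `dressCoact`, the Φ inside `qS`, the coproduct in the twisted action and the outer Φ of
the coaction assemble into one side of the pentagon. On the other side (id ⊗ id ⊗ Δ)(Φ) is absorbed
by α, and only Δ(q¹) to the left of y and q² to its right survive. -/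
theorem dressCoact_flatDress (y : H ⊗[k] B) :
    dressCoact Q.toQuasiBialgebra (Q.twistedAct v) v (Q.flatDress v)
      (outerMap v Q.S.toLinearMap y Q.Φ.val) =
    mulMap (LinearMap.mulRight k y ∘ₗ (Algebra.TensorProduct.map (AlgHom.id k H) v).toLinearMap ∘ₗ
      Q.comul.toLinearMap) (TensorProduct.mk k H B 1 ∘ₗ v.toLinearMap) Q.qS := by
  have h1 : ∀ t, dressCoact Q.toQuasiBialgebra (Q.twistedAct v) v (Q.flatDress v)
      (outerMap v Q.S.toLinearMap y t) = outerMap v Q.evα y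
        (inclTail Q.Φ.val * Q.comulSnd Q.Φ.val * inclInit t) := by
    intro t
    induction t using tensor_induction_right with
    | zero => simp
    | add x y hx hy => simp only [map_add, mul_add, hx, hy]
    | tmul x1 x2 x3 =>
      rw [outerMap_tmul]
      induction y using tensor_induction with
      | zero => simp [outerMap, mulMap]
      | add z w hz hw =>
        have h2 : ∀ t : H ⊗[k] (H ⊗[k] (H ⊗[k] H)), outerMap v Q.evα (z + w) t =
            outerMap v Q.evα z t + outerMap v Q.evα w t := by
          intro t
          induction t using tensor_induction_right_right with
          | zero => simp
          | add x y hx hy => simp only [map_add, hx, hy]; abel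
          | tmul a b c d => simp [mul_add, add_mul]
        rw [h2, mul_add, add_mul, map_add, hz, hw]
      | tmul g c =>
        simp only [Algebra.TensorProduct.tmul_mul_tmul, mul_one]
        rw [dressCoact_tmul]
        have h2 : ∀ t, TensorProduct.map (LinearMap.mulRight k (x1 * g))
            (mulMap (Q.flatDress v ∘ₗ (Q.twistedAct v).flip (v x2 * c * v (Q.S x3)))
              v.toLinearMap) t = outerMap v Q.evα (g ⊗ₜ c)
                (inclTail Q.Φ.val * Q.comulSnd t * inclInit (x1 ⊗ₜ (x2 ⊗ₜ x3))) := by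
          intro t
          induction t using tensor_induction_right with
          | zero => simp
          | add x y hx hy => simp only [map_add, mul_add, add_mul, hx, hy]
          | tmul y1 y2 y3 =>
            simp only [TensorProduct.map_tmul, mulMap_tmul, LinearMap.comp_apply,
              LinearMap.flip_apply, flatDress, twistedAct, AlgHom.toLinearMap_apply, qS,
              comulSnd_tmul, inclTail_apply, inclInit_tmul, LinearMap.mulRight_apply]
            generalize Q.comul y2 = u
            generalize Q.Φ.val = z
            induction u using tensor_induction with
            | zero => simp
            | add x y hx hy =>
              simp only [map_add, add_mul, mul_add, LinearMap.add_apply, TensorProduct.add_tmul,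
                TensorProduct.tmul_add, hx, hy]
            | tmul d e =>
              induction z using tensor_induction_right with
              | zero => simp
              | add x y hx hy =>
                simp only [map_add, add_mul, LinearMap.add_apply, TensorProduct.tmul_add, hx, hy]
              | tmul x y z => simp [Q.S_mul, mul_assoc]
        exact h2 _
  have h2 : inclTail Q.Φ.val * Q.comulSnd Q.Φ.val * inclInit Q.Φ.val =
      Q.comulThd Q.Φ.val * Q.comulFst Q.Φ.val := Q.pentagon
  have h3 : ∀ t : H ⊗[k] (H ⊗[k] (H ⊗[k] H)), outerMap v Q.evα y t =
      outerMap v LinearMap.id y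
        (TensorProduct.map LinearMap.id (TensorProduct.map LinearMap.id Q.evα) t) := by
    intro t
    induction t using tensor_induction_right_right with
    | zero => simp
    | add x y hx hy => simp only [map_add, hx, hy]
    | tmul a b c d => simp
  have h4 : TensorProduct.map LinearMap.id (TensorProduct.map LinearMap.id Q.evα)
      (Q.comulThd Q.Φ.val * Q.comulFst Q.Φ.val) =
      TensorProduct.map LinearMap.id (TensorProduct.map LinearMap.id Q.evα)
        (Q.comulFst Q.Φ.val) := by
    refine ((Q.evα_equivariant.tmul_left (A := H)).tmul_left (A := H) _ _).trans ?_
    rw [Q.isCounital_Φ.map_right, one_mul]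
  rw [h1, h2, h3, h4, ← h3, qS]
  generalize Q.Φ.val = t
  induction t using tensor_induction_right with
  | zero => simp
  | add x y hx hy => simp only [map_add, hx, hy]
  | tmul x1 x2 x3 =>
    simp only [comulFst_tmul, TensorProduct.map_tmul, mulMap_tmul, LinearMap.comp_apply,
      AlgHom.toLinearMap_apply, LinearMap.id_apply, LinearMap.mulRight_apply]
    generalize Q.comul x1 = u
    induction u using tensor_induction with
    | zero => simp
    | add x y hx hy => simp only [map_add, add_mul, TensorProduct.add_tmul, hx, hy]
    | tmul d e => simp

/-- Put F(a ⊗ b' ⊗ c) = lam(D(a·b)) (b' ⊗ v(c)) with D the flat dressing. The left side is F of (id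
⊗ `pRMap`)(Φ⁻¹), surrounded by Δ(q¹) and q². Both factors can be moved inside F, and
`comul_qS_mul_map_pRMap` shows that its argument then equals Φ. -/
theorem flatDress_cointertwines (hC : IsComoduleAlgebra Q.toQuasiBialgebra v lam) :
    Cointertwines Q.toQuasiBialgebra (Q.twistedAct v) (Q.twistedCoact v lam.toLinearMap) v lam
      (Q.flatDress v) := by
  intro b
  rw [twistedCoact_eq Q hC, coactConj_apply, mul_assoc, map_undress_mapMiddle_mul,
    dressCoact_flatDress]
  let F : H ⊗[k] (H ⊗[k] H) →ₗ[k] H ⊗[k] B :=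
    mulMap (lam.toLinearMap ∘ₗ Q.flatDress v ∘ₗ (Q.twistedAct v).flip b)
      (TensorProduct.map LinearMap.id v.toLinearMap)
  have h1 : TensorProduct.map LinearMap.id (Q.undress v)
      (coactExt lam (Q.dress v b) * mapMiddle v Q.Φ.inv) =
      F (TensorProduct.map LinearMap.id Q.pRMap Q.Φ.inv) := by
    have h2 : ∀ t, TensorProduct.map LinearMap.id (Q.undress v)
        (coactExt lam (liftMap (Q.twistedAct v) v (Q.flatDress v) b t) * mapMiddle v Q.Φ.inv) =
        F (TensorProduct.map LinearMap.id Q.pRMap t) := by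
      intro t
      induction t using tensor_induction_right with
      | zero => simp
      | add x y hx hy => simp only [map_add, add_mul, hx, hy]
      | tmul x y z =>
        have h2 : ∀ u : H ⊗[k] H, TensorProduct.map LinearMap.id v.toLinearMap u =
          Algebra.TensorProduct.map (AlgHom.id k H) v u := fun _ => rfl
        rw [liftMap_tmul, coactExt_tmul, map_undress_mul_mapMiddle, ← pR, map_mul lam, hC.lam_v,
          TensorProduct.map_tmul, mulMap_tmul, h2, pRMap_tmul]
        simp only [map_mul, mul_assoc]
        rfl
    rw [dress, liftDress_apply, h2]
  have h3 : ∀ h t, Algebra.TensorProduct.map (AlgHom.id k H) v (Q.comul h) * F t =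
      F (Algebra.TensorProduct.map (AlgHom.id k H) Q.comul (Q.comul h) * t) := by
    intro h t
    induction t using TensorProduct.induction_on with
    | zero => simp
    | add x y hx hy => simp only [map_add, mul_add, hx, hy]
    | tmul a t =>
      simp only [F, mulMap_tmul, LinearMap.comp_apply, LinearMap.flip_apply,
        AlgHom.toLinearMap_apply]
      rw [← hC.lam_v, ← mul_assoc, ← map_mul, Q.flatDress_intertwines v h]
      generalize Q.comul h = u
      induction u using tensor_induction with
      | zero => simp
      | add x y hx hy => simp only [map_add, add_mul, hx, hy]
      | tmul c d =>
        simp only [mulMap_tmul, LinearMap.comp_apply, LinearMap.flip_apply, map_mul,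
          AlgHom.toLinearMap_apply, Algebra.TensorProduct.map_tmul, AlgHom.coe_id, id_eq,
          Algebra.TensorProduct.tmul_mul_tmul, hC.lam_v, mul_assoc, twistedAct_mul]
        exact congrArg _
          (map_mul (Algebra.TensorProduct.map (AlgHom.id k H) v) (Q.comul d) t).symm
  have h4 : ∀ t c, F t * (1 ⊗ₜ v c) = F (t * (1 ⊗ₜ (1 ⊗ₜ c))) := by
    intro t c
    induction t using tensor_induction_right with
    | zero => simp
    | add x y hx hy => simp only [map_add, add_mul, hx, hy]
    | tmul x y z => simp [F, mul_assoc]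
  have h5 : ∀ q W, mulMap (LinearMap.mulRight k (F W) ∘ₗ
      (Algebra.TensorProduct.map (AlgHom.id k H) v).toLinearMap ∘ₗ Q.comul.toLinearMap)
      (TensorProduct.mk k H B 1 ∘ₗ v.toLinearMap) q =
      F (mulMap (LinearMap.mulRight k W ∘ₗ
        (Algebra.TensorProduct.map (AlgHom.id k H) Q.comul).toLinearMap ∘ₗ Q.comul.toLinearMap)
        (TensorProduct.mk k H (H ⊗[k] H) 1 ∘ₗ TensorProduct.mk k H H 1) q) := by
    intro q W
    induction q using tensor_induction with
    | zero => simp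
    | add x y hx hy => simp only [map_add, hx, hy]
    | tmul a c =>
      simp only [mulMap_tmul, LinearMap.comp_apply, LinearMap.mulRight_apply,
        AlgHom.toLinearMap_apply, TensorProduct.mk_apply]
      rw [h3, h4]
  rw [h1, h5, comul_qS_mul_map_pRMap]

/-- Both sides are the undressed coaction of (v(h₁) ⊗ h₂) `dress`(b): on one side lam is
multiplicative, on the other v(h) is first moved across `dress`. Compatibility is proved before the
Yetter–Drinfeld axioms because lifting the cointertwining relation needs it. -/
theorem twisted_compat (hC : IsComoduleAlgebra Q.toQuasiBialgebra v lam) (h : H) (b : B) :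
    tensorAct Q.toQuasiBialgebra regAct (Q.twistedAct v) h
        (Q.twistedCoact v lam.toLinearMap b) =
      coactMul (Q.twistedCoact v lam.toLinearMap)
        (TensorProduct.map ((Q.twistedAct v).flip b) LinearMap.id (Q.comul h)) := by
  have hT := hC.coactConj
  have h1 : tensorAct Q.toQuasiBialgebra regAct (Q.twistedAct v) h
        (Q.twistedCoact v lam.toLinearMap b) = TensorProduct.map LinearMap.id (Q.undress v)
      (coactConj Q.toQuasiBialgebra v lam
        (comulMap Q.toQuasiBialgebra v h * Q.dress v b)) := by
    rw [twistedCoact_eq Q hC, map_mul, hT.lam_v, tensorAct, LinearMap.comp_apply,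
      AlgHom.toLinearMap_apply]
    generalize Q.comul h = u
    generalize coactConj Q.toQuasiBialgebra v lam (Q.dress v b) = z
    induction u using tensor_induction with
    | zero => simp
    | add x y hx hy => simp only [map_add, add_mul, LinearMap.add_apply, hx, hy]
    | tmul c d =>
      induction z using TensorProduct.induction_on with
      | zero => simp
      | add x y hx hy => simp only [map_add, mul_add, hx, hy]
      | tmul g z => simp [twistedAct_undress]
  rw [h1, dress, (Q.flatDress_intertwines v).liftDress (Q.twistedAct_mul v)]
  generalize Q.comul h = u
  induction u using tensor_induction with
  | zero => simp
  | add x y hx hy => simp only [map_add, hx, hy]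
  | tmul c d =>
    simp only [mulMap_tmul, LinearMap.comp_apply, LinearMap.flip_apply, AlgHom.toLinearMap_apply,
      TensorProduct.map_tmul, LinearMap.id_apply, coactMul_tmul, map_mul]
    rw [(Q.undress_rightInvariant v).map_mul_lam_v hT, twistedCoact_eq Q hC, ← dress]
    generalize coactConj Q.toQuasiBialgebra v lam (Q.dress v _) = z
    induction z using TensorProduct.induction_on with
    | zero => simp
    | add x y hx hy => simp only [map_add, add_mul, hx, hy]
    | tmul g z => simp

theorem twistedAlgebra_isDressing (hC : IsComoduleAlgebra Q.toQuasiBialgebra v lam) :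
    YDAlgebraData.IsDressing Q.toQuasiBialgebra (comulMap Q.toQuasiBialgebra v)
      (coactConj Q.toQuasiBialgebra v lam) (Q.twistedAlgebra v lam.toLinearMap) (Q.dress v) where
  intertwines := (Q.flatDress_intertwines v).liftDress (Q.twistedAct_mul v)
  cointertwines := (Q.flatDress_cointertwines hC).liftDress (Q.twistedAct_mul v)
    (Q.twisted_compat hC) hC (Q.flatDress_intertwines v)
  map_mul := fun a b => by
    refine Eq.trans ?_ (Q.dress_twistedMul v a b)
    simp [twistedAlgebra]
  map_one := Q.dress_β v

theorem twistedAlgebra_isAlgebra (hC : IsComoduleAlgebra Q.toQuasiBialgebra v lam) :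
    (Q.twistedAlgebra v lam.toLinearMap).IsAlgebra Q.toQuasiBialgebra :=
  (Q.twistedAlgebra_isDressing hC).isAlgebra hC.coactConj (Q.undress_rightInvariant v)
    (Q.undress_dress v)

theorem comulMap_id : comulMap Q.toQuasiBialgebra (AlgHom.id k H) = Q.comul := by
  ext h
  rw [comulMap_apply, Algebra.TensorProduct.map_id]
  rfl

theorem coactConj_id :
    (coactConj Q.toQuasiBialgebra (AlgHom.id k H) Q.comul).toLinearMap = Q.squareCoact := by
  refine LinearMap.ext fun z => ?_
  have h1 : mapMiddle (AlgHom.id k H) = AlgHom.id k (H ⊗[k] (H ⊗[k] H)) := by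
    rw [mapMiddle, Algebra.TensorProduct.map_id, Algebra.TensorProduct.map_id]
  rw [AlgHom.toLinearMap_apply, coactConj_apply, h1]
  rfl

/-- The coaction prescribed on H ⊗ H is the extension to H ⊗ H of the comodule algebra H with
coaction Δ, so no new verification is needed. -/
theorem isComoduleAlgebra_square : IsComoduleAlgebra Q.toQuasiBialgebra Q.comul
    (coactConj Q.toQuasiBialgebra (AlgHom.id k H) Q.comul) := by
  have := (isComoduleAlgebra_self Q.toQuasiBialgebra).coactConj
  rwa [comulMap_id] at this

theorem H₀_isAlgebra : Q.H₀.IsAlgebra Q.toQuasiBialgebra :=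
  Q.twistedAlgebra_isAlgebra (isComoduleAlgebra_self Q.toQuasiBialgebra)

theorem squareΔ_eq : Q.squareΔ = Q.twistedAlgebra Q.comul
    (coactConj Q.toQuasiBialgebra (AlgHom.id k H) Q.comul).toLinearMap := by
  rw [coactConj_id, squareΔ]

theorem squareΔ_isAlgebra : Q.squareΔ.IsAlgebra Q.toQuasiBialgebra := by
  rw [squareΔ_eq]
  exact Q.twistedAlgebra_isAlgebra Q.isComoduleAlgebra_square

end QuasiHopfAlgebra

open QuasiBialgebra

/-! ### Transport of dressings along maps of comodule algebras -/

section Functoriality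

variable {k H : Type*} [Field k] [Ring H] [Algebra k H] {Q : QuasiBialgebra k H}
variable {C C' : Type*} [Ring C] [Algebra k C] [Ring C'] [Algebra k C']
variable {M N : Type*} [AddCommGroup M] [Module k M] [AddCommGroup N] [Module k N]
variable {aM : H →ₗ[k] M →ₗ[k] M} {cM : M →ₗ[k] H ⊗[k] M} {aN : H →ₗ[k] N →ₗ[k] N}
  {v : H →ₐ[k] C} {v' : H →ₐ[k] C'} {lam : C →ₐ[k] H ⊗[k] C} {lam' : C' →ₐ[k] H ⊗[k] C'}
  {D : M →ₗ[k] C} {D' : N →ₗ[k] C} {f : C →ₐ[k] C'}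

theorem Intertwines.comp (hD : Intertwines Q aM v D) (hv : ∀ h, f (v h) = v' h) :
    Intertwines Q aM v' (f.toLinearMap ∘ₗ D) := by
  intro h m
  simp only [LinearMap.comp_apply, AlgHom.toLinearMap_apply]
  rw [← hv, ← map_mul, hD]
  generalize Q.comul h = u
  induction u using tensor_induction with
  | zero => simp
  | add x y hx hy => simp only [map_add, hx, hy]
  | tmul a b => simp [hv]

theorem Cointertwines.comp (hD : Cointertwines Q aM cM v lam D) (hv : ∀ h, f (v h) = v' h)
    (hlam : ∀ c, lam' (f c) = Algebra.TensorProduct.map (AlgHom.id k H) f (lam c)) :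
    Cointertwines Q aM cM v' lam' (f.toLinearMap ∘ₗ D) := by
  intro m
  have h1 : ∀ w, dressCoact Q aM v' (f.toLinearMap ∘ₗ D) w =
      Algebra.TensorProduct.map (AlgHom.id k H) f (dressCoact Q aM v D w) := by
    intro w
    induction w using tensor_induction with
    | zero => simp
    | add x y hx hy => simp only [map_add, hx, hy]
    | tmul g m =>
      rw [dressCoact_tmul, dressCoact_tmul]
      generalize Q.Φ.val = t
      induction t using tensor_induction_right with
      | zero => simp
      | add x y hx hy => simp only [map_add, hx, hy]
      | tmul a b c => simp [hv]
  rw [h1, hD]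
  generalize Q.Φ.val = t
  induction t using tensor_induction_right with
  | zero => simp
  | add x y hx hy => simp only [map_add, hx, hy]
  | tmul a b c => simp [hv, hlam]

theorem dressMul_comp (hv : ∀ h, f (v h) = v' h) (w : M ⊗[k] N) :
    dressMul Q aM aN v' (f.toLinearMap ∘ₗ D) (f.toLinearMap ∘ₗ D') w =
      f (dressMul Q aM aN v D D' w) := by
  induction w using tensor_induction with
  | zero => simp
  | add x y hx hy => simp only [map_add, hx, hy]
  | tmul m n =>
    rw [dressMul_tmul, dressMul_tmul]
    generalize Q.Φ.val = t
    induction t using tensor_induction_right with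
    | zero => simp
    | add x y hx hy => simp only [map_add, hx, hy]
    | tmul a b c => simp [hv]

theorem liftDress_comp (hv : ∀ h, f (v h) = v' h) :
    liftDress Q aM v' (f.toLinearMap ∘ₗ D) =
      (Algebra.TensorProduct.map f (AlgHom.id k H)).toLinearMap ∘ₗ liftDress Q aM v D := by
  refine LinearMap.ext fun m => ?_
  rw [liftDress_apply, LinearMap.comp_apply, liftDress_apply]
  generalize Q.Φ.inv = t
  induction t using tensor_induction_right with
  | zero => simp
  | add x y hx hy => simp only [map_add, hx, hy]
  | tmul a b c => simp [hv]

theorem coactConj_comp (hv : ∀ h, f (v h) = v' h)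
    (hlam : ∀ c, lam' (f c) = Algebra.TensorProduct.map (AlgHom.id k H) f (lam c))
    (z : C ⊗[k] H) : coactConj Q v' lam' (Algebra.TensorProduct.map f (AlgHom.id k H) z) =
      Algebra.TensorProduct.map (AlgHom.id k H)
        (Algebra.TensorProduct.map f (AlgHom.id k H)) (coactConj Q v lam z) := by
  have h1 : ∀ t, mapMiddle v' t = Algebra.TensorProduct.map (AlgHom.id k H)
        (Algebra.TensorProduct.map f (AlgHom.id k H)) (mapMiddle v t) := by
    intro t
    induction t using tensor_induction_right with
    | zero => simp
    | add x y hx hy => simp only [map_add, hx, hy]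
    | tmul a b c => simp [hv]
  rw [coactConj_apply, coactConj_apply, map_mul, map_mul, h1, h1]
  congr 2
  induction z using tensor_induction with
  | zero => simp
  | add x y hx hy => simp only [map_add, hx, hy]
  | tmul c h =>
    rw [Algebra.TensorProduct.map_tmul, coactExt_tmul, coactExt_tmul, hlam]
    generalize lam c = u
    induction u using tensor_induction with
    | zero => simp
    | add x y hx hy => simp only [map_add, TensorProduct.add_tmul, hx, hy]
    | tmul a b => simp

end Functoriality

/-! ### Associativity constraints under a right invariant map -/

section Constraint

variable {k H : Type*} [Field k] [Ring H] [Algebra k H] {Q : QuasiBialgebra k H}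
variable {C : Type*} [Ring C] [Algebra k C]
variable {M N P R : Type*} [AddCommGroup M] [Module k M] [AddCommGroup N] [Module k N]
  [AddCommGroup P] [Module k P] [AddCommGroup R] [Module k R]
variable {aM : H →ₗ[k] M →ₗ[k] M} {aN : H →ₗ[k] N →ₗ[k] N} {aP : H →ₗ[k] P →ₗ[k] P}
  {aR : H →ₗ[k] R →ₗ[k] R}
  {v : H →ₐ[k] C} {D₁ : M →ₗ[k] C} {D₂ : N →ₗ[k] C} {D₃ : P →ₗ[k] C} {D₄ : R →ₗ[k] C}
  {V : Type*} [AddCommGroup V] [Module k V] {κ : C →ₗ[k] V}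

theorem associator_associatorInv (hM : ∀ m, aM 1 m = m)
    (hM' : ∀ g h m, aM (g * h) m = aM g (aM h m)) (hN : ∀ n, aN 1 n = n)
    (hN' : ∀ g h n, aN (g * h) n = aN g (aN h n)) (hP : ∀ p, aP 1 p = p)
    (hP' : ∀ g h p, aP (g * h) p = aP g (aP h p)) (t : M ⊗[k] (N ⊗[k] P)) :
    associator Q aM aN aP (associatorInv Q aM aN aP t) = t := by
  simp only [associator, associatorInv, LinearMap.comp_apply, LinearEquiv.coe_coe,
    LinearEquiv.apply_symm_apply]
  have h1 : ∀ x y : H ⊗[k] (H ⊗[k] H), TensorProduct.map₂ aM (TensorProduct.map₂ aN aP) x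
      (TensorProduct.map₂ aM (TensorProduct.map₂ aN aP) y t) =
      TensorProduct.map₂ aM (TensorProduct.map₂ aN aP) (x * y) t := by
    intro x y
    induction t using tensor_induction_right with
    | zero => simp
    | add t u ht hu => simp only [map_add, ht, hu]
    | tmul m n p =>
      induction x using tensor_induction_right with
      | zero => simp
      | add a b ha hb => simp only [map_add, add_mul, LinearMap.add_apply, ha, hb]
      | tmul a b c =>
        induction y using tensor_induction_right with
        | zero => simp
        | add a b ha hb => simp only [map_add, mul_add, LinearMap.add_apply, ha, hb]
        | tmul d e f => simp [hM', hN', hP']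
  rw [h1, Units.val_inv, Algebra.TensorProduct.one_def, Algebra.TensorProduct.one_def]
  clear h1
  induction t using tensor_induction_right with
  | zero => simp
  | add t u ht hu => simp only [map_add, ht, hu]
  | tmul m n p => simp [hM, hN, hP]

theorem RightInvariant.mulLeft (hκ : RightInvariant Q v κ) (c : C) :
    RightInvariant Q v (κ ∘ₗ LinearMap.mulLeft k c) := by
  intro c' h
  simp [← mul_assoc, hκ _ h]

/-- Under κ the factor D₃(X³·p) may be replaced by v(X³) D₃(p), and then the first two factors with
v(X³) form `dressMul`. Constraints in the category thus turn into rebracketings in the associative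
algebra C. -/
theorem RightInvariant.mulMap_associator (hκ : RightInvariant Q v κ)
    (hD₃ : Intertwines Q aP v D₃) (c : C) (t : (M ⊗[k] N) ⊗[k] P) :
    κ (c * mulMap D₁ (mulMap D₂ D₃) (associator Q aM aN aP t)) =
      κ (c * mulMap (QuasiHopf.dressMul Q aM aN v D₁ D₂) D₃ t) := by
  induction t using tensor_induction_left with
  | zero => simp
  | add x y hx hy => simp only [map_add, mul_add, hx, hy]
  | tmul m n p =>
    rw [associator_tmul, mulMap_tmul, dressMul_tmul]
    generalize Q.Φ.val = x
    induction x using tensor_induction_right with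
    | zero => simp
    | add x y hx hy => simp only [map_add, mul_add, add_mul, hx, hy]
    | tmul x y z =>
      have := hD₃.apply_mul hκ (c * (D₁ (aM x m) * D₂ (aN y n))) z p
      simp only [mul_assoc] at this
      simp [mul_assoc, this]

theorem RightInvariant.mul_dressMul (hκ : RightInvariant Q v κ) (hM : ∀ m, aM 1 m = m)
    (hN : ∀ n, aN 1 n = n) (c : C) (w : M ⊗[k] N) :
    κ (c * QuasiHopf.dressMul Q aM aN v D₁ D₂ w) = κ (c * mulMap D₁ D₂ w) := by
  induction w using tensor_induction with
  | zero => simp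
  | add x y hx hy => simp only [map_add, mul_add, hx, hy]
  | tmul m n => simpa using (hκ.mulLeft c).dressMul (D := D₁) (D' := D₂) hM hN m n

theorem RightInvariant.mulMap_dressMul (hκ : RightInvariant Q v κ) (hP : ∀ p, aP 1 p = p)
    (hR : ∀ r, aR 1 r = r) (c : C) (t : M ⊗[k] (N ⊗[k] (P ⊗[k] R))) :
    κ (c * mulMap D₁ (mulMap D₂ (QuasiHopf.dressMul Q aP aR v D₃ D₄)) t) =
      κ (c * mulMap D₁ (mulMap D₂ (mulMap D₃ D₄)) t) := by
  induction t using tensor_induction_right with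
  | zero => simp
  | add x y hx hy => simp only [map_add, mul_add, hx, hy]
  | tmul m n w =>
    have := hκ.mul_dressMul (D₁ := D₃) (D₂ := D₄) hP hR (c * (D₁ m * D₂ n)) w
    simp only [mul_assoc] at this
    simp [this]

end Constraint

/-! ### The braided product computed inside a comodule algebra -/

namespace YDAlgebraData

variable {k H : Type*} [Field k] [Ring H] [Algebra k H] {Q : QuasiBialgebra k H}
variable {C C' : Type*} [Ring C] [Algebra k C] [Ring C'] [Algebra k C']
variable {A B : Type*} [AddCommGroup A] [Module k A] [AddCommGroup B] [Module k B]
variable {v : H →ₐ[k] C} {v' : H →ₐ[k] C'} {lam : C →ₐ[k] H ⊗[k] C} {lam' : C' →ₐ[k] H ⊗[k] C'}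
variable {X : YDAlgebraData k H A} {Y : YDAlgebraData k H B} {D : A →ₗ[k] C} {D' : B →ₗ[k] C}
  {V : Type*} [AddCommGroup V] [Module k V] {κ : C →ₗ[k] V}

theorem IsDressing.comp {f : C →ₐ[k] C'} (hD : IsDressing Q v lam X D)
    (hv : ∀ h, f (v h) = v' h)
    (hlam : ∀ c, lam' (f c) = Algebra.TensorProduct.map (AlgHom.id k H) f (lam c)) :
    IsDressing Q v' lam' X (f.toLinearMap ∘ₗ D) where
  intertwines := hD.intertwines.comp hv
  cointertwines := hD.cointertwines.comp hv hlam
  map_mul := fun a b => by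
    rw [dressMul_comp hv, ← hD.map_mul]
    rfl
  map_one := by simp [hD.map_one]

theorem IsDressing.liftDress (hD : IsDressing Q v lam X D) (hX : X.IsAlgebra Q)
    (hC : IsComoduleAlgebra Q v lam) :
    IsDressing Q (comulMap Q v) (coactConj Q v lam) X (liftDress Q X.act v D) where
  intertwines := hD.intertwines.liftDress hX.isYetterDrinfeld.mul_act
  cointertwines := hD.cointertwines.liftDress hX.isYetterDrinfeld.mul_act
    hX.isYetterDrinfeld.compat hC hD.intertwines
  map_mul := fun a b => by
    have hM' := hX.isYetterDrinfeld.mul_act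
    rw [← liftDress_dressMul hM' hM' hD.intertwines, liftDress_apply, liftDress_apply]
    generalize Q.Φ.inv = t
    induction t using tensor_induction_right with
    | zero => simp
    | add x y hx hy => simp only [_root_.map_add, hx, hy]
    | tmul x y z =>
      rw [liftMap_tmul, liftMap_tmul, hX.act_mul]
      have h1 : ∀ w, D (X.mul w) = dressMul Q X.act X.act v D D w := by
        intro w
        induction w using tensor_induction with
        | zero => simp
        | add x y hx hy => simp only [_root_.map_add, hx, hy]
        | tmul a b => exact hD.map_mul a b
      rw [h1]
  map_one := by
    rw [liftDress_apply]
    have h1 := Q.isCounital_Φ_inv.apply_left (liftMap X.act v D X.one) (fun a b c => ?_)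
    · rw [h1, Algebra.TensorProduct.one_def, Algebra.TensorProduct.one_def, liftMap_tmul,
        hX.isYetterDrinfeld.one_act, hD.map_one, _root_.map_one, _root_.mul_one]
      rfl
    · rw [liftMap_tmul, liftMap_tmul, hX.act_one, hX.isYetterDrinfeld.one_act, _root_.map_smul,
        smul_mul_assoc, TensorProduct.smul_tmul']

/-- Under κ every constraint in the braided multiplication becomes a rebracketing in C, and `hcomm`
turns the braiding into an equality of products in the two orders. What remains is the product in C
of the two dressed tensors. -/
theorem IsDressing.braidedTensor_mul (hD : IsDressing Q v lam X D)
    (hD' : IsDressing Q v lam Y D') (hκ : RightInvariant Q v κ) (hX : X.IsAlgebra Q)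
    (hY : Y.IsAlgebra Q)
    (hcomm : ∀ b a, dressMul Q X.act Y.act v D D' (braiding Y.coact X.act (b ⊗ₜ a)) =
      dressMul Q Y.act X.act v D' D (b ⊗ₜ a)) (w w' : A ⊗[k] B) :
    κ (mulMap D D' ((braidedTensor Q X Y).mul (w ⊗ₜ w'))) =
      κ (dressMul Q X.act Y.act v D D' w * dressMul Q X.act Y.act v D D' w') := by
  have hX1 := hX.isYetterDrinfeld.one_act
  have hX2 := hX.isYetterDrinfeld.mul_act
  have hY1 := hY.isYetterDrinfeld.one_act
  have hY2 := hY.isYetterDrinfeld.mul_act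
  have hP := hD.intertwines.dressMul hX2 hY2 hD'.intertwines
  have hP' := hD'.intertwines.dressMul hY2 hY2 hD'.intertwines
  -- Both multiplications are unfolded by the dressings; their Φ-corrections become an associator,
  -- which cancels the inverse one in the definition.
  have h1 : ∀ t : (A ⊗[k] A) ⊗[k] (B ⊗[k] B), κ (mulMap D D' (TensorProduct.map X.mul Y.mul t)) =
      κ (mulMap D (mulMap D (mulMap D' D'))
        (associator Q X.act X.act (tensorAct Q Y.act Y.act) t)) := by
    intro t
    have h2 := hκ.mulMap_dressMul (D₁ := D) (D₂ := D) (D₃ := D') (D₄ := D') hY1 hY1 1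
      (associator Q X.act X.act (tensorAct Q Y.act Y.act) t)
    have h3 := hκ.mulMap_associator (D₁ := D) (D₂ := D) (aM := X.act) (aN := X.act) hP' 1 t
    rw [_root_.one_mul, _root_.one_mul] at h2 h3
    rw [← h2, h3]
    clear h2 h3
    congr 1
    induction t using TensorProduct.induction_on with
    | zero => simp
    | add x y hx hy => simp only [_root_.map_add, hx, hy]
    | tmul p q =>
      rw [TensorProduct.map_tmul, mulMap_tmul, mulMap_tmul]
      congr 1
      · induction p using tensor_induction with
        | zero => simp
        | add x y hx hy => simp only [_root_.map_add, hx, hy]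
        | tmul a b => exact hD.map_mul a b
      · induction q using tensor_induction with
        | zero => simp
        | add x y hx hy => simp only [_root_.map_add, hx, hy]
        | tmul a b => exact hD'.map_mul a b
  -- The middle block: the constraints around the braiding rebracket D D' D', and `hcomm` exchanges
  -- the first two factors.
  have h2 : ∀ (c : C) (s : B ⊗[k] (A ⊗[k] B)), κ (c * mulMap D (mulMap D' D')
      (associator Q X.act Y.act Y.act (TensorProduct.map (braiding Y.coact X.act) LinearMap.id
        (associatorInv Q Y.act X.act Y.act s)))) = κ (c * mulMap D' (mulMap D D') s) := by
    intro c s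
    rw [hκ.mulMap_associator hD'.intertwines]
    have h3 : ∀ t : (B ⊗[k] A) ⊗[k] B, mulMap (dressMul Q X.act Y.act v D D') D'
        (TensorProduct.map (braiding Y.coact X.act) LinearMap.id t) =
        mulMap (dressMul Q Y.act X.act v D' D) D' t := by
      intro t
      induction t using tensor_induction_left with
      | zero => simp
      | add x y hx hy => simp only [_root_.map_add, hx, hy]
      | tmul b a b' =>
        rw [TensorProduct.map_tmul, mulMap_tmul, mulMap_tmul, hcomm]
        rfl
    rw [h3, ← hκ.mulMap_associator hD'.intertwines,
      associator_associatorInv hY1 hY2 hX1 hX2 hY1 hY2]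
  have h3 : ∀ s : A ⊗[k] (B ⊗[k] (A ⊗[k] B)), κ (mulMap D (mulMap D (mulMap D' D'))
      (TensorProduct.map LinearMap.id (associator Q X.act Y.act Y.act)
        (TensorProduct.map LinearMap.id
          (TensorProduct.map (braiding Y.coact X.act) LinearMap.id)
          (TensorProduct.map LinearMap.id (associatorInv Q Y.act X.act Y.act) s)))) =
      κ (mulMap D (mulMap D' (mulMap D D')) s) := by
    intro s
    induction s using TensorProduct.induction_on with
    | zero => simp
    | add x y hx hy => simp only [_root_.map_add, hx, hy]
    | tmul a s =>
      simp only [TensorProduct.map_tmul, mulMap_tmul, LinearMap.id_apply]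
      exact h2 (D a) s
  simp only [braidedTensor, LinearMap.comp_apply]
  rw [h1, associator_associatorInv hX1 hX2 hX1 hX2 (tensorAct_one hY1 hY1)
    (tensorAct_mul hY2 hY2), h3]
  have h4 := hκ.mulMap_dressMul (D₁ := D) (D₂ := D') (D₃ := D) (D₄ := D') hX1 hY1 1
      (associator Q X.act Y.act (tensorAct Q X.act Y.act) (w ⊗ₜ w'))
  have h5 := hκ.mulMap_associator (D₁ := D) (D₂ := D') (aM := X.act) (aN := Y.act) hP 1 (w ⊗ₜ w')
  rw [_root_.one_mul, _root_.one_mul] at h4 h5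
  rw [← h4, h5, mulMap_tmul]

end YDAlgebraData

open QuasiBialgebra

/-! ### Transport of the algebra axioms along an isomorphism -/

namespace YDAlgebraData

variable {k H : Type*} [Field k] [Ring H] [Algebra k H] {Q : QuasiBialgebra k H}
variable {C : Type*} [Ring C] [Algebra k C]
variable {A B : Type*} [AddCommGroup A] [Module k A] [AddCommGroup B] [Module k B]
variable {v : H →ₐ[k] C} {lam : C →ₐ[k] H ⊗[k] C}
variable {X : YDAlgebraData k H A} {Y : YDAlgebraData k H B} {D : B →ₗ[k] C} {κ : C →ₗ[k] B}

theorem IsDressing.comap (hD : IsDressing Q v lam Y D) (e : X.Iso Y) :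
    IsDressing Q v lam X (D ∘ₗ e.toLinearEquiv.toLinearMap) where
  intertwines := fun h m => by
    rw [LinearMap.comp_apply, LinearEquiv.coe_coe, hD.intertwines h]
    generalize Q.comul h = u
    induction u using tensor_induction with
    | zero => simp
    | add x y hx hy => simp only [_root_.map_add, hx, hy]
    | tmul a b => simp [e.map_act]
  cointertwines := fun m => by
    have h1 : ∀ w, dressCoact Q X.act v (D ∘ₗ e.toLinearEquiv.toLinearMap) w =
        dressCoact Q Y.act v D
          (TensorProduct.map LinearMap.id e.toLinearEquiv.toLinearMap w) := by
      intro w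
      induction w using tensor_induction with
      | zero => simp
      | add x y hx hy => simp only [_root_.map_add, hx, hy]
      | tmul g m =>
        rw [TensorProduct.map_tmul, dressCoact_tmul, dressCoact_tmul]
        generalize Q.Φ.val = t
        induction t using tensor_induction_right with
        | zero => simp
        | add x y hx hy => simp only [_root_.map_add, hx, hy]
        | tmul a b c => simp [e.map_act]
    rw [h1, ← e.map_coact, hD.cointertwines]
    generalize Q.Φ.val = t
    induction t using tensor_induction_right with
    | zero => simp
    | add x y hx hy => simp only [_root_.map_add, hx, hy]
    | tmul a b c => simp [e.map_act]
  map_mul := fun a b => by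
    rw [LinearMap.comp_apply, LinearEquiv.coe_coe, e.map_mul, hD.map_mul, dressMul_tmul,
      dressMul_tmul]
    generalize Q.Φ.val = t
    induction t using tensor_induction_right with
    | zero => simp
    | add x y hx hy => simp only [_root_.map_add, hx, hy]
    | tmul a b c => simp [e.map_act]
  map_one := by rw [LinearMap.comp_apply, LinearEquiv.coe_coe, e.map_one, hD.map_one]

/-- A dressing and its retraction pull back along e, so the recognition theorem applies to X. In
this way the braided square needs no direct check of the axioms. -/
theorem IsDressing.isAlgebra_of_iso (hD : IsDressing Q v lam Y D)
    (hC : IsComoduleAlgebra Q v lam) (hκ : RightInvariant Q v κ) (hκD : ∀ m, κ (D m) = m)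
    (e : X.Iso Y) : X.IsAlgebra Q :=
  (hD.comap e).isAlgebra (κ := e.toLinearEquiv.symm.toLinearMap ∘ₗ κ) hC
    (fun c h => by simp [hκ c h]) (fun m => by simp [hκD])

end YDAlgebraData

/-! ### Two copies of H₀ in (H ⊗ H) ⊗ H and the comparison map -/

namespace QuasiHopfAlgebra

variable {k H : Type*} [Field k] [Ring H] [Algebra k H] (Q : QuasiHopfAlgebra k H)

/-- The coaction of `H ⊗ H` as an algebra map. -/
abbrev squareCoactAlg : H ⊗[k] H →ₐ[k] H ⊗[k] (H ⊗[k] H) :=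
  coactConj Q.toQuasiBialgebra (AlgHom.id k H) Q.comul

/-- The algebra map `(Δ ⊗ id) Δ`. -/
abbrev cubeMap : H →ₐ[k] (H ⊗[k] H) ⊗[k] H := comulMap Q.toQuasiBialgebra Q.comul

/-- The coaction of `(H ⊗ H) ⊗ H`. -/
abbrev cubeCoact : (H ⊗[k] H) ⊗[k] H →ₐ[k] H ⊗[k] ((H ⊗[k] H) ⊗[k] H) :=
  coactConj Q.toQuasiBialgebra Q.comul Q.squareCoactAlg

/-- The dressing of `H₀` in `H ⊗ H`. -/
abbrev dressSelf : H →ₗ[k] H ⊗[k] H := Q.dress (AlgHom.id k H)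

/-- The dressing of the left copy of `H₀` in `(H ⊗ H) ⊗ H`. -/
def dressLeft : H →ₗ[k] (H ⊗[k] H) ⊗[k] H :=
  liftDress Q.toQuasiBialgebra Q.H₀.act Q.comul Q.dressSelf

/-- The dressing of the right copy of `H₀` in `(H ⊗ H) ⊗ H`. -/
def dressRight : H →ₗ[k] (H ⊗[k] H) ⊗[k] H :=
  (Algebra.TensorProduct.map Q.comul (AlgHom.id k H)).toLinearMap ∘ₗ Q.dressSelf

theorem dressSelf_isDressing : YDAlgebraData.IsDressing Q.toQuasiBialgebra Q.comul
    Q.squareCoactAlg Q.H₀ Q.dressSelf := by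
  have := Q.twistedAlgebra_isDressing (isComoduleAlgebra_self Q.toQuasiBialgebra)
  rwa [comulMap_id] at this

theorem dressLeft_isDressing : YDAlgebraData.IsDressing Q.toQuasiBialgebra Q.cubeMap
    Q.cubeCoact Q.H₀ Q.dressLeft :=
  Q.dressSelf_isDressing.liftDress Q.H₀_isAlgebra Q.isComoduleAlgebra_square

/-- The comultiplication H → H ⊗ H is itself a map of comodule algebras, so Δ ⊗ id carries the
dressing of H₀ in H ⊗ H to one in the cube. -/
theorem dressRight_isDressing : YDAlgebraData.IsDressing Q.toQuasiBialgebra Q.cubeMap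
    Q.cubeCoact Q.H₀ Q.dressRight :=
  Q.dressSelf_isDressing.comp (fun _ => rfl) (fun z =>
    coactConj_comp (v := AlgHom.id k H) (fun _ => rfl) Q.isComoduleAlgebra_square.lam_v z)

theorem dressRight_eq : Q.dressRight = liftDress Q.toQuasiBialgebra Q.H₀.act Q.comul
    (Q.comul.toLinearMap ∘ₗ Q.flatDress (AlgHom.id k H)) :=
  (liftDress_comp (v := AlgHom.id k H) (fun _ => rfl)).symm

theorem liftMap_Φ_inv_mul (a x : H) (y : H ⊗[k] H) :
    liftMap Q.H₀.act Q.comul Q.dressSelf a (Q.Φ.inv * (x ⊗ₜ y)) =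
      Q.dressLeft (Q.H₀.act x a) * Algebra.TensorProduct.map Q.comul (AlgHom.id k H) y := by
  rw [dressLeft, liftDress_apply, liftMap_act Q.H₀_isAlgebra.isYetterDrinfeld.mul_act]
  generalize Q.Φ.inv = t
  induction t using tensor_induction_right with
  | zero => simp
  | add x y hx hy => simp only [map_add, add_mul, hx, hy]
  | tmul p q r =>
    induction y using tensor_induction with
    | zero => simp
    | add x y hx hy => simp only [map_add, mul_add, TensorProduct.tmul_add, hx, hy]
    | tmul d e => simp [mul_assoc]

/-- The two copies of `H₀` commute up to the braiding. -/
theorem dressMul_braiding (b a : H) :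
    dressMul Q.toQuasiBialgebra Q.H₀.act Q.H₀.act Q.cubeMap Q.dressLeft Q.dressRight
        (braiding Q.H₀.coact Q.H₀.act (b ⊗ₜ a)) =
      dressMul Q.toQuasiBialgebra Q.H₀.act Q.H₀.act Q.cubeMap Q.dressRight Q.dressLeft
        (b ⊗ₜ a) := by
  have hact := Q.H₀_isAlgebra.isYetterDrinfeld.mul_act
  -- The left copy absorbs the right copy into its argument: the product is the lift of a evaluated
  -- at Φ⁻¹ times `dressCoact`, to which the cointertwining relation for b applies.
  have h1 : ∀ w, dressMul Q.toQuasiBialgebra Q.H₀.act Q.H₀.act Q.cubeMap Q.dressLeft Q.dressRight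
      (TensorProduct.map (Q.H₀.act.flip a) LinearMap.id w) =
      liftMap Q.H₀.act Q.comul Q.dressSelf a
        (Q.Φ.inv * dressCoact Q.toQuasiBialgebra Q.H₀.act Q.comul Q.dressSelf w) := by
    intro w
    induction w using tensor_induction with
    | zero => simp
    | add x y hx hy => simp only [map_add, mul_add, hx, hy]
    | tmul g m =>
      rw [TensorProduct.map_tmul, dressMul_tmul, dressCoact_tmul]
      have h2 : ∀ t : H ⊗[k] (H ⊗[k] H), mulMap (Q.dressLeft ∘ₗ Q.H₀.act.flip (Q.H₀.act.flip a g))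
          (mulMap (Q.dressRight ∘ₗ Q.H₀.act.flip ((LinearMap.id : H →ₗ[k] H) m))
            Q.cubeMap.toLinearMap) t =
          liftMap Q.H₀.act Q.comul Q.dressSelf a (Q.Φ.inv *
            TensorProduct.map (LinearMap.mulRight k g)
              (mulMap (Q.dressSelf ∘ₗ Q.H₀.act.flip m) Q.comul.toLinearMap) t) := by
        intro t
        induction t using tensor_induction_right with
        | zero => simp
        | add x y hx hy => simp only [map_add, mul_add, hx, hy]
        | tmul x y z =>
          rw [TensorProduct.map_tmul, liftMap_Φ_inv_mul]
          simp [hact, dressRight, comulMap_apply]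
          rfl
      exact h2 _
  rw [braiding_tmul, h1, Q.dressSelf_isDressing.cointertwines, dressMul_tmul]
  -- The coaction of D(b) is Φ (Δ ⊗ id)(D(b)) Φ⁻¹. Its left factor cancels the Φ⁻¹, and what remains
  -- of it, (Δ ⊗ id)(D(b)), moves out to the left as the right copy of b.
  have h2 : ∀ t : H ⊗[k] (H ⊗[k] H), liftMap Q.H₀.act Q.comul Q.dressSelf a (Q.Φ.inv *
      mulMap (Q.squareCoactAlg.toLinearMap ∘ₗ Q.dressSelf ∘ₗ Q.H₀.act.flip b)
        (TensorProduct.map LinearMap.id Q.comul.toLinearMap) t) =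
      mulMap (Q.dressRight ∘ₗ Q.H₀.act.flip b)
        (mulMap (Q.dressLeft ∘ₗ Q.H₀.act.flip a) Q.cubeMap.toLinearMap) t := by
    intro t
    induction t using tensor_induction_right with
    | zero => simp
    | add x y hx hy => simp only [map_add, mul_add, hx, hy]
    | tmul x y z =>
      have h3 : mapMiddle (AlgHom.id k H) = AlgHom.id k (H ⊗[k] (H ⊗[k] H)) := by
        rw [mapMiddle, Algebra.TensorProduct.map_id, Algebra.TensorProduct.map_id]
      have h4 : ∀ c t, Q.Φ.inv * (Q.squareCoactAlg c * t) = TensorProduct.assoc k H H H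
          (Algebra.TensorProduct.map Q.comul (AlgHom.id k H) c) * (Q.Φ.inv * t) := by
        intro c t
        rw [coactConj_apply, h3, AlgHom.id_apply, AlgHom.id_apply, mul_assoc, mul_assoc,
          ← mul_assoc Q.Φ.inv, Units.inv_val, one_mul]
        rfl
      simp only [mulMap_tmul, LinearMap.comp_apply, TensorProduct.map_tmul,
        AlgHom.toLinearMap_apply, LinearMap.id_apply]
      rw [h4, ← Q.dressSelf_isDressing.intertwines.map_mul_liftMap hact, liftMap_Φ_inv_mul]
      rfl
  exact h2 _

/-- The map `a ⊗ a' ↦ D(x¹ · a) Δ(x² a' S(x³))`. -/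
def squareMap : H ⊗[k] H →ₗ[k] H ⊗[k] H :=
  Q.undress Q.comul ∘ₗ
    dressMul Q.toQuasiBialgebra Q.H₀.act Q.H₀.act Q.cubeMap Q.dressLeft Q.dressRight

/-- By `dressRight_eq` both copies are lifts from H ⊗ H, so their product is a lift and the
universal property applies. Compatibility of `squareMap` with product and coaction can then be
checked in the cube. -/
theorem dress_squareMap (w : H ⊗[k] H) : Q.dress Q.comul (Q.squareMap w) =
    dressMul Q.toQuasiBialgebra Q.H₀.act Q.H₀.act Q.cubeMap Q.dressLeft Q.dressRight w := by
  have h1 := Q.H₀_isAlgebra.isYetterDrinfeld.one_act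
  have h2 := Q.H₀_isAlgebra.isYetterDrinfeld.mul_act
  have h3 : Intertwines Q.toQuasiBialgebra Q.H₀.act Q.comul
      (Q.comul.toLinearMap ∘ₗ Q.flatDress (AlgHom.id k H)) :=
    (Q.flatDress_intertwines (AlgHom.id k H)).comp (fun _ => rfl)
  rw [squareMap, LinearMap.comp_apply, dressLeft, dressRight_eq, ← liftDress_dressMul h2 h2 h3]
  exact Q.dress_undress_liftDress (tensorAct_one h1 h1) (tensorAct_mul h2 h2)
    (Q.dressSelf_isDressing.intertwines.dressMul h2 h2 h3) w

theorem squareMap_eq (w : H ⊗[k] H) :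
    Q.squareMap w = Q.undress Q.comul (mulMap Q.dressLeft Q.dressRight w) := by
  have h1 := Q.H₀_isAlgebra.isYetterDrinfeld.one_act
  have := (Q.undress_rightInvariant Q.comul).mul_dressMul (D₁ := Q.dressLeft)
    (D₂ := Q.dressRight) h1 h1 1 w
  rw [one_mul, one_mul] at this
  rw [squareMap, LinearMap.comp_apply, this]

theorem squareMap_act (h : H) (w : H ⊗[k] H) :
    Q.squareMap (tensorAct Q.toQuasiBialgebra Q.H₀.act Q.H₀.act h w) =
      Q.squareΔ.act h (Q.squareMap w) := by
  have h2 := Q.H₀_isAlgebra.isYetterDrinfeld.mul_act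
  refine Eq.symm ((Q.twistedAct_undress Q.comul h _).trans ?_)
  exact (Q.dressLeft_isDressing.intertwines.dressMul h2 h2
    Q.dressRight_isDressing.intertwines).apply_mul_right (Q.undress_rightInvariant Q.comul) h w

theorem squareMap_coact (w : H ⊗[k] H) :
    Q.squareΔ.coact (Q.squareMap w) = TensorProduct.map LinearMap.id Q.squareMap
      (tensorCoact Q.toQuasiBialgebra Q.H₀.act Q.H₀.coact Q.H₀.act Q.H₀.coact w) := by
  have h1 := Q.H₀_isAlgebra.isYetterDrinfeld.one_act
  have h2 := Q.H₀_isAlgebra.isYetterDrinfeld.mul_act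
  have h3 : Q.squareMap = Q.undress Q.comul ∘ₗ mulMap Q.dressLeft Q.dressRight :=
    LinearMap.ext Q.squareMap_eq
  rw [squareΔ_eq]
  refine (Q.twistedCoact_eq Q.isComoduleAlgebra_square _).trans ?_
  rw [dress_squareMap, h3]
  induction w using tensor_induction with
  | zero => simp
  | add x y hx hy => simp only [map_add, hx, hy]
  | tmul a b =>
    exact map_tensorCoact (Q.undress_rightInvariant Q.comul) h1 h2 h1 h2
      Q.dressLeft_isDressing.cointertwines Q.dressRight_isDressing.intertwines
      Q.dressRight_isDressing.cointertwines Q.isComoduleAlgebra_square.coactConj a b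

theorem squareMap_mul (w w' : H ⊗[k] H) :
    Q.squareMap ((YDAlgebraData.braidedTensor Q.toQuasiBialgebra Q.H₀ Q.H₀).mul (w ⊗ₜ w')) =
      Q.squareΔ.mul (Q.squareMap w ⊗ₜ Q.squareMap w') := by
  rw [squareMap_eq, Q.dressLeft_isDressing.braidedTensor_mul Q.dressRight_isDressing
    (Q.undress_rightInvariant Q.comul) Q.H₀_isAlgebra Q.H₀_isAlgebra Q.dressMul_braiding,
    ← dress_squareMap, ← dress_squareMap, ← twistedMul_eq]
  simp [squareΔ, twistedAlgebra]

theorem squareMap_one : Q.squareMap (Q.β ⊗ₜ Q.β) = Q.comul Q.β := by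
  have h1 : Q.dressLeft Q.β = 1 := Q.dressLeft_isDressing.map_one
  have h2 : Q.dressRight Q.β = 1 := Q.dressRight_isDressing.map_one
  rw [squareMap_eq, mulMap_tmul, h1, h2, one_mul, Algebra.TensorProduct.one_def, undress_tmul,
    Q.S_one, map_one, mul_one, one_mul]

/-! ### Bijectivity of the comparison map -/

/-- `a ⊗ h ↦ D(a) Δ(h)`. -/
def dressComul : H ⊗[k] H →ₗ[k] H ⊗[k] H := mulMap Q.dressSelf Q.comul.toLinearMap

/-- `x ⊗ y ⊗ z` acts on `a ⊗ b` as `(x · a) ⊗ y b S(z)`. -/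
def pairAct : H ⊗[k] (H ⊗[k] H) →ₗ[k] H ⊗[k] H →ₗ[k] H ⊗[k] H :=
  TensorProduct.map₂ Q.H₀.act (bimul ∘ₗ TensorProduct.map LinearMap.id Q.S.toLinearMap)

@[simp]
theorem pairAct_tmul (x y z a b : H) :
    Q.pairAct (x ⊗ₜ (y ⊗ₜ z)) (a ⊗ₜ b) = Q.H₀.act x a ⊗ₜ (y * b * Q.S z) := by
  simp [pairAct]

theorem pairAct_mul (s t : H ⊗[k] (H ⊗[k] H)) (w : H ⊗[k] H) :
    Q.pairAct (s * t) w = Q.pairAct s (Q.pairAct t w) := by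
  induction w using tensor_induction with
  | zero => simp
  | add x y hx hy => simp only [map_add, hx, hy]
  | tmul a b =>
    induction s using tensor_induction_right with
    | zero => simp
    | add x y hx hy => simp only [map_add, add_mul, LinearMap.add_apply, hx, hy]
    | tmul x y z =>
      induction t using tensor_induction_right with
      | zero => simp
      | add x y hx hy => simp only [map_add, mul_add, LinearMap.add_apply, hx, hy]
      | tmul p q r =>
        simp [Q.H₀_isAlgebra.isYetterDrinfeld.mul_act, Q.S_mul, mul_assoc]

theorem pairAct_one (w : H ⊗[k] H) : Q.pairAct 1 w = w := by
  rw [Algebra.TensorProduct.one_def, Algebra.TensorProduct.one_def]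
  induction w using tensor_induction with
  | zero => simp
  | add x y hx hy => simp only [map_add, hx, hy]
  | tmul a b => simp [Q.H₀_isAlgebra.isYetterDrinfeld.one_act, Q.S_one]

/-- Undressing leaves the left copy D(x¹·a) Δ(x²) untouched, turns the last leg x³ into Δ(S(x³)) on
the far right, and recovers Δ(b) from the right copy. -/
theorem squareMap_eq_dressComul (w : H ⊗[k] H) :
    Q.squareMap w = Q.dressComul (Q.pairAct Q.Φ.inv w) := by
  rw [squareMap_eq]
  induction w using tensor_induction with
  | zero => simp
  | add x y hx hy => simp only [map_add, hx, hy]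
  | tmul a b =>
    rw [mulMap_tmul, dressLeft, liftDress_apply]
    generalize Q.Φ.inv = t
    induction t using tensor_induction_right with
    | zero => simp
    | add x y hx hy => simp only [map_add, add_mul, LinearMap.add_apply, hx, hy]
    | tmul x y z =>
      have h1 : Q.undress Q.comul (Q.dressRight b) = Q.comul b := by
        have h2 : ∀ u, Q.undress Q.comul (Algebra.TensorProduct.map Q.comul (AlgHom.id k H) u) =
            Q.comul (Q.undress (AlgHom.id k H) u) := by
          intro u
          induction u using tensor_induction with
          | zero => simp
          | add x y hx hy => simp only [map_add, hx, hy]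
          | tmul c d => simp
        rw [dressRight, LinearMap.comp_apply, AlgHom.toLinearMap_apply, h2, undress_dress]
      have h3 : ∀ (c : H ⊗[k] H) (z : H), c ⊗ₜ[k] z = (c ⊗ₜ 1) * (1 ⊗ₜ z) := by simp
      rw [liftMap_tmul, h3, mul_assoc, undress_tmul_one_mul, undress_one_tmul_mul, h1]
      simp [dressComul, mul_assoc]

theorem dressSelf_apply (a : H) : Q.dressSelf a =
    liftMap Q.H₀.act (AlgHom.id k H) (Q.flatDress (AlgHom.id k H)) a Q.Φ.inv :=
  liftDress_apply a

/-- `Φ⁻¹ (id ⊗ Δ)(D(a)) Φ` is the dressing of `a` in the left copy. -/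
theorem assoc_dressLeft (a : H) : TensorProduct.assoc k H H H (Q.dressLeft a) =
    Q.Φ.inv * (Algebra.TensorProduct.map (AlgHom.id k H) Q.comul (Q.dressSelf a) * Q.Φ.val) := by
  have hact := Q.H₀_isAlgebra.isYetterDrinfeld.mul_act
  let E := Q.flatDress (AlgHom.id k H)
  have hE : Intertwines Q.toQuasiBialgebra Q.H₀.act (AlgHom.id k H) E :=
    Q.flatDress_intertwines (AlgHom.id k H)
  -- W sends p ⊗ q ⊗ u to E(p·a) q ⊗ u. Both sides of the claim are values of W, and the two
  -- arguments agree by the pentagon.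
  let W : H ⊗[k] (H ⊗[k] (H ⊗[k] H)) →ₗ[k] H ⊗[k] (H ⊗[k] H) :=
    mulMap ((TensorProduct.mk k H (H ⊗[k] H)).flip 1 ∘ₗ E ∘ₗ Q.H₀.act.flip a) LinearMap.id
  have hW : ∀ p q u, W (p ⊗ₜ (q ⊗ₜ u)) = (E (Q.H₀.act p a) * q) ⊗ₜ u := by
    intro p q u
    simp [W]
  have h1 : ∀ y t, y * W t = W (Q.comulFst y * t) := by
    intro y t
    induction y using TensorProduct.induction_on with
    | zero => simp
    | add x y hx hy => simp only [map_add, add_mul, hx, hy]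
    | tmul y u =>
      induction t using tensor_induction_right with
      | zero => simp
      | add x y hx hy => simp only [map_add, mul_add, hx, hy]
      | tmul p q w =>
        have h2 := hE y (Q.H₀.act p a)
        rw [AlgHom.id_apply] at h2
        rw [hW, Algebra.TensorProduct.tmul_mul_tmul, ← mul_assoc, h2, comulFst_tmul]
        generalize Q.comul y = x
        induction x using tensor_induction with
        | zero => simp
        | add x y hx hy => simp only [map_add, add_mul, TensorProduct.add_tmul, hx, hy]
        | tmul d e => simp [hW, hact, mul_assoc]
  have h2 : ∀ t u, W t * u = W (t * inclTail u) := by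
    intro t u
    simp only [W]
    induction t using TensorProduct.induction_on with
    | zero => simp
    | add x y hx hy => simp only [map_add, add_mul, hx, hy]
    | tmul p t => simp [mul_assoc]
  have h3 : ∀ t, Algebra.TensorProduct.map (AlgHom.id k H) Q.comul
      (liftMap Q.H₀.act (AlgHom.id k H) E a t) = W (Q.comulThd t) := by
    intro t
    induction t using tensor_induction_right with
    | zero => simp
    | add x y hx hy => simp only [map_add, hx, hy]
    | tmul x y z => simp [hW]
  have h4 : ∀ t, TensorProduct.assoc k H H H (liftMap Q.H₀.act Q.comul Q.dressSelf a t) =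
      W (inclInit Q.Φ.inv * Q.comulSnd t) := by
    intro t
    induction t using tensor_induction_right with
    | zero => simp
    | add x y hx hy => simp only [map_add, mul_add, hx, hy]
    | tmul x y z =>
      rw [liftMap_tmul, dressSelf_apply, liftMap_act hact, comulSnd_tmul]
      generalize Q.comul y = u
      generalize Q.Φ.inv = w
      induction u using tensor_induction with
      | zero => simp
      | add x y hx hy =>
        simp only [map_add, mul_add, TensorProduct.add_tmul, TensorProduct.tmul_add, hx, hy]
      | tmul d e =>
        induction w using tensor_induction_right with
        | zero => simp
        | add x y hx hy => simp only [map_add, add_mul, TensorProduct.add_tmul, hx, hy]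
        | tmul p q r => simp [hW, E, mul_assoc]
  rw [dressLeft, liftDress_apply, h4, dressSelf_apply, h3, h2, h1, comulThd_inv_mul_inclTail,
    ← mul_assoc, ← map_mul, Units.inv_val, map_one, one_mul]

/-- The map r carries D(a) Δ(h) to `dressLeft` a times (Δ ⊗ id)Δ(h), by `assoc_dressLeft` and
quasi-coassociativity. Undressing the inner H ⊗ H then kills Δ(h₁) up to ε(h₁), and the middle leg
of Φ⁻¹ in `dressLeft` a likewise, so a ⊗ h comes back. -/
theorem dressComul_injective : Function.Injective Q.dressComul := by
  have h1 := Q.H₀_isAlgebra.isYetterDrinfeld.one_act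
  let r : H ⊗[k] H →ₗ[k] (H ⊗[k] H) ⊗[k] H := (TensorProduct.assoc k H H H).symm.toLinearMap ∘ₗ
    LinearMap.mulRight k Q.Φ.val ∘ₗ LinearMap.mulLeft k Q.Φ.inv ∘ₗ
    (Algebra.TensorProduct.map (AlgHom.id k H) Q.comul).toLinearMap
  let L : H ⊗[k] H →ₗ[k] H ⊗[k] H := TensorProduct.map (Q.undress (AlgHom.id k H))
    LinearMap.id ∘ₗ r
  have hκ : RightInvariant Q.toQuasiBialgebra Q.comul (Q.undress (AlgHom.id k H)) := by
    have := Q.undress_rightInvariant (AlgHom.id k H)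
    rwa [comulMap_id] at this
  have hr : ∀ a h, r (Q.dressSelf a * Q.comul h) = Q.dressLeft a *
      Algebra.TensorProduct.map Q.comul (AlgHom.id k H) (Q.comul h) := by
    intro a h
    apply (TensorProduct.assoc k H H H).injective
    simp only [r, LinearMap.comp_apply, LinearMap.mulRight_apply, LinearMap.mulLeft_apply,
      AlgHom.toLinearMap_apply, LinearEquiv.coe_coe, LinearEquiv.apply_symm_apply]
    rw [assoc_mul, assoc_dressLeft, map_mul]
    simp only [mul_assoc]
    rw [Φ_mul_comul]
  refine Function.LeftInverse.injective (g := L) fun w => ?_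
  induction w using tensor_induction with
  | zero => simp
  | add x y hx hy => simp only [map_add, hx, hy]
  | tmul a h =>
    have h3 : ∀ c : (H ⊗[k] H) ⊗[k] H, TensorProduct.map (Q.undress (AlgHom.id k H)) LinearMap.id
        (c * Algebra.TensorProduct.map Q.comul (AlgHom.id k H) (Q.comul h)) =
        TensorProduct.map (Q.undress (AlgHom.id k H)) LinearMap.id c * (1 ⊗ₜ h) := by
      intro c
      induction c using TensorProduct.induction_on with
      | zero => simp
      | add x y hx hy => simp only [map_add, add_mul, hx, hy]
      | tmul c d =>
        have := Q.comul_counit_left (TensorProduct.map (Q.undress (AlgHom.id k H))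
          LinearMap.id ∘ₗ LinearMap.mulLeft k (c ⊗ₜ d) ∘ₗ
          (Algebra.TensorProduct.map Q.comul (AlgHom.id k H)).toLinearMap) (fun x y => ?_) h
        · simp only [LinearMap.comp_apply, LinearMap.mulLeft_apply, AlgHom.toLinearMap_apply,
            Algebra.TensorProduct.map_tmul, AlgHom.coe_id, id_eq, map_one] at this
          rw [this]
          simp
        · simp [hκ c x, TensorProduct.smul_tmul']
    have h4 : TensorProduct.map (Q.undress (AlgHom.id k H)) LinearMap.id (Q.dressLeft a) =
        a ⊗ₜ 1 := by
      rw [dressLeft, liftDress_apply]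
      have := Q.isCounital_Φ_inv.apply_middle (TensorProduct.map (Q.undress (AlgHom.id k H))
        LinearMap.id ∘ₗ liftMap Q.H₀.act Q.comul Q.dressSelf a) (fun x y z => ?_)
      · rw [Algebra.TensorProduct.one_def, Algebra.TensorProduct.one_def, LinearMap.comp_apply,
          LinearMap.comp_apply, liftMap_tmul, h1, map_one Q.comul, mul_one, TensorProduct.map_tmul,
          undress_dress] at this
        exact this
      · simp [hκ _ y, TensorProduct.smul_tmul']
    simp only [L, LinearMap.comp_apply, dressComul, mulMap_tmul, AlgHom.toLinearMap_apply]
    rw [hr, h3, h4]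
    simp

theorem sandwichMap_id_tmul (a x : H) (u : H ⊗[k] H) :
    sandwichMap (AlgHom.id k H) a (x ⊗ₜ u) = ((x * a) ⊗ₜ 1) * u := by
  induction u using tensor_induction with
  | zero => simp
  | add x y hx hy => simp only [map_add, mul_add, TensorProduct.tmul_add, hx, hy]
  | tmul c d => simp

/-- Writing D through `qL` gives D(a) Δ(h) = (X¹ a S(X²) ⊗ 1) `qL` Δ(X³ h). As Φ is invertible, the
range contains every (c ⊗ 1) `qL` Δ(l), and by `qLMap_comul` also every (c ⊗ h) `qL` Δ(l).
Multiplying D(β) = 1 on the left by u ⊗ h then exhibits u ⊗ h in the range. -/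
theorem dressComul_surjective : Function.Surjective Q.dressComul := by
  rw [← LinearMap.range_eq_top, eq_top_iff]
  have h1 : ∀ c l : H, (c ⊗ₜ 1) * Q.qL * Q.comul l ∈ LinearMap.range Q.dressComul := by
    intro c l
    let F : H ⊗[k] (H ⊗[k] H) →ₗ[k] H ⊗[k] H :=
      mulMap (LinearMap.mulRight k Q.qL ∘ₗ (TensorProduct.mk k H H).flip 1 ∘ₗ bimul.flip c ∘ₗ
        TensorProduct.map LinearMap.id Q.S.toLinearMap)
        (Q.comul.toLinearMap ∘ₗ LinearMap.mulRight k l) ∘ₗ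
        (TensorProduct.assoc k H H H).symm.toLinearMap
    have hF : ∀ x y z, F (x ⊗ₜ (y ⊗ₜ z)) =
        ((x * c * Q.S y) ⊗ₜ 1) * Q.qL * Q.comul (z * l) := by
      intro x y z
      simp [F]
    have h2 : ∀ t, F (Q.Φ.val * t) ∈ LinearMap.range Q.dressComul := by
      intro t
      induction t using tensor_induction_right with
      | zero => simp
      | add x y hx hy => rw [mul_add, map_add]; exact add_mem hx hy
      | tmul x y z =>
        refine ⟨(x * c * Q.S y) ⊗ₜ (z * l), ?_⟩
        rw [dressComul, mulMap_tmul, dressSelf, dress_apply, elementD_eq_qLMap]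
        generalize Q.Φ.val = w
        induction w using tensor_induction_right with
        | zero => simp
        | add x y hx hy => simp only [map_add, add_mul, hx, hy]
        | tmul p q r =>
          simp only [TensorProduct.map_tmul, LinearMap.id_apply, sandwichMap_id_tmul, qLMap_tmul,
            AlgHom.toLinearMap_apply, Algebra.TensorProduct.tmul_mul_tmul, hF, Q.S_mul, map_mul]
          simp only [← mul_assoc, Algebra.TensorProduct.tmul_mul_tmul, mul_one]
    -- At t = Φ⁻¹ the argument of F becomes 1.
    have h3 := h2 Q.Φ.inv
    rw [Units.val_inv, Algebra.TensorProduct.one_def, Algebra.TensorProduct.one_def, hF, Q.S_one,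
      mul_one, one_mul, one_mul] at h3
    exact h3
  have h2 : ∀ (c l : H) (t : H ⊗[k] H),
      (c ⊗ₜ 1) * Q.qLMap t * Q.comul l ∈ LinearMap.range Q.dressComul := by
    intro c l t
    induction t using tensor_induction with
    | zero => simp
    | add x y hx hy => rw [map_add, mul_add, add_mul]; exact add_mem hx hy
    | tmul x y =>
      have h3 := h1 (c * Q.S x) (y * l)
      have h4 : ((c * Q.S x) ⊗ₜ[k] (1 : H)) = (c ⊗ₜ 1) * (Q.S x ⊗ₜ 1) := by simp
      rw [h4, map_mul] at h3
      simpa only [qLMap_tmul, mul_assoc] using h3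
  intro z _
  induction z using tensor_induction with
  | zero => simp
  | add x y hx hy => exact add_mem (hx trivial) (hy trivial)
  | tmul u h =>
    have h3 : ∀ t, (u ⊗ₜ h) * sandwichMap (AlgHom.id k H) Q.β
        (TensorProduct.map LinearMap.id Q.qLMap t) ∈ LinearMap.range Q.dressComul := by
      intro t
      induction t using tensor_induction_right with
      | zero => simp
      | add x y hx hy => rw [map_add, map_add, mul_add]; exact add_mem hx hy
      | tmul x y z =>
        -- Choosing Δ(h) as the tensor puts h into the second leg, since S(h₁) q¹ h₂ ⊗ q² h₃ = q¹ ⊗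
        -- h q² for q = `qL`.
        have h4 := h2 (u * x * Q.β * Q.S y) z (Q.comul h)
        rw [qLMap_comul] at h4
        have h5 : (u ⊗ₜ[k] h) * (((x * Q.β) ⊗ₜ 1) * ((Q.S y ⊗ₜ 1) * Q.qL * Q.comul z)) =
            ((u * x * Q.β * Q.S y) ⊗ₜ 1) * ((1 ⊗ₜ h) * Q.qL) * Q.comul z := by
          simp only [← mul_assoc, Algebra.TensorProduct.tmul_mul_tmul, mul_one, one_mul]
        rw [TensorProduct.map_tmul, LinearMap.id_apply, sandwichMap_id_tmul, qLMap_tmul, h5]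
        exact h4
    have h4 := h3 Q.Φ.val
    have h5 := Q.dress_β (AlgHom.id k H)
    rw [AlgHom.id_apply, dress_apply, elementD_eq_qLMap] at h5
    rwa [h5, mul_one] at h4

theorem squareMap_bijective : Function.Bijective Q.squareMap := by
  have h1 : ⇑Q.squareMap = Q.dressComul ∘ Q.pairAct Q.Φ.inv :=
    funext fun w => Q.squareMap_eq_dressComul w
  rw [h1]
  refine Function.Bijective.comp ⟨Q.dressComul_injective, Q.dressComul_surjective⟩ ?_
  refine Function.bijective_iff_has_inverse.2 ⟨Q.pairAct Q.Φ.val, fun w => ?_, fun w => ?_⟩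
  · rw [← pairAct_mul, Units.val_inv, pairAct_one]
  · rw [← pairAct_mul, Units.inv_val, pairAct_one]

/-- The isomorphism of the braided square of `H₀` with `(H ⊗ H)^Δ`. -/
def squareIso :
    (YDAlgebraData.braidedTensor Q.toQuasiBialgebra Q.H₀ Q.H₀).Iso Q.squareΔ where
  toLinearEquiv := LinearEquiv.ofBijective Q.squareMap Q.squareMap_bijective
  map_act := Q.squareMap_act
  map_coact := Q.squareMap_coact
  map_mul := Q.squareMap_mul
  map_one := Q.squareMap_one

theorem braidedTensor_isAlgebra :
    (YDAlgebraData.braidedTensor Q.toQuasiBialgebra Q.H₀ Q.H₀).IsAlgebra Q.toQuasiBialgebra := by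
  have h1 := Q.twistedAlgebra_isDressing Q.isComoduleAlgebra_square
  rw [← squareΔ_eq] at h1
  exact h1.isAlgebra_of_iso Q.isComoduleAlgebra_square.coactConj (Q.undress_rightInvariant Q.comul)
    (Q.undress_dress Q.comul) Q.squareIso

end QuasiHopfAlgebra

end QuasiHopf

end

theorem proposition5p7 {k H : Type*} [Field k] [Ring H] [Algebra k H]
    (Q : QuasiHopf.QuasiHopfAlgebra k H) :
    Q.H₀.IsAlgebra Q.toQuasiBialgebra ∧
      (QuasiHopf.YDAlgebraData.braidedTensor Q.toQuasiBialgebra Q.H₀ Q.H₀).IsAlgebra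
        Q.toQuasiBialgebra ∧
      Q.squareΔ.IsAlgebra Q.toQuasiBialgebra ∧
      Nonempty
        ((QuasiHopf.YDAlgebraData.braidedTensor Q.toQuasiBialgebra Q.H₀ Q.H₀).Iso Q.squareΔ) := by
  exact ⟨Q.H₀_isAlgebra, Q.braidedTensor_isAlgebra, Q.squareΔ_isAlgebra, ⟨Q.squareIso⟩⟩
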